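/- Let $k\ge 3$ be an integer and let $1/2<\gamma_k<\dots<\gamma_1<1$ be fixed real numbers. Put $\sigma_k=k-(\gamma_1+\dots+\gamma_k)$ and $$\varpi_3=\tfrac1{36},\qquad \varpi_4=\tfrac1{64},\qquad \varpi_5=\tfrac1{90},\qquad \varpi_k=\tfrac1{3k^2}\ (k\ge 6).$$ Let $0\le\delta<1/2$ satisfy $$12\,\sigma_3+52\,\delta<1-\varpi_3\quad\text{if }k=3,\qquad 4k\,\sigma_k+4k(k+1)\,\delta<1-\varpi_k\quad\text{if }k\ge4 .$$ Write $e(x)=e^{2\pi i x}$ and let $\Lambda$ be von Mangoldt's function. Then for every sufficiently small $\varepsilon>0$ (in terms of $k,\gamma_1,\dots,\gamma_k,\delta$) and every $A\ge 1$ one has $$\sum_{X<n\le X_1}\Lambda(n)\,e\big(\alpha n+h_1n^{\gamma_1}+\dots+h_kn^{\gamma_k}\big)\ll X^{1-\sigma_k-(k+1)\delta-(k+2)\varepsilon}$$ for all real $X\ge 1$, all real $X_1$ with $X<X_1\le AX$, all real $\alpha$, and all integers $h_1,\dots,h_k$ with $1\le|h_j|\le X^{1-\gamma_j+\delta+\varepsilon}$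 $(1\le j\le k)$. The implied constant depends only on $k,\gamma_1,\dots,\gamma_k,\delta,\varepsilon$ and $A$; in particular the bound is uniform in $\alpha$, $h_1,\dots,h_k$, $X$ and $X_1$. -/

import Mathlib

/-- The additive character `e(x) = exp(2 π i x)`. -/
noncomputable def expChar (x : ℝ) : ℂ :=
  Complex.exp (2 * (Real.pi : ℂ) * Complex.I * (x : ℂ))

/-- `σ_k = k - (γ₁ + ⋯ + γ_k)`. -/
noncomputable def sigmaDef (k : ℕ) (γ : Fin k → ℝ) : ℝ :=
  (k : ℝ) - ∑ j, γ j

/-- `ϖ_3 = 1/3 · 1/12`, `ϖ_4 = 1/4 · 1/16`, `ϖ_5 = 1/5 · 1/18`, and `ϖ_k = 1/k · 1/(3k)` for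
`k ≥ 6` (only `k ≥ 3` matters). -/
noncomputable def varpi (k : ℕ) : ℝ :=
  if k = 3 then 1 / 3 * (1 / 12)
  else if k = 4 then 1 / 4 * (1 / 16)
  else if k = 5 then 1 / 5 * (1 / 18)
  else 1 / (k : ℝ) * (1 / (3 * (k : ℝ)))

/-- The coefficient `Ω(k) = 4k` of `σ_k` (so `Ω(3) = 12`). -/
noncomputable def Omega (k : ℕ) : ℝ := 4 * (k : ℝ)

/-- The coefficient of `δ`: `Ω_*(3) = 52`, and `Ω_*(k) = 4k(k+1)` for `k ≥ 4`. -/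
noncomputable def OmegaStar (k : ℕ) : ℝ :=
  if k = 3 then 52 else 4 * (k : ℝ) * ((k : ℝ) + 1)

/-- `𝒯_k(X) = ∑_{X < n ≤ X₁} Λ(n) e(α n + h₁ n^{γ₁} + ⋯ + h_k n^{γ_k})`, for `X, X₁ ≥ 0`. -/
noncomputable def mangoldtExpSum (k : ℕ) (γ : Fin k → ℝ) (h : Fin k → ℤ) (α X X₁ : ℝ) : ℂ :=
  ∑ n ∈ Finset.Ioc ⌊X⌋₊ ⌊X₁⌋₊,
    ((ArithmeticFunction.vonMangoldt n : ℝ) : ℂ) *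
      expChar (α * (n : ℝ) + ∑ j, (h j : ℝ) * (n : ℝ) ^ γ j)

/-! The phase is f(x) = αx + Σ h_j x^{γ_j}. Only second derivatives enter, so α drops out and
uniformity in it is free. Everything rests on G₁ = x²f'' and G₂ = xG₁', which are combinations of
the powers x^{γ_j} with coefficients h_jγ_j(γ_j-1) and h_jγ_j²(γ_j-1).

Suppose |G₁| and |G₂| stay in dyadic ranges [κ₁, 2κ₁] and [κ₂, 2κ₂] with constant signs. Vaughan's
identity with cut-off U ≈ X^{1/3} then reduces the sum to bilinear ones. In a type I sum, l ↦ f(ml)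
has second derivative G₁(ml)/l², and van der Corput's test applies. In a type II sum, Cauchy–Schwarz
in blocks of length Q ≈ X^q leaves m ↦ f(ml') - f(ml), whose second derivative is (l'-l)/m · G₂(ξ)/ξ
by the mean value theorem (`norm_vonMangoldt_sum_le`).

The h_j are arbitrary, so cancellation may make G₁ or G₂ small. In t = log(x/X) each is an
exponential sum Σ b_γ e^{γt} with k exponents. By Rolle it takes a nonzero value at most k+1 times,
so O(log X) break points cut the interval into pieces on which it either lies in a dyadic range or
is O(2^{-I} Σ|b_γ|). In the latter case the piece has length O(X 2^{-I/k}), because an exponential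
sum reaches size ≫ ℓ^k Σ|b_γ| on every interval of length ℓ (`exists_subinterval_expPoly_large`,
`exists_breakpoints`), and the trivial bound suffices.

Put η = σ + (k+1)δ + (k+2)ε, q = 2η + 20ε and 2^{-I} ≈ X^{-kq/2}. Up to constants Σ|b_γ| lies
between X^{1-σ} and X^{1+δ+ε}, so the levels lie between X^{1-σ-kq/2} and X^{1+δ+ε}. The loss
X^{-kq/2} at the bottom is why the condition on σ and δ tightens with k (`exponent_conditions`). -/

open Finset

/-! ### The additive character and the Kusmin–Landau inequality -/

lemma expChar_add (x y : ℝ) : expChar (x + y) = expChar x * expChar y := by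
  simp only [expChar, ← Complex.exp_add]
  congr 1
  push_cast
  ring

lemma expChar_eq (x : ℝ) : expChar x = Complex.exp ((2 * Real.pi * x : ℝ) * Complex.I) := by
  simp only [expChar]
  congr 1
  push_cast
  ring

@[simp] lemma norm_expChar (x : ℝ) : ‖expChar x‖ = 1 := by
  rw [expChar_eq, Complex.norm_exp_ofReal_mul_I]

lemma expChar_neg (x : ℝ) : expChar (-x) = (starRingEnd ℂ) (expChar x) := by
  rw [expChar_eq, expChar_eq, ← Complex.exp_conj]
  congr 1
  simp only [map_mul, Complex.conj_I, Complex.conj_ofReal]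
  push_cast
  ring

lemma expChar_mul_conj (x y : ℝ) :
    expChar x * (starRingEnd ℂ) (expChar y) = expChar (x - y) := by
  rw [← expChar_neg, ← expChar_add, sub_eq_add_neg]

lemma norm_sum_expChar_le_card (s : Finset ℕ) (F : ℕ → ℝ) :
    ‖∑ n ∈ s, expChar (F n)‖ ≤ #s := by
  refine (norm_sum_le _ _).trans ?_
  simp

lemma norm_sum_expChar_neg (s : Finset ℕ) (F : ℕ → ℝ) :
    ‖∑ n ∈ s, expChar (-F n)‖ = ‖∑ n ∈ s, expChar (F n)‖ := by
  simp only [expChar_neg]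
  rw [← map_sum, RCLike.norm_conj]

/-- The coefficient `1 / (1 - e(d))`, in real and imaginary parts. -/
noncomputable def kusminCoeff (d : ℝ) : ℂ :=
  1 / 2 + Complex.I / 2 * ((Real.cos (Real.pi * d) / Real.sin (Real.pi * d) : ℝ) : ℂ)

lemma kusminCoeff_mul (d : ℝ) (hd : Real.sin (Real.pi * d) ≠ 0) :
    kusminCoeff d * (1 - expChar d) = 1 := by
  have h2 : expChar d = ((1 - 2 * Real.sin (Real.pi * d) ^ 2 : ℝ) : ℂ)
      + ((2 * Real.sin (Real.pi * d) * Real.cos (Real.pi * d) : ℝ) : ℂ) * Complex.I := by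
    rw [expChar_eq, Complex.exp_mul_I, ← Complex.ofReal_cos, ← Complex.ofReal_sin,
      mul_assoc 2 Real.pi d, Real.sin_two_mul, Real.cos_two_mul, ← Real.cos_sq_add_sin_sq (Real.pi * d)]
    push_cast
    ring
  have hs : ((Real.sin (Real.pi * d) : ℝ) : ℂ) ≠ 0 := by exact_mod_cast hd
  have hsc : ((Real.sin (Real.pi * d) : ℝ) : ℂ) ^ 2 + ((Real.cos (Real.pi * d) : ℝ) : ℂ) ^ 2 = 1 := by
    exact_mod_cast Real.sin_sq_add_cos_sq (Real.pi * d)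
  rw [h2, kusminCoeff]
  push_cast at hs hsc ⊢
  field_simp
  linear_combination (2 * Complex.sin (Real.pi * d)) * hsc -
    2 * Complex.sin (Real.pi * d) * Complex.cos (Real.pi * d) ^ 2 * Complex.I_sq

lemma two_mul_le_sin {d θ : ℝ} (hθ : 0 < θ) (h1 : θ ≤ d) (h2 : d ≤ 1 - θ) :
    2 * θ ≤ Real.sin (Real.pi * d) := by
  have hpi := Real.pi_pos
  rcases le_total d (1 / 2) with h | h
  · have := Real.mul_le_sin (x := Real.pi * d) (by positivity [hθ.trans_le h1]) (by nlinarith)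
    have e : 2 / Real.pi * (Real.pi * d) = 2 * d := by field_simp
    linarith
  · have := Real.mul_le_sin (x := Real.pi - Real.pi * d) (by nlinarith) (by nlinarith)
    have e : 2 / Real.pi * (Real.pi - Real.pi * d) = 2 * (1 - d) := by field_simp
    rw [Real.sin_pi_sub] at this
    linarith

lemma abs_cot_le {d θ : ℝ} (hθ : 0 < θ) (h1 : θ ≤ d) (h2 : d ≤ 1 - θ) :
    |Real.cos (Real.pi * d) / Real.sin (Real.pi * d)| ≤ 1 / (2 * θ) := by
  have hs := two_mul_le_sin hθ h1 h2
  have hs0 : 0 < Real.sin (Real.pi * d) := by linarith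
  rw [abs_div, abs_of_pos hs0]
  exact div_le_div₀ zero_le_one (Real.abs_cos_le_one _) (by positivity) hs

lemma norm_kusminCoeff_le {d θ : ℝ} (hθ : 0 < θ) (h1 : θ ≤ d) (h2 : d ≤ 1 - θ) :
    ‖kusminCoeff d‖ ≤ 1 / (2 * θ) := by
  have h := abs_cot_le hθ h1 h2
  have hθ2 : θ ≤ 1 / 2 := by linarith
  have h3 : 1 ≤ 1 / (2 * θ) := by
    rw [le_div_iff₀ (by positivity)]; linarith
  refine (norm_add_le _ _).trans ?_
  rw [norm_mul, norm_div, norm_div, Complex.norm_I, Complex.norm_real, Real.norm_eq_abs]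
  norm_num
  norm_num at h h3
  linarith

/-- Cross-multiplying turns the claim into sin(π(y - x)) ≥ 0. -/
lemma cot_antitone {x y : ℝ} (h0 : 0 < x) (hxy : x ≤ y) (h1 : y < 1) :
    Real.cos (Real.pi * y) / Real.sin (Real.pi * y) ≤
      Real.cos (Real.pi * x) / Real.sin (Real.pi * x) := by
  have hpi := Real.pi_pos
  have hx : 0 < Real.sin (Real.pi * x) :=
    Real.sin_pos_of_pos_of_lt_pi (by positivity) (by nlinarith)
  have hy : 0 < Real.sin (Real.pi * y) :=
    Real.sin_pos_of_pos_of_lt_pi (by nlinarith) (by nlinarith)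
  rw [div_le_div_iff₀ hy hx]
  have h : 0 ≤ Real.sin (Real.pi * y - Real.pi * x) :=
    Real.sin_nonneg_of_nonneg_of_le_pi (by nlinarith) (by nlinarith)
  rw [Real.sin_sub] at h
  linarith

/-- The Kusmin–Landau inequality for differences lying in `[θ, 1 - θ]`. -/
lemma kusmin_landau_aux (F : ℕ → ℝ) (a b : ℕ) {θ : ℝ} (hθ : 0 < θ)
    (hlow : ∀ n ∈ Ico a b, θ ≤ F (n + 1) - F n)
    (hup : ∀ n ∈ Ico a b, F (n + 1) - F n ≤ 1 - θ)
    (hmono : ∀ n, a ≤ n → n + 1 < b → F (n + 1) - F n ≤ F (n + 2) - F (n + 1)) :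
    ‖∑ n ∈ Ico a b, expChar (F n)‖ ≤ 2 / θ := by
  rcases le_or_gt b a with hab | hab
  · rw [Ico_eq_empty_of_le hab]; simp; positivity
  obtain ⟨N, rfl⟩ : ∃ N, b = a + 1 + N := ⟨b - (a + 1), by omega⟩
  set d : ℕ → ℝ := fun n => F (n + 1) - F n with hd
  set ct : ℕ → ℝ := fun n => Real.cos (Real.pi * d n) / Real.sin (Real.pi * d n) with hct
  have hE : ∀ n, expChar (F (n + 1)) = expChar (F n) * expChar (d n) := by
    intro n; rw [← expChar_add]; congr 1; simp [hd]
  have hsin : ∀ n ∈ Ico a (a + 1 + N), Real.sin (Real.pi * d n) ≠ 0 := by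
    intro n hn
    have := two_mul_le_sin hθ (hlow n hn) (hup n hn)
    intro h
    simp only [hd] at h
    linarith
  -- Summation by parts: e(F n) equals `kusminCoeff (d n)` times e(F n) - e(F(n+1)). Apart from the
  -- two boundary terms, only differences of consecutive coefficients remain. These are i/2 times
  -- differences of cotangents, and monotonicity of d makes their norms telescope.
  have key : ∀ m ≤ N, ‖∑ n ∈ Ico a (a + 1 + m), expChar (F n) - kusminCoeff (d a) * expChar (F a)
      + kusminCoeff (d (a + m)) * expChar (F (a + m + 1))‖ ≤ 1 / 2 * (ct a - ct (a + m)) := by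
    intro m hm
    induction m with
    | zero =>
      have h1 := kusminCoeff_mul (d a) (hsin a (by simp; omega))
      have : ∑ n ∈ Ico a (a + 1 + 0), expChar (F n) - kusminCoeff (d a) * expChar (F a)
        + kusminCoeff (d (a + 0)) * expChar (F (a + 0 + 1)) = 0 := by
        simp only [add_zero, Nat.Ico_succ_singleton, sum_singleton, hE]
        linear_combination -(expChar (F a)) * h1
      rw [this]; simp
    | succ m ih =>
      have ih := ih (by omega)
      have hmem : a + (m + 1) ∈ Ico a (a + 1 + N) := by simp; omega
      have hmem' : a + m ∈ Ico a (a + 1 + N) := by simp; omega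
      have h1 := kusminCoeff_mul (d (a + (m + 1))) (hsin _ hmem)
      have hm' := hmono (a + m) (by omega) (by omega)
      have hc : ct (a + (m + 1)) ≤ ct (a + m) :=
        cot_antitone (hθ.trans_le (hlow _ hmem')) hm'
          (lt_of_le_of_lt (hup _ hmem) (by linarith))
      have hdc : ‖kusminCoeff (d (a + (m + 1))) - kusminCoeff (d (a + m))‖
          = 1 / 2 * (ct (a + m) - ct (a + (m + 1))) := by
        have : kusminCoeff (d (a + (m + 1))) - kusminCoeff (d (a + m))
            = Complex.I / 2 * ((ct (a + (m + 1)) - ct (a + m) : ℝ) : ℂ) := by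
          simp only [kusminCoeff, hct]; push_cast; ring
        rw [this, norm_mul, Complex.norm_real, Real.norm_eq_abs, abs_of_nonpos (by linarith)]
        simp
      have e : ∑ n ∈ Ico a (a + 1 + (m + 1)), expChar (F n) - kusminCoeff (d a) * expChar (F a)
          + kusminCoeff (d (a + (m + 1))) * expChar (F (a + (m + 1) + 1))
          = (∑ n ∈ Ico a (a + 1 + m), expChar (F n) - kusminCoeff (d a) * expChar (F a)
          + kusminCoeff (d (a + m)) * expChar (F (a + m + 1))) +
          (kusminCoeff (d (a + (m + 1))) - kusminCoeff (d (a + m))) * expChar (F (a + m + 1)) := by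
        rw [← add_assoc (a + 1) m 1, sum_Ico_succ_top (by omega), hE (a + (m + 1)),
          show a + 1 + m = a + m + 1 by ring, show a + (m + 1) = a + m + 1 by ring]
        rw [show a + (m + 1) = a + m + 1 by ring] at h1
        linear_combination -(expChar (F (a + m + 1))) * h1
      rw [e]
      refine (norm_add_le _ _).trans ?_
      rw [norm_mul, hdc, norm_expChar, mul_one]
      linarith
  have hk := key N le_rfl
  have ha : a ∈ Ico a (a + 1 + N) := by simp; omega
  have hb : a + N ∈ Ico a (a + 1 + N) := by simp
  have c1 := norm_kusminCoeff_le hθ (hlow _ ha) (hup _ ha)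
  have c2 := norm_kusminCoeff_le hθ (hlow _ hb) (hup _ hb)
  have t1 := abs_le.1 (abs_cot_le hθ (hlow _ ha) (hup _ ha))
  have t2 := abs_le.1 (abs_cot_le hθ (hlow _ hb) (hup _ hb))
  have : ∑ n ∈ Ico a (a + 1 + N), expChar (F n) =
      (∑ n ∈ Ico a (a + 1 + N), expChar (F n) - kusminCoeff (d a) * expChar (F a)
      + kusminCoeff (d (a + N)) * expChar (F (a + N + 1))) + kusminCoeff (d a) * expChar (F a)
      - kusminCoeff (d (a + N)) * expChar (F (a + N + 1)) := by ring
  rw [this]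
  refine (norm_sub_le _ _).trans ?_
  refine (add_le_add (norm_add_le _ _) le_rfl).trans ?_
  rw [norm_mul, norm_mul, norm_expChar, norm_expChar, mul_one, mul_one]
  -- The two boundary terms and the total variation contribute at most 1/(2θ) each, which is three
  -- of the four available.
  have e1 : 2 / θ = 4 * (1 / (2 * θ)) := by field_simp; norm_num
  have t1' : ct a ≤ 1 / (2 * θ) := t1.2
  have t2' : -(1 / (2 * θ)) ≤ ct (a + N) := t2.1
  have hp : 0 < 1 / (2 * θ) := by positivity
  have c1' : ‖kusminCoeff (d a)‖ ≤ 1 / (2 * θ) := c1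
  have c2' : ‖kusminCoeff (d (a + N))‖ ≤ 1 / (2 * θ) := c2
  rw [e1]
  linarith

lemma expChar_add_int (x : ℝ) (m : ℤ) : expChar (x + m) = expChar x := by
  rw [expChar_add]
  have : expChar (m : ℝ) = 1 := by
    rw [expChar, Complex.exp_eq_one_iff]
    exact ⟨m, by push_cast; ring⟩
  rw [this, mul_one]

/-- The Kusmin–Landau inequality. -/
lemma kusmin_landau (F : ℕ → ℝ) (a b : ℕ) (ν : ℤ) {θ : ℝ} (hθ : 0 < θ)
    (hlow : ∀ n ∈ Ico a b, ν + θ ≤ F (n + 1) - F n)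
    (hup : ∀ n ∈ Ico a b, F (n + 1) - F n ≤ ν + 1 - θ)
    (hmono : ∀ n, a ≤ n → n + 1 < b → F (n + 1) - F n ≤ F (n + 2) - F (n + 1)) :
    ‖∑ n ∈ Ico a b, expChar (F n)‖ ≤ 2 / θ := by
  -- Subtracting νn moves the differences into [θ, 1 - θ] without changing any term.
  have h : ∀ n, expChar (F n) = expChar (F n - ν * n) := by
    intro n
    rw [← expChar_add_int (F n - ν * n) (ν * n)]
    congr 1
    push_cast
    ring
  simp only [h]
  apply kusmin_landau_aux (fun n => F n - ν * n) a b hθ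
  · intro n hn; have := hlow n hn; push_cast; linarith
  · intro n hn; have := hup n hn; push_cast; linarith
  · intro n h1 h2; have := hmono n h1 h2; push_cast; linarith

/-! ### Van der Corput's second derivative test -/

/-- Counting points of a sequence with gaps at least `g` in an interval. -/
lemma card_filter_le_of_gap (d : ℕ → ℝ) (a b : ℕ) {g u v : ℝ} (hg : 0 < g) (huv : u ≤ v)
    (hgap : ∀ m n, a ≤ m → m ≤ n → n < b → g * (n - m : ℝ) ≤ d n - d m)
    (s : Finset ℕ) (hs : s ⊆ Ico a b) (hsu : ∀ n ∈ s, u ≤ d n) (hsv : ∀ n ∈ s, d n ≤ v) :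
    (#s : ℝ) ≤ (v - u) / g + 1 := by
  rcases s.eq_empty_or_nonempty with rfl | hne
  · simp only [card_empty, Nat.cast_zero]
    have : 0 ≤ (v - u) / g := div_nonneg (by linarith) hg.le
    linarith
  · have h1 := s.min'_mem hne
    have h2 := s.max'_mem hne
    set m := s.min' hne
    set n := s.max' hne
    have hmn : m ≤ n := s.min'_le _ h2
    have hsub : s ⊆ Icc m n := fun x hx => mem_Icc.2 ⟨s.min'_le _ hx, s.le_max' _ hx⟩
    have hc : #s ≤ n + 1 - m := by simpa using card_le_card hsub
    have hc' : (#s : ℝ) ≤ (n - m : ℝ) + 1 := by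
      have : #s + m ≤ n + 1 := by omega
      have : (#s : ℝ) + m ≤ n + 1 := by exact_mod_cast this
      linarith
    have := hgap m n (mem_Ico.1 (hs h1)).1 hmn (mem_Ico.1 (hs h2)).2
    have h3 : (n - m : ℝ) ≤ (v - u) / g := by
      rw [le_div_iff₀ hg]
      have := hsu m h1
      have := hsv n h2
      linarith
    linarith

/-- The second derivative test in discrete form. -/
lemma second_difference_test_aux (F : ℕ → ℝ) (a b : ℕ) {g h : ℝ} (hg : 0 < g) (hg1 : g ≤ 1)
    (hh : 0 ≤ h)
    (hlow : ∀ n, a ≤ n → n + 1 < b → g ≤ (F (n + 2) - F (n + 1)) - (F (n + 1) - F n))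
    (hup : ∀ n, a ≤ n → n + 1 < b → (F (n + 2) - F (n + 1)) - (F (n + 1) - F n) ≤ h * g) :
    ‖∑ n ∈ Ico a b, expChar (F n)‖ ≤ 6 * (h * (b - a : ℕ) * √g) + 12 / √g := by
  set d : ℕ → ℝ := fun n => F (n + 1) - F n with hd
  have hs0 : 0 < √g := Real.sqrt_pos.2 hg
  have hs1 : √g ≤ 1 := Real.sqrt_le_one.2 hg1
  have hss : √g * √g = g := Real.mul_self_sqrt hg.le
  rcases le_or_gt b a with hab | hab
  · rw [Ico_eq_empty_of_le hab]; simp; positivity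
  have hgap : ∀ m n, a ≤ m → m ≤ n → n < b → g * (n - m : ℝ) ≤ d n - d m := by
    intro m n hm hmn hn
    induction n, hmn using Nat.le_induction with
    | base => simp
    | succ n hmn ih =>
      have h1 := ih (by omega)
      have h2 : g ≤ d (n + 1) - d n := hlow n (by omega) hn
      push_cast
      linarith
  have hgapu : ∀ n, a ≤ n → n < b → d n - d a ≤ h * g * (n - a : ℝ) := by
    intro n hmn hn
    induction n, hmn using Nat.le_induction with
    | base => simp
    | succ n hmn ih =>
      have h1 := ih (by omega)
      have h2 : d (n + 1) - d n ≤ h * g := hup n (by omega) hn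
      push_cast
      linarith
  have hmono : ∀ m n, a ≤ m → m ≤ n → n < b → d m ≤ d n := by
    intro m n hm hmn hn
    have := hgap m n hm hmn hn
    have : 0 ≤ g * (n - m : ℝ) := mul_nonneg hg.le (by
      have : (m : ℝ) ≤ n := by exact_mod_cast hmn
      linarith)
    linarith
  -- On a fibre of ⌊d⌋, terms with d within √g of an integer are counted through the gaps; the
  -- others form an interval to which Kusmin–Landau applies with θ = √g. This threshold makes both
  -- contributions O(1/√g).
  have hfib : ∀ ν : ℤ, ‖∑ n ∈ Ico a b with ⌊d n⌋ = ν, expChar (F n)‖ ≤ 6 / √g := by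
    intro ν
    set S := {n ∈ Ico a b | ⌊d n⌋ = ν} with hS
    have hSν : ∀ n ∈ S, (ν : ℝ) ≤ d n ∧ d n ≤ ν + 1 := by
      intro n hn
      have := (mem_filter.1 hn).2
      rw [← this]
      exact ⟨Int.floor_le _, (Int.lt_floor_add_one _).le⟩
    rw [← sum_filter_add_sum_filter_not S (fun n => d n < ν + √g),
      ← sum_filter_add_sum_filter_not ({n ∈ S | ¬ d n < ν + √g}) (fun n => d n ≤ ν + 1 - √g)]
    have c1 : (#{n ∈ S | d n < ν + √g} : ℝ) ≤ √g / g + 1 := by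
      have := card_filter_le_of_gap d a b (u := ν) (v := ν + √g) hg (by linarith) hgap
        {n ∈ S | d n < ν + √g} (fun n hn => (mem_filter.1 (mem_filter.1 hn).1).1)
        (fun n hn => (hSν n (mem_filter.1 hn).1).1) (fun n hn => (mem_filter.1 hn).2.le)
      simpa using this
    have c3 : (#{n ∈ {n ∈ S | ¬ d n < ν + √g} | ¬ d n ≤ ν + 1 - √g} : ℝ) ≤ √g / g + 1 := by
      have := card_filter_le_of_gap d a b (u := ν + 1 - √g) (v := ν + 1) hg (by linarith) hgap
        {n ∈ {n ∈ S | ¬ d n < ν + √g} | ¬ d n ≤ ν + 1 - √g}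
        (fun n hn => (mem_filter.1 (mem_filter.1 (mem_filter.1 hn).1).1).1)
        (fun n hn => (not_le.1 (mem_filter.1 hn).2).le)
        (fun n hn => (hSν n (mem_filter.1 (mem_filter.1 hn).1).1).2)
      simpa using this
    have c2 : ‖∑ n ∈ {n ∈ S | ¬ d n < ν + √g} with d n ≤ ν + 1 - √g, expChar (F n)‖ ≤ 2 / √g := by
      set M := {n ∈ {n ∈ S | ¬ d n < ν + √g} | d n ≤ ν + 1 - √g} with hM
      have hMp : ∀ n ∈ M, a ≤ n ∧ n < b ∧ ν + √g ≤ d n ∧ d n ≤ ν + 1 - √g := by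
        intro n hn
        have h1 := mem_filter.1 hn
        have h2 := mem_filter.1 h1.1
        have h3 := mem_Ico.1 (mem_filter.1 h2.1).1
        exact ⟨h3.1, h3.2, not_lt.1 h2.2, h1.2⟩
      rcases M.eq_empty_or_nonempty with hemp | hne
      · rw [hemp]; simp; positivity
      have hp := hMp _ (M.min'_mem hne)
      have hq := hMp _ (M.max'_mem hne)
      set p := M.min' hne
      set q := M.max' hne
      have hMI : M = Ico p (q + 1) := by
        ext n
        constructor
        · intro hn
          exact mem_Ico.2 ⟨M.min'_le _ hn, Nat.lt_succ_of_le (M.le_max' _ hn)⟩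
        · intro hn
          obtain ⟨h1, h2⟩ := mem_Ico.1 hn
          have l1 := hmono p n hp.1 h1 (by omega)
          have l2 := hmono n q (by omega) (by omega) hq.2.1
          simp only [hM, hS, mem_filter, mem_Ico]
          refine ⟨⟨⟨⟨by omega, by omega⟩, ?_⟩, ?_⟩, ?_⟩
          · rw [Int.floor_eq_iff]; constructor <;> linarith
          · linarith
          · linarith
      rw [hMI]
      apply kusmin_landau F p (q + 1) ν hs0
      · intro n hn
        obtain ⟨h1, h2⟩ := mem_Ico.1 hn
        have l1 := hmono p n hp.1 h1 (by omega)
        exact hp.2.2.1.trans l1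
      · intro n hn
        obtain ⟨h1, h2⟩ := mem_Ico.1 hn
        have l2 := hmono n q (by omega) (by omega) hq.2.1
        exact l2.trans hq.2.2.2
      · intro n h1 h2
        exact hmono n (n + 1) (by omega) (by omega) (by omega)
    have e : √g / g = 1 / √g := by
      rw [div_eq_div_iff hg.ne' hs0.ne']; linarith
    have e1 : 1 ≤ 1 / √g := by rw [le_div_iff₀ hs0]; linarith
    have n1 := (norm_sum_expChar_le_card {n ∈ S | d n < ν + √g} F).trans c1
    have n3 := (norm_sum_expChar_le_card
      {n ∈ {n ∈ S | ¬ d n < ν + √g} | ¬ d n ≤ ν + 1 - √g} F).trans c3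
    have e6 : 6 / √g = 6 * (1 / √g) := by ring
    have e2 : 2 / √g = 2 * (1 / √g) := by ring
    rw [e6]
    rw [e2] at c2
    rw [e] at n1 n3
    refine (norm_add_le _ _).trans ?_
    refine (add_le_add le_rfl (norm_add_le _ _)).trans ?_
    linarith
  have hmaps : ∀ n ∈ Ico a b, ⌊d n⌋ ∈ Icc ⌊d a⌋ ⌊d (b - 1)⌋ := by
    intro n hn
    obtain ⟨h1, h2⟩ := mem_Ico.1 hn
    exact mem_Icc.2 ⟨Int.floor_mono (hmono a n le_rfl h1 h2),
      Int.floor_mono (hmono n (b - 1) h1 (by omega) (by omega))⟩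
  rw [← sum_fiberwise_of_maps_to hmaps]
  refine (norm_sum_le _ _).trans ((sum_le_sum fun ν _ => hfib ν).trans ?_)
  rw [sum_const, nsmul_eq_mul, Int.card_Icc]
  -- Each step raises d by at most hg, which bounds the number of unit intervals that d can meet.
  have hcard : (((⌊d (b - 1)⌋ + 1 - ⌊d a⌋).toNat : ℕ) : ℝ) ≤ h * g * (b - a : ℕ) + 2 := by
    have h1 : ⌊d a⌋ ≤ ⌊d (b - 1)⌋ := Int.floor_mono (hmono a (b - 1) le_rfl (by omega) (by omega))
    have h2 : (((⌊d (b - 1)⌋ + 1 - ⌊d a⌋).toNat : ℕ) : ℝ) = (⌊d (b - 1)⌋ + 1 - ⌊d a⌋ : ℝ) := by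
      have : (((⌊d (b - 1)⌋ + 1 - ⌊d a⌋).toNat : ℕ) : ℤ) = ⌊d (b - 1)⌋ + 1 - ⌊d a⌋ :=
        Int.toNat_of_nonneg (by omega)
      exact_mod_cast this
    rw [h2]
    have h3 := Int.floor_le (d (b - 1))
    have h4 := Int.lt_floor_add_one (d a)
    have h5 := hgapu (b - 1) (by omega) (by omega)
    have h6 : ((b - 1 : ℕ) - a : ℝ) ≤ ((b - a : ℕ) : ℝ) := by
      rw [Nat.cast_sub hab.le]
      have : ((b - 1 : ℕ) : ℝ) ≤ b := by exact_mod_cast Nat.sub_le b 1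
      linarith
    have h7 : h * g * ((b - 1 : ℕ) - a : ℝ) ≤ h * g * ((b - a : ℕ) : ℝ) :=
      mul_le_mul_of_nonneg_left h6 (by positivity)
    linarith
  calc _ ≤ (h * g * (b - a : ℕ) + 2) * (6 / √g) := by gcongr
    _ = _ := by
      nth_rewrite 1 [← hss]
      field_simp
      ring

/-- The second derivative test in discrete form, for all sizes of the second difference. -/
lemma second_difference_test (F : ℕ → ℝ) (a b : ℕ) {g h : ℝ} (hg : 0 < g) (hh : 1 ≤ h)
    (hlow : ∀ n, a ≤ n → n + 2 < b → g ≤ (F (n + 2) - F (n + 1)) - (F (n + 1) - F n))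
    (hup : ∀ n, a ≤ n → n + 2 < b → (F (n + 2) - F (n + 1)) - (F (n + 1) - F n) ≤ h * g) :
    ‖∑ n ∈ Ico a b, expChar (F n)‖ ≤ 6 * (h * (b - a : ℕ) * √g) + 13 / √g := by
  have hs0 : 0 < √g := Real.sqrt_pos.2 hg
  rcases le_or_gt b a with hab | hab
  · rw [Ico_eq_empty_of_le hab]; simp; positivity
  rcases le_or_gt g 1 with hg1 | hg1
  · have hs1 : √g ≤ 1 := Real.sqrt_le_one.2 hg1
    -- The auxiliary version looks one point past its summation range, while here F b is not
    -- controlled. The last term is therefore split off; it costs 1 ≤ 1/√g, which turns 12 into 13.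
    obtain ⟨c, rfl⟩ : ∃ c, b = c + 1 := ⟨b - 1, by omega⟩
    rw [sum_Ico_succ_top (by omega)]
    refine (norm_add_le _ _).trans ?_
    rw [norm_expChar]
    have := second_difference_test_aux F a c hg hg1 (by linarith)
      (fun n h1 h2 => hlow n h1 (by omega)) (fun n h1 h2 => hup n h1 (by omega))
    have e1 : 1 ≤ 1 / √g := by rw [le_div_iff₀ hs0]; linarith
    have e2 : h * (c - a : ℕ) * √g ≤ h * (c + 1 - a : ℕ) * √g := by
      gcongr; omega
    have e3 : 13 / √g = 12 / √g + 1 / √g := by ring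
    linarith
  · have hs1 : 1 ≤ √g := by rw [Real.one_le_sqrt]; exact hg1.le
    have := norm_sum_expChar_le_card (Ico a b) F
    rw [Nat.card_Ico] at this
    have e : ((b - a : ℕ) : ℝ) ≤ h * (b - a : ℕ) * √g := by
      have : (1 : ℝ) * (b - a : ℕ) * 1 ≤ h * (b - a : ℕ) * √g := by gcongr
      simpa using this
    have : 0 ≤ 13 / √g := by positivity
    have : 0 ≤ ((b - a : ℕ) : ℝ) := by positivity
    linarith

/-- The mean value theorem is used twice: for y ↦ f(y+1) - f(y) on [x, x+1], then for f' on an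
interval of length 1. -/
lemma exists_second_difference_eq (f f' f'' : ℝ → ℝ) (x : ℝ)
    (hf : ∀ y ∈ Set.Icc x (x + 2), HasDerivAt f (f' y) y)
    (hf' : ∀ y ∈ Set.Icc x (x + 2), HasDerivAt f' (f'' y) y) :
    ∃ ξ ∈ Set.Icc x (x + 2), (f (x + 2) - f (x + 1)) - (f (x + 1) - f x) = f'' ξ := by
  have hd : ∀ y ∈ Set.Icc x (x + 1), HasDerivAt (fun y => f (y + 1) - f y) (f' (y + 1) - f' y) y := by
    intro y hy
    have h1 : HasDerivAt (fun y => f (y + 1)) (f' (y + 1)) y :=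
      (hf (y + 1) ⟨by linarith [hy.1], by linarith [hy.2]⟩).comp_add_const y 1
    exact h1.sub (hf y ⟨hy.1, by linarith [hy.2]⟩)
  obtain ⟨c, hc, hce⟩ := exists_hasDerivAt_eq_slope (fun y => f (y + 1) - f y)
    (fun y => f' (y + 1) - f' y) (show x < x + 1 by linarith)
    (fun y hy => (hd y hy).continuousAt.continuousWithinAt)
    (fun y hy => hd y (Set.Ioo_subset_Icc_self hy))
  have hsub : ∀ y ∈ Set.Icc c (c + 1), y ∈ Set.Icc x (x + 2) := fun y hy =>
    ⟨by linarith [hy.1, hc.1], by linarith [hy.2, hc.2]⟩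
  obtain ⟨ξ, hξ, hξe⟩ := exists_hasDerivAt_eq_slope f' f'' (show c < c + 1 by linarith)
    (fun y hy => (hf' y (hsub y hy)).continuousAt.continuousWithinAt)
    (fun y hy => hf' y (hsub y (Set.Ioo_subset_Icc_self hy)))
  refine ⟨ξ, hsub ξ (Set.Ioo_subset_Icc_self hξ), ?_⟩
  rw [hξe, show c + 1 - c = 1 by ring, div_one, hce, show x + 1 - x = 1 by ring, div_one]
  ring_nf

/-- Van der Corput's second derivative test, with a sign `s = ± 1`. -/
lemma second_derivative_test (f f' f'' : ℝ → ℝ) (a b : ℕ) {g h s : ℝ} (hg : 0 < g) (hh : 1 ≤ h)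
    (hs : s = 1 ∨ s = -1)
    (hf : ∀ y ∈ Set.Icc (a + 1 : ℝ) b, HasDerivAt f (f' y) y)
    (hf' : ∀ y ∈ Set.Icc (a + 1 : ℝ) b, HasDerivAt f' (f'' y) y)
    (hlow : ∀ y ∈ Set.Icc (a + 1 : ℝ) b, g ≤ s * f'' y)
    (hup : ∀ y ∈ Set.Icc (a + 1 : ℝ) b, s * f'' y ≤ h * g) :
    ‖∑ n ∈ Ioc a b, expChar (f n)‖ ≤ 6 * (h * (b - a : ℕ) * √g) + 13 / √g := by
  have key : ‖∑ n ∈ Ico (a + 1) (b + 1), expChar (s * f n)‖ ≤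
      6 * (h * (b + 1 - (a + 1) : ℕ) * √g) + 13 / √g := by
    have hsd : ∀ n : ℕ, a + 1 ≤ n → n + 2 < b + 1 → ∃ ξ ∈ Set.Icc (a + 1 : ℝ) b,
        (s * f ((n + 2 : ℕ) : ℝ) - s * f ((n + 1 : ℕ) : ℝ)) - (s * f ((n + 1 : ℕ) : ℝ) - s * f n)
          = s * f'' ξ := by
      intro n h1 h2
      have h1' : (a + 1 : ℝ) ≤ n := by exact_mod_cast h1
      have h2' : (n + 2 : ℝ) ≤ b := by exact_mod_cast (by omega : n + 2 ≤ b)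
      have hsub : ∀ y ∈ Set.Icc (n : ℝ) (n + 2), y ∈ Set.Icc (a + 1 : ℝ) b := fun y hy =>
        ⟨by linarith [hy.1], by linarith [hy.2]⟩
      obtain ⟨ξ, hξ, he⟩ := exists_second_difference_eq f f' f'' n
        (fun y hy => hf y (hsub y hy)) (fun y hy => hf' y (hsub y hy))
      refine ⟨ξ, hsub ξ hξ, ?_⟩
      rw [← he]
      push_cast
      ring
    refine second_difference_test (fun n => s * f n) (a + 1) (b + 1) hg hh ?_ ?_
    · intro n h1 h2
      obtain ⟨ξ, hξ, he⟩ := hsd n h1 h2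
      simp only [he]
      exact hlow ξ hξ
    · intro n h1 h2
      obtain ⟨ξ, hξ, he⟩ := hsd n h1 h2
      simp only [he]
      exact hup ξ hξ
  rw [Nat.add_sub_add_right] at key
  have hI : Ioc a b = Ico (a + 1) (b + 1) := by ext; simp
  rw [hI]
  rcases hs with rfl | rfl
  · simpa using key
  · simp only [neg_mul, one_mul] at key
    rwa [norm_sum_expChar_neg] at key

/-! ### Exponential sums in a real variable: lower bounds and zeros -/

/-- A continuous function bounded away from zero on an interval has a constant sign there. -/
lemma sign_const_of_le_abs {q : ℝ → ℝ} {I : Set ℝ} {s : ℝ} (hI : IsPreconnected I)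
    (hq : ContinuousOn q I) (hs : 0 < s)
    (h : ∀ t ∈ I, s ≤ |q t|) : (∀ t ∈ I, s ≤ q t) ∨ (∀ t ∈ I, s ≤ -q t) := by
  by_contra hcon
  push Not at hcon
  obtain ⟨⟨x, hx, hx'⟩, ⟨y, hy, hy'⟩⟩ := hcon
  have h1 : q x ≤ 0 := by
    by_contra h0
    have := h x hx
    rw [abs_of_pos (not_le.1 h0)] at this
    linarith
  have h2 : 0 ≤ q y := by
    by_contra h0
    have := h y hy
    rw [abs_of_neg (not_le.1 h0)] at this
    linarith
  obtain ⟨z, hz, hz0⟩ := hI.intermediate_value hx hy hq ⟨h1, h2⟩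
  have := h z hz
  rw [hz0, abs_zero] at this
  linarith

/-- Since p increases with slope at least s, it moves away from zero on one side of the midpoint; on
the outer quarter of that side it has gained at least s(v-u)/4. -/
lemma exists_quarter_of_deriv_ge {p p' : ℝ → ℝ} {u v s : ℝ} (huv : u ≤ v) (hs : 0 ≤ s)
    (hp : ∀ t ∈ Set.Icc u v, HasDerivAt p (p' t) t) (h : ∀ t ∈ Set.Icc u v, s ≤ p' t) :
    ∃ u' v', u ≤ u' ∧ u' ≤ v' ∧ v' ≤ v ∧ v' - u' = (v - u) / 4 ∧
      ∀ t ∈ Set.Icc u' v', s * ((v - u) / 4) ≤ |p t| := by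
  have hslope : ∀ x ∈ Set.Icc u v, ∀ y ∈ Set.Icc u v, x ≤ y → s * (y - x) ≤ p y - p x := by
    intro x hx y hy hxy
    refine (convex_Icc u v).mul_sub_le_image_sub_of_le_deriv
      (fun t ht => (hp t ht).continuousAt.continuousWithinAt)
      (fun t ht => (hp t (interior_subset ht)).differentiableAt.differentiableWithinAt)
      (fun t ht => ?_) x hx y hy hxy
    rw [(hp t (interior_subset ht)).deriv]
    exact h t (interior_subset ht)
  set m := (u + v) / 2 with hm
  have hmI : m ∈ Set.Icc u v := ⟨by linarith, by linarith⟩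
  rcases le_total 0 (p m) with h0 | h0
  · refine ⟨v - (v - u) / 4, v, by linarith, by linarith, le_rfl, by ring, fun t ht => ?_⟩
    have := hslope m hmI t ⟨by linarith [ht.1], ht.2⟩ (by linarith [ht.1])
    have h3 : s * ((v - u) / 4) ≤ s * (t - m) := by
      apply mul_le_mul_of_nonneg_left _ hs; linarith [ht.1]
    exact le_trans (by linarith) (le_abs_self _)
  · refine ⟨u, u + (v - u) / 4, le_rfl, by linarith, by linarith, by ring, fun t ht => ?_⟩
    have := hslope t ⟨ht.1, by linarith [ht.2]⟩ m hmI (by linarith [ht.2])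
    have h3 : s * ((v - u) / 4) ≤ s * (m - t) := by
      apply mul_le_mul_of_nonneg_left _ hs; linarith [ht.2]
    exact le_trans (by linarith) (neg_le_abs _)

lemma exists_quarter_of_abs_deriv_ge {p p' : ℝ → ℝ} {u v s : ℝ} (huv : u ≤ v) (hs : 0 ≤ s)
    (hp : ∀ t ∈ Set.Icc u v, HasDerivAt p (p' t) t) (hc : ContinuousOn p' (Set.Icc u v))
    (h : ∀ t ∈ Set.Icc u v, s ≤ |p' t|) :
    ∃ u' v', u ≤ u' ∧ u' ≤ v' ∧ v' ≤ v ∧ v' - u' = (v - u) / 4 ∧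
      ∀ t ∈ Set.Icc u' v', s * ((v - u) / 4) ≤ |p t| := by
  rcases hs.eq_or_lt with rfl | hs
  · exact ⟨u, u + (v - u) / 4, le_rfl, by linarith, by linarith, by ring, fun t _ => by simp⟩
  rcases sign_const_of_le_abs isPreconnected_Icc hc hs h with h1 | h1
  · exact exists_quarter_of_deriv_ge huv hs.le hp h1
  · obtain ⟨u', v', a1, a2, a3, a4, a5⟩ :=
      exists_quarter_of_deriv_ge huv hs.le (fun t ht => (hp t ht).neg) h1
    exact ⟨u', v', a1, a2, a3, a4, fun t ht => by simpa using a5 t ht⟩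

/-- The exponential sum `∑_{γ ∈ S} b_γ e^{γ t}`. -/
noncomputable def expPoly (S : Finset ℝ) (b : ℝ → ℝ) (t : ℝ) : ℝ :=
  ∑ γ ∈ S, b γ * Real.exp (γ * t)

lemma continuous_expPoly (S : Finset ℝ) (b : ℝ → ℝ) : Continuous (expPoly S b) := by
  unfold expPoly
  fun_prop

/-- The factor e^{-γ₁t} makes the γ₁-term constant, so differentiating removes one exponent and
multiplies each other b_γ by γ - γ₁. The inductions for the lower bound and for the zero count both
run on this. -/
lemma hasDerivAt_exp_mul_expPoly {S : Finset ℝ} {γ₁ : ℝ} (hγ : γ₁ ∉ S) (b : ℝ → ℝ) (t : ℝ) :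
    HasDerivAt (fun t => Real.exp (-γ₁ * t) * expPoly (insert γ₁ S) b t)
      (Real.exp (-γ₁ * t) * expPoly S (fun γ => b γ * (γ - γ₁)) t) t := by
  have hexp : ∀ c : ℝ, HasDerivAt (fun t => Real.exp (c * t)) (Real.exp (c * t) * c) t := by
    intro c
    have := ((hasDerivAt_id t).const_mul c).exp
    simpa using this
  have hsum : HasDerivAt (expPoly (insert γ₁ S) b)
      (∑ γ ∈ insert γ₁ S, b γ * (Real.exp (γ * t) * γ)) t := by
    unfold expPoly
    exact HasDerivAt.fun_sum fun γ _ => (hexp γ).const_mul (b γ)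
  refine ((hexp (-γ₁)).mul hsum).congr_deriv ?_
  simp only [expPoly, sum_insert hγ]
  have : ∑ γ ∈ S, b γ * (γ - γ₁) * Real.exp (γ * t) =
      ∑ γ ∈ S, b γ * (Real.exp (γ * t) * γ) - γ₁ * ∑ γ ∈ S, b γ * Real.exp (γ * t) := by
    rw [mul_sum, ← sum_sub_distrib]
    exact sum_congr rfl fun γ _ => by ring
  rw [this]
  ring

lemma abs_expPoly_le (S : Finset ℝ) (b : ℝ → ℝ) {T t : ℝ} (ht : 0 ≤ t) (htT : t ≤ T) :
    |expPoly S b t| ≤ (1 + ∑ γ ∈ S, Real.exp (|γ| * T)) * ∑ γ ∈ S, |b γ| := by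
  unfold expPoly
  refine (abs_sum_le_sum_abs _ _).trans ?_
  rw [mul_sum]
  refine sum_le_sum fun γ hγ => ?_
  rw [abs_mul, abs_of_pos (Real.exp_pos _), mul_comm]
  apply mul_le_mul_of_nonneg_right _ (abs_nonneg _)
  have h1 : Real.exp (γ * t) ≤ Real.exp (|γ| * T) := by
    apply Real.exp_le_exp.2
    calc γ * t ≤ |γ| * t := mul_le_mul_of_nonneg_right (le_abs_self _) ht
      _ ≤ |γ| * T := mul_le_mul_of_nonneg_left htT (abs_nonneg _)
  have h2 := single_le_sum (f := fun γ => Real.exp (|γ| * T)) (fun _ _ => (Real.exp_pos _).le) hγ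
  linarith

lemma exists_pos_le_abs_sub {S : Finset ℝ} {γ₁ : ℝ} (hγ : γ₁ ∉ S) :
    ∃ m > 0, ∀ γ ∈ S, m ≤ |γ - γ₁| := by
  rcases S.eq_empty_or_nonempty with rfl | hne
  · exact ⟨1, one_pos, by simp⟩
  · obtain ⟨x, hx, hmin⟩ := S.exists_min_image (fun γ => |γ - γ₁|) hne
    exact ⟨|x - γ₁|, abs_pos.2 (sub_ne_zero.2 (by rintro rfl; exact hγ hx)), hmin⟩

/-- On every interval, an exponential sum is large on a subinterval of comparable length. -/
lemma exists_subinterval_expPoly_large (T : ℝ) (hT : 0 ≤ T) (S : Finset ℝ) :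
    ∃ c : ℝ, 0 < c ∧ c ≤ 1 ∧ ∀ (b : ℝ → ℝ) (u v : ℝ), 0 ≤ u → u ≤ v → v ≤ T →
      ∃ u' v', u ≤ u' ∧ u' ≤ v' ∧ v' ≤ v ∧ c * (v - u) ≤ v' - u' ∧
        ∀ t ∈ Set.Icc u' v', c * (v - u) ^ #S * ∑ γ ∈ S, |b γ| ≤ |expPoly S b t| := by
  induction S using Finset.induction_on with
  | empty =>
    refine ⟨1, one_pos, le_rfl, fun b u v _ huv _ => ⟨u, v, le_rfl, huv, le_rfl, by simp, ?_⟩⟩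
    intro t _
    simp [expPoly]
  | insert γ₁ S hγ ih =>
    obtain ⟨c', hc', hc'1, ih⟩ := ih
    obtain ⟨m, hm, hmS⟩ := exists_pos_le_abs_sub hγ
    set E := Real.exp (|γ₁| * T) with hE
    have hE1 : 1 ≤ E := Real.one_le_exp (by positivity)
    have hE0 : 0 < E := by linarith
    set M := 1 + ∑ γ ∈ S, Real.exp (|γ| * T) with hM
    have hM1 : 1 ≤ M := by
      have : 0 ≤ ∑ γ ∈ S, Real.exp (|γ| * T) := sum_nonneg fun _ _ => (Real.exp_pos _).le
      linarith
    have hElow : ∀ t, 0 ≤ t → t ≤ T → 1 / E ≤ Real.exp (γ₁ * t) := by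
      intro t h0 h1
      rw [hE, one_div, ← Real.exp_neg]
      apply Real.exp_le_exp.2
      have h2 : |γ₁| * t ≤ |γ₁| * T := mul_le_mul_of_nonneg_left h1 (abs_nonneg _)
      have h3 : -|γ₁| * t ≤ γ₁ * t := mul_le_mul_of_nonneg_right (neg_abs_le _) h0
      linarith
    have hElow' : ∀ t, 0 ≤ t → t ≤ T → 1 / E ≤ Real.exp (-γ₁ * t) := by
      intro t h0 h1
      rw [hE, one_div, ← Real.exp_neg]
      apply Real.exp_le_exp.2
      have h2 : |γ₁| * t ≤ |γ₁| * T := mul_le_mul_of_nonneg_left h1 (abs_nonneg _)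
      have h3 : γ₁ * t ≤ |γ₁| * t := mul_le_mul_of_nonneg_right (le_abs_self _) h0
      linarith
    set c1 := 1 / (4 * E * (1 + T) ^ (#S + 1)) with hc1
    set c2 := c' ^ 2 * m / (4 * E ^ 2 * (2 * E * M + 1)) with hc2
    set c := min (min c1 c2) (c' / 4) with hc
    have hc1p : 0 < c1 := by positivity
    have hc2p : 0 < c2 := by positivity
    have hcp : 0 < c := lt_min (lt_min hc1p hc2p) (by positivity)
    have hcc1 : c ≤ c1 := (min_le_left _ _).trans (min_le_left _ _)
    have hcc2 : c ≤ c2 := (min_le_left _ _).trans (min_le_right _ _)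
    have hcc3 : c ≤ c' / 4 := min_le_right _ _
    refine ⟨c, hcp, by linarith, fun b u v hu huv hv => ?_⟩
    set β := ∑ γ ∈ S, |b γ| with hβ
    have hβ0 : 0 ≤ β := sum_nonneg fun _ _ => abs_nonneg _
    set ℓ := v - u with hℓ
    have hℓ0 : 0 ≤ ℓ := by linarith
    rw [card_insert_of_notMem hγ, sum_insert hγ, ← hβ]
    -- If b_{γ₁} dominates, its term is at least twice the bound Mβ for the rest on all of [u, v].
    -- Otherwise the total coefficient sum is at most (2EM+1)β, and the induction hypothesis bounds
    -- the derivative of e^{-γ₁t} times the sum from below. The function is then large on a quarter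
    -- of that subinterval, whose length supplies the additional factor ℓ.
    rcases le_or_gt (2 * E * M * β) |b γ₁| with hA | hB
    · refine ⟨u, v, le_rfl, huv, le_rfl, ?_, fun t ht => ?_⟩
      · have : c * ℓ ≤ 1 * ℓ := mul_le_mul_of_nonneg_right (by linarith) hℓ0
        linarith
      have ht0 : 0 ≤ t := hu.trans ht.1
      have htT : t ≤ T := ht.2.trans hv
      have h1 : |expPoly S b t| ≤ M * β := abs_expPoly_le S b ht0 htT
      have h2 : expPoly (insert γ₁ S) b t = b γ₁ * Real.exp (γ₁ * t) + expPoly S b t := by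
        simp [expPoly, sum_insert hγ]
      have h3 : |b γ₁| * (1 / E) ≤ |b γ₁ * Real.exp (γ₁ * t)| := by
        rw [abs_mul, abs_of_pos (Real.exp_pos _)]
        exact mul_le_mul_of_nonneg_left (hElow t ht0 htT) (abs_nonneg _)
      have h4 : |b γ₁ * Real.exp (γ₁ * t)| - |expPoly S b t| ≤ |expPoly (insert γ₁ S) b t| := by
        rw [h2]
        have := abs_sub_abs_le_abs_sub (b γ₁ * Real.exp (γ₁ * t)) (-expPoly S b t)
        rwa [abs_neg, sub_neg_eq_add] at this
      have h5 : M * β ≤ |b γ₁| * (1 / E) / 2 := by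
        rw [mul_one_div, div_div, le_div_iff₀ (by positivity)]
        linarith
      have h6 : β ≤ |b γ₁| := by
        have : 1 * β ≤ 2 * E * M * β := by
          apply mul_le_mul_of_nonneg_right _ hβ0
          nlinarith
        linarith
      have h7 : c * ℓ ^ (#S + 1) * (|b γ₁| + β) ≤ c1 * (1 + T) ^ (#S + 1) * (2 * |b γ₁|) := by
        have : ℓ ≤ 1 + T := by linarith
        gcongr
        linarith
      have h8 : c1 * (1 + T) ^ (#S + 1) * (2 * |b γ₁|) = |b γ₁| * (1 / E) / 2 := by
        rw [hc1]
        field_simp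
        norm_num
      linarith
    · obtain ⟨u', v', a1, a2, a3, a4, a5⟩ := ih (fun γ => b γ * (γ - γ₁)) u v hu huv hv
      have hsum : m * β ≤ ∑ γ ∈ S, |b γ * (γ - γ₁)| := by
        rw [hβ, mul_sum]
        refine sum_le_sum fun γ hγ' => ?_
        rw [abs_mul, mul_comm]
        exact mul_le_mul_of_nonneg_left (hmS γ hγ') (abs_nonneg _)
      set s := 1 / E * (c' * ℓ ^ #S * (m * β)) with hs
      have hs0 : 0 ≤ s := by positivity
      obtain ⟨u'', v'', b1, b2, b3, b4, b5⟩ := exists_quarter_of_abs_deriv_ge (s := s) a2 hs0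
        (p := fun t => Real.exp (-γ₁ * t) * expPoly (insert γ₁ S) b t)
        (p' := fun t => Real.exp (-γ₁ * t) * expPoly S (fun γ => b γ * (γ - γ₁)) t)
        (fun t _ => hasDerivAt_exp_mul_expPoly hγ b t)
        (Continuous.continuousOn (by have := continuous_expPoly S (fun γ => b γ * (γ - γ₁)); fun_prop))
        (by
          intro t ht
          have ht0 : 0 ≤ t := hu.trans (a1.trans ht.1)
          have htT : t ≤ T := ht.2.trans (a3.trans hv)
          rw [abs_mul, abs_of_pos (Real.exp_pos _), hs]
          have h1 := a5 t ht
          apply mul_le_mul (hElow' t ht0 htT) (le_trans _ h1) (by positivity) (Real.exp_pos _).le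
          gcongr)
      refine ⟨u'', v'', a1.trans b1, b2, b3.trans a3, ?_, fun t ht => ?_⟩
      · have : c * ℓ ≤ c' / 4 * ℓ := mul_le_mul_of_nonneg_right hcc3 hℓ0
        linarith
      have ht0 : 0 ≤ t := hu.trans (a1.trans (b1.trans ht.1))
      have htT : t ≤ T := ht.2.trans (b3.trans (a3.trans hv))
      have h1 := b5 t ht
      rw [abs_mul, abs_of_pos (Real.exp_pos _)] at h1
      have h2 : |expPoly (insert γ₁ S) b t| =
          Real.exp (γ₁ * t) * (Real.exp (-γ₁ * t) * |expPoly (insert γ₁ S) b t|) := by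
        rw [← mul_assoc, ← Real.exp_add, show γ₁ * t + -γ₁ * t = 0 by ring, Real.exp_zero, one_mul]
      rw [h2]
      have h3 : 1 / E * (s * (c' * ℓ / 4)) ≤
          Real.exp (γ₁ * t) * (Real.exp (-γ₁ * t) * |expPoly (insert γ₁ S) b t|) := by
        apply mul_le_mul (hElow t ht0 htT) (le_trans _ h1) (by positivity) (Real.exp_pos _).le
        gcongr
      refine le_trans ?_ h3
      have h4 : c * ℓ ^ (#S + 1) * (|b γ₁| + β) ≤ c2 * ℓ ^ (#S + 1) * ((2 * E * M + 1) * β) :=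
        mul_le_mul (mul_le_mul_of_nonneg_right hcc2 (pow_nonneg hℓ0 _)) (by linarith)
          (add_nonneg (abs_nonneg _) hβ0) (mul_nonneg hc2p.le (pow_nonneg hℓ0 _))
      refine h4.trans (le_of_eq ?_)
      rw [hs, hc2, pow_succ]
      field_simp
      ring

/-- Rolle's theorem, counting zeros. -/
lemma exists_zeros_of_deriv {p p' : ℝ → ℝ} (hp : ∀ t, HasDerivAt p (p' t) t) (Z : Finset ℝ)
    (hZ : ∀ z ∈ Z, p z = 0) :
    ∃ W : Finset ℝ, (∀ w ∈ W, p' w = 0 ∧ ∃ z ∈ Z, w < z) ∧ #Z ≤ #W + 1 := by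
  induction Z using Finset.induction_on_max with
  | empty => exact ⟨∅, by simp, by simp⟩
  | insert a s ha ih =>
    obtain ⟨W, hW, hcard⟩ := ih fun z hz => hZ z (mem_insert_of_mem hz)
    have hnot : a ∉ s := fun h => lt_irrefl _ (ha a h)
    rcases s.eq_empty_or_nonempty with rfl | hne
    · exact ⟨∅, by simp, by simp⟩
    · have hm := s.max'_mem hne
      obtain ⟨w, hw, hw0⟩ := exists_hasDerivAt_eq_zero (f := p) (f' := p') (ha _ hm)
        (fun x _ => (hp x).continuousAt.continuousWithinAt)
        (by rw [hZ _ (mem_insert_of_mem hm), hZ a (mem_insert_self _ _)]) (fun x _ => hp x)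
      -- The zeros already in W lie to the left of some point of s, whereas the new one lies to the
      -- right of max s.
      have hwW : w ∉ W := by
        intro h
        obtain ⟨z, hz, hlt⟩ := (hW w h).2
        exact absurd (hw.1.trans (hlt.trans_le (s.le_max' z hz))) (lt_irrefl _)
      refine ⟨insert w W, ?_, ?_⟩
      · intro x hx
        rcases mem_insert.1 hx with rfl | hx
        · exact ⟨hw0, a, mem_insert_self _ _, hw.2⟩
        · obtain ⟨h1, z, hz, h2⟩ := hW x hx
          exact ⟨h1, z, mem_insert_of_mem hz, h2⟩
      · rw [card_insert_of_notMem hnot, card_insert_of_notMem hwW]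
        omega

/-- Dividing by one exponential and differentiating loses one exponent and, by Rolle, at most one
zero. If only b γ₁ is nonzero, the sum is a single exponential and has no zeros. -/
lemma card_zeros_expPoly_le (S : Finset ℝ) : ∀ (b : ℝ → ℝ), (∃ γ ∈ S, b γ ≠ 0) →
    ∀ Z : Finset ℝ, (∀ z ∈ Z, expPoly S b z = 0) → #Z ≤ #S := by
  induction S using Finset.induction_on with
  | empty => simp
  | insert γ₁ S hγ ih =>
    intro b hb Z hZ
    by_cases hS : ∃ γ ∈ S, b γ ≠ 0
    · obtain ⟨W, hW, hcard⟩ := exists_zeros_of_deriv (hasDerivAt_exp_mul_expPoly hγ b) Z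
        (fun z hz => by simp only [hZ z hz, mul_zero])
      rw [card_insert_of_notMem hγ]
      refine hcard.trans (Nat.succ_le_succ (ih (fun γ => b γ * (γ - γ₁)) ?_ W ?_))
      · obtain ⟨γ, h1, h2⟩ := hS
        exact ⟨γ, h1, mul_ne_zero h2 (sub_ne_zero.2 (by rintro rfl; exact hγ h1))⟩
      · intro w hw
        exact (mul_eq_zero.1 (hW w hw).1).resolve_left (Real.exp_pos _).ne'
    · push Not at hS
      have h1 : b γ₁ ≠ 0 := by
        obtain ⟨γ, h1, h2⟩ := hb
        rcases mem_insert.1 h1 with rfl | h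
        · exact h2
        · exact absurd (hS γ h) h2
      rcases Z.eq_empty_or_nonempty with rfl | ⟨z, hz⟩
      · simp
      · exfalso
        have h2 := hZ z hz
        simp only [expPoly, sum_insert hγ] at h2
        rw [sum_eq_zero (s := S) (fun γ hγ => by rw [hS γ hγ, zero_mul]), add_zero] at h2
        exact (mul_ne_zero h1 (Real.exp_pos _).ne') h2

/-- A nonzero exponential sum with `n` terms has at most `n` zeros. -/
lemma exists_finset_zeros_expPoly (S : Finset ℝ) (b : ℝ → ℝ) (hb : ∃ γ ∈ S, b γ ≠ 0) :
    ∃ Z : Finset ℝ, #Z ≤ #S ∧ ∀ t, expPoly S b t = 0 → t ∈ Z := by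
  have hfin : {t | expPoly S b t = 0}.Finite := by
    by_contra hinf
    obtain ⟨Z, hZ, hcard⟩ := Set.Infinite.exists_subset_card_eq hinf (#S + 1)
    have := card_zeros_expPoly_le S b hb Z (fun z hz => hZ hz)
    omega
  refine ⟨hfin.toFinset, card_zeros_expPoly_le S b hb _ (fun z hz => by simpa using hz), ?_⟩
  intro t ht
  simpa using ht

/-! ### The divisor bound -/

/-- For every exponent `ν > 0` the number of divisors of `n` is `O(n ^ ν)`. -/
lemma exists_card_divisors_le (ν : ℝ) (hν : 0 < ν) :
    ∃ C : ℝ, 1 ≤ C ∧ ∀ n : ℕ, (#n.divisors : ℝ) ≤ C * (n : ℝ) ^ ν := by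
  have hl2 : 0 < Real.log 2 := Real.log_pos (by norm_num)
  set K := 1 + 1 / (ν * Real.log 2) with hK
  have hK1 : 1 ≤ K := by
    have : 0 ≤ 1 / (ν * Real.log 2) := by positivity
    linarith
  obtain ⟨P, hP⟩ := exists_nat_ge ((2 : ℝ) ^ (1 / ν))
  -- The estimate is made prime by prime. Primes above P have p^ν ≥ 2, so a + 1 ≤ 2^a needs no
  -- constant; each of the at most P + 1 smaller primes costs a factor K.
  have hlocal : ∀ p a : ℕ, 2 ≤ p → (a + 1 : ℝ) ≤ (if p ≤ P then K else 1) * ((p : ℝ) ^ ν) ^ a := by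
    intro p a hp
    have hp' : (2 : ℝ) ≤ p := by exact_mod_cast hp
    split_ifs with h
    · have h1 : (2 : ℝ) ^ ν ≤ (p : ℝ) ^ ν := Real.rpow_le_rpow (by norm_num) hp' hν.le
      have h2 : 1 + a * (ν * Real.log 2) ≤ ((2 : ℝ) ^ ν) ^ a := by
        rw [Real.rpow_def_of_pos (by norm_num), ← Real.exp_nat_mul]
        have := Real.add_one_le_exp (a * (Real.log 2 * ν))
        linarith
      have h3 : ((2 : ℝ) ^ ν) ^ a ≤ ((p : ℝ) ^ ν) ^ a := pow_le_pow_left₀ (by positivity) h1 a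
      have h4 : (a + 1 : ℝ) ≤ K * (1 + a * (ν * Real.log 2)) := by
        rw [hK]
        have e : (1 + 1 / (ν * Real.log 2)) * (1 + a * (ν * Real.log 2)) =
          1 + a + (a * (ν * Real.log 2) + 1 / (ν * Real.log 2)) := by field_simp; ring
        rw [e]
        have : 0 ≤ a * (ν * Real.log 2) + 1 / (ν * Real.log 2) := by positivity
        linarith
      exact h4.trans (mul_le_mul_of_nonneg_left (h2.trans h3) (by linarith))
    · have h1 : (2 : ℝ) ≤ (p : ℝ) ^ ν := by
        have h2 : (2 : ℝ) ^ (1 / ν) ≤ p := hP.trans (by exact_mod_cast (not_le.1 h).le)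
        calc (2 : ℝ) = ((2 : ℝ) ^ (1 / ν)) ^ ν := by
              rw [← Real.rpow_mul (by norm_num), one_div_mul_cancel hν.ne', Real.rpow_one]
          _ ≤ _ := Real.rpow_le_rpow (by positivity) h2 hν.le
      have h2 : (a + 1 : ℝ) ≤ (2 : ℝ) ^ a := by exact_mod_cast (Nat.lt_two_pow_self (n := a))
      rw [one_mul]
      exact h2.trans (pow_le_pow_left₀ (by norm_num) h1 a)
  refine ⟨K ^ (P + 1), one_le_pow₀ hK1, fun n => ?_⟩
  rcases eq_or_ne n 0 with rfl | hn
  · simp [Real.zero_rpow hν.ne']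
  rw [Nat.card_divisors hn]
  push_cast
  calc ∏ p ∈ n.primeFactors, ((n.factorization p : ℝ) + 1)
      ≤ ∏ p ∈ n.primeFactors, (if p ≤ P then K else 1) * ((p : ℝ) ^ ν) ^ n.factorization p :=
        prod_le_prod (fun p _ => by positivity)
          fun p hp => hlocal p _ (Nat.prime_of_mem_primeFactors hp).two_le
    _ = (∏ p ∈ n.primeFactors, if p ≤ P then K else 1) * (n : ℝ) ^ ν := by
        rw [prod_mul_distrib]
        congr 1
        have h := congrArg (Nat.cast (R := ℝ)) (Nat.prod_factorization_pow_eq_self hn)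
        rw [← h, Finsupp.prod, Nat.cast_prod, ← Real.finsetProd_rpow _ _ (fun _ _ => by positivity)]
        refine prod_congr rfl fun p _ => ?_
        push_cast
        rw [← Real.rpow_natCast, ← Real.rpow_natCast, ← Real.rpow_mul (by positivity),
          ← Real.rpow_mul (by positivity), mul_comm]
    _ ≤ K ^ (P + 1) * (n : ℝ) ^ ν := by
        apply mul_le_mul_of_nonneg_right _ (by positivity)
        rw [← prod_filter, prod_const]
        apply pow_le_pow_right₀ hK1
        have : {p ∈ n.primeFactors | p ≤ P} ⊆ range (P + 1) := fun p hp => by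
          simp only [mem_filter] at hp
          exact mem_range.2 (by omega)
        simpa using card_le_card this

/-! ### Vaughan's identity and Dirichlet convolutions in twisted sums -/

open ArithmeticFunction

/-- The restriction of an arithmetic function to `n ≤ U`. -/
noncomputable def lowPart (U : ℕ) (a : ArithmeticFunction ℝ) : ArithmeticFunction ℝ :=
  ⟨fun n => if n ≤ U then a n else 0, by simp⟩

/-- The restriction of an arithmetic function to `n > U`. -/
noncomputable def highPart (U : ℕ) (a : ArithmeticFunction ℝ) : ArithmeticFunction ℝ :=
  ⟨fun n => if n ≤ U then 0 else a n, by simp⟩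

lemma lowPart_apply (U : ℕ) (a : ArithmeticFunction ℝ) (n : ℕ) :
    lowPart U a n = if n ≤ U then a n else 0 := rfl

lemma highPart_apply (U : ℕ) (a : ArithmeticFunction ℝ) (n : ℕ) :
    highPart U a n = if n ≤ U then 0 else a n := rfl

lemma lowPart_add_highPart (U : ℕ) (a : ArithmeticFunction ℝ) :
    lowPart U a + highPart U a = a := by
  ext n
  rw [ArithmeticFunction.add_apply, lowPart_apply, highPart_apply]
  split_ifs <;> simp

lemma abs_lowPart_le (U : ℕ) (a : ArithmeticFunction ℝ) (n : ℕ) : |lowPart U a n| ≤ |a n| := by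
  rw [lowPart_apply]; split_ifs <;> simp

lemma abs_highPart_le (U : ℕ) (a : ArithmeticFunction ℝ) (n : ℕ) : |highPart U a n| ≤ |a n| := by
  rw [highPart_apply]; split_ifs <;> simp

/-- Vaughan's identity. -/
lemma vaughan_identity (U : ℕ) :
    vonMangoldt = lowPart U vonMangoldt + lowPart U (moebius : ArithmeticFunction ℝ) * log
      - lowPart U (moebius : ArithmeticFunction ℝ) * lowPart U vonMangoldt *
          (zeta : ArithmeticFunction ℝ)
      + highPart U vonMangoldt * ((zeta : ArithmeticFunction ℝ) *
          highPart U (moebius : ArithmeticFunction ℝ)) := by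
  have hΛ := lowPart_add_highPart U vonMangoldt
  have hμ := lowPart_add_highPart U (moebius : ArithmeticFunction ℝ)
  set Λ₁ := lowPart U vonMangoldt
  set Λ₂ := highPart U vonMangoldt
  set μ₁ := lowPart U (moebius : ArithmeticFunction ℝ)
  set μ₂ := highPart U (moebius : ArithmeticFunction ℝ)
  have h1 : (zeta : ArithmeticFunction ℝ) * (μ₁ + μ₂) = 1 := by
    rw [hμ]; exact coe_zeta_mul_coe_moebius
  have h2 : (Λ₁ + Λ₂) * (zeta : ArithmeticFunction ℝ) = log := by
    rw [hΛ]; exact vonMangoldt_mul_zeta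
  rw [← hΛ]
  linear_combination (-Λ₂) * h1 + μ₁ * h2

/-- The sum of `a(n) E(n)` over `P < n ≤ R`. -/
noncomputable def twistedSum (P R : ℕ) (E : ℕ → ℂ) (a : ArithmeticFunction ℝ) : ℂ :=
  ∑ n ∈ Ioc P R, (a n : ℂ) * E n

lemma twistedSum_add (P R : ℕ) (E : ℕ → ℂ) (a b : ArithmeticFunction ℝ) :
    twistedSum P R E (a + b) = twistedSum P R E a + twistedSum P R E b := by
  simp only [twistedSum, ArithmeticFunction.add_apply, ← sum_add_distrib]
  exact sum_congr rfl fun n _ => by push_cast; ring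

lemma twistedSum_sub (P R : ℕ) (E : ℕ → ℂ) (a b : ArithmeticFunction ℝ) :
    twistedSum P R E (a - b) = twistedSum P R E a - twistedSum P R E b := by
  rw [eq_sub_iff_add_eq, ← twistedSum_add, sub_add_cancel]

/-- For m > 0, P < ml ≤ R is equivalent to ⌊P/m⌋ < l ≤ ⌊R/m⌋, so truncated division gives the exact
range of l. -/
lemma sum_Ioc_divisorsAntidiagonal {M : Type*} [AddCommMonoid M] (P R : ℕ) (g : ℕ → ℕ → M) :
    ∑ n ∈ Ioc P R, ∑ p ∈ n.divisorsAntidiagonal, g p.1 p.2 =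
      ∑ m ∈ Ioc 0 R, ∑ l ∈ Ioc (P / m) (R / m), g m l := by
  rw [sum_sigma', sum_sigma']
  refine sum_bij' (fun x _ => ⟨x.2.1, x.2.2⟩) (fun x _ => ⟨x.1 * x.2, (x.1, x.2)⟩) ?_ ?_ ?_ ?_ ?_
  · rintro ⟨n, m, l⟩ h
    simp only [mem_sigma, mem_Ioc, Nat.mem_divisorsAntidiagonal] at h ⊢
    obtain ⟨⟨h1, h2⟩, rfl, h3⟩ := h
    have hm : 0 < m := Nat.pos_of_ne_zero (by rintro rfl; simp at h3)
    have hl : 0 < l := Nat.pos_of_ne_zero (by rintro rfl; simp at h3)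
    refine ⟨⟨hm, (Nat.le_mul_of_pos_right m hl).trans h2⟩, ?_, ?_⟩
    · rw [Nat.div_lt_iff_lt_mul hm]; linarith
    · rw [Nat.le_div_iff_mul_le hm]; linarith
  · rintro ⟨m, l⟩ h
    simp only [mem_sigma, mem_Ioc, Nat.mem_divisorsAntidiagonal] at h ⊢
    obtain ⟨⟨hm, h2⟩, h3, h4⟩ := h
    rw [Nat.div_lt_iff_lt_mul hm] at h3
    rw [Nat.le_div_iff_mul_le hm] at h4
    refine ⟨⟨by linarith, by linarith⟩, trivial, ?_⟩
    have : P < m * l := by linarith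
    omega
  · rintro ⟨n, m, l⟩ h
    simp only [mem_sigma, mem_Ioc, Nat.mem_divisorsAntidiagonal] at h ⊢
    obtain ⟨_, rfl, _⟩ := h
    rfl
  · rintro ⟨m, l⟩ _; rfl
  · rintro ⟨n, m, l⟩ _; rfl

lemma twistedSum_mul (P R : ℕ) (E : ℕ → ℂ) (a b : ArithmeticFunction ℝ) :
    twistedSum P R E (a * b) =
      ∑ m ∈ Ioc 0 R, ∑ l ∈ Ioc (P / m) (R / m), (a m : ℂ) * (b l : ℂ) * E (m * l) := by
  rw [← sum_Ioc_divisorsAntidiagonal P R fun m l => (a m : ℂ) * (b l : ℂ) * E (m * l)]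
  refine sum_congr rfl fun n _ => ?_
  rw [ArithmeticFunction.mul_apply]
  push_cast
  rw [sum_mul]
  refine sum_congr rfl fun p hp => ?_
  rw [(Nat.mem_divisorsAntidiagonal.1 hp).1]

lemma abs_lowPart_moebius_le (U n : ℕ) :
    |lowPart U (moebius : ArithmeticFunction ℝ) n| ≤ 1 := by
  refine (abs_lowPart_le _ _ _).trans ?_
  rw [intCoe_apply]
  exact_mod_cast abs_moebius_le_one

lemma abs_highPart_moebius_le (U n : ℕ) :
    |highPart U (moebius : ArithmeticFunction ℝ) n| ≤ 1 := by
  refine (abs_highPart_le _ _ _).trans ?_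
  rw [intCoe_apply]
  exact_mod_cast abs_moebius_le_one

lemma abs_zeta_mul_highPart_moebius_le (U n : ℕ) :
    |((zeta : ArithmeticFunction ℝ) * highPart U (moebius : ArithmeticFunction ℝ)) n|
      ≤ #n.divisors := by
  rw [coe_zeta_mul_apply]
  refine (abs_sum_le_sum_abs _ _).trans ((sum_le_sum fun i _ => abs_highPart_moebius_le U i).trans ?_)
  simp

/-- As |μ| ≤ 1, the convolution is dominated by Λ * 1 = log. -/
lemma abs_lowPart_mul_lowPart_le (U n : ℕ) :
    |(lowPart U (moebius : ArithmeticFunction ℝ) * lowPart U vonMangoldt) n| ≤ Real.log n := by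
  rw [ArithmeticFunction.mul_apply]
  refine (abs_sum_le_sum_abs _ _).trans ?_
  rw [← vonMangoldt_sum, Nat.sum_divisorsAntidiagonal'
    (fun i j => |lowPart U (moebius : ArithmeticFunction ℝ) i * lowPart U vonMangoldt j|)]
  refine sum_le_sum fun i _ => ?_
  rw [abs_mul]
  have h1 := abs_lowPart_moebius_le U (n / i)
  have h2 := abs_lowPart_le U vonMangoldt i
  rw [abs_of_nonneg vonMangoldt_nonneg] at h2
  calc _ ≤ 1 * vonMangoldt i := mul_le_mul h1 h2 (abs_nonneg _) zero_le_one
    _ = _ := one_mul _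

lemma lowPart_mul_lowPart_eq_zero {U n : ℕ} (hn : U * U < n) (a b : ArithmeticFunction ℝ) :
    (lowPart U a * lowPart U b) n = 0 := by
  rw [ArithmeticFunction.mul_apply]
  refine sum_eq_zero fun p hp => ?_
  rw [Nat.mem_divisorsAntidiagonal] at hp
  rw [lowPart_apply, lowPart_apply]
  split_ifs with h1 h2
  · have := Nat.mul_le_mul h1 h2
    omega
  all_goals simp

lemma zeta_mul_highPart_eq_zero {U n : ℕ} (hn : n ≤ U) (a : ArithmeticFunction ℝ) :
    ((zeta : ArithmeticFunction ℝ) * highPart U a) n = 0 := by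
  rw [coe_zeta_mul_apply]
  refine sum_eq_zero fun i hi => ?_
  rw [highPart_apply, if_pos ((Nat.divisor_le hi).trans hn)]

/-! ### Phases, levels and type I sums -/

/-- The phase `f` with `f' = f₁`, `x² f'' = G₁` and `x G₁' = G₂` on the positive half-line. -/
structure IsPhase (f f₁ G₁ G₂ : ℝ → ℝ) : Prop where
  deriv₁ : ∀ x, 0 < x → HasDerivAt f (f₁ x) x
  deriv₂ : ∀ x, 0 < x → HasDerivAt f₁ (G₁ x / x ^ 2) x
  deriv₃ : ∀ x, 0 < x → HasDerivAt G₁ (G₂ x / x) x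

/-- `s · G` lies in `[κ, 2κ]` at all points of `[P + 1, R]`, where `s` is a sign. -/
structure HasLevel (G : ℝ → ℝ) (P R : ℕ) (s κ : ℝ) : Prop where
  sign : s = 1 ∨ s = -1
  pos : 0 < κ
  low : ∀ x ∈ Set.Icc (P + 1 : ℝ) R, κ ≤ s * G x
  high : ∀ x ∈ Set.Icc (P + 1 : ℝ) R, s * G x ≤ 2 * κ

/-- Partial summation with an increasing weight. -/
lemma norm_sum_monotone_mul_le (z : ℕ → ℂ) (w : ℕ → ℝ) (b : ℕ) {K : ℝ} (N : ℕ) :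
    ∀ a, a + N = b → (∀ a', a ≤ a' → a' ≤ b → ‖∑ l ∈ Ioc a' b, z l‖ ≤ K) →
    (∀ i j, a < i → i ≤ j → j ≤ b → w i ≤ w j) → ∀ c ≤ w b, (∀ i, a < i → i ≤ b → c ≤ w i) →
    ‖∑ l ∈ Ioc a b, ((w l - c : ℝ) : ℂ) * z l‖ ≤ (w b - c) * K := by
  induction N with
  | zero =>
    intro a hab hK _ c hcb _
    have h0 := (norm_nonneg _).trans (hK a le_rfl (by omega))
    rw [Ioc_eq_empty (by omega)]
    simpa using mul_nonneg (by linarith) h0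
  | succ N ih =>
    intro a hab hK hw c hcb hc
    have e : Ioc a b = insert (a + 1) (Ioc (a + 1) b) := by
      ext x; simp only [mem_Ioc, mem_insert]; omega
    -- The first increment multiplies the whole tail, and the remaining weights are measured from
    -- w(a+1). The free baseline c lets the induction close using tail sums only.
    have hsplit : ∑ l ∈ Ioc a b, ((w l - c : ℝ) : ℂ) * z l =
        ((w (a + 1) - c : ℝ) : ℂ) * (∑ l ∈ Ioc a b, z l) +
          ∑ l ∈ Ioc (a + 1) b, ((w l - w (a + 1) : ℝ) : ℂ) * z l := by
      rw [e, sum_insert (by simp), sum_insert (by simp), mul_add, mul_sum, add_assoc,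
        ← sum_add_distrib]
      congr 1
      refine sum_congr rfl fun l _ => ?_
      push_cast
      ring
    have h1 := ih (a + 1) (by omega) (fun a' h1 h2 => hK a' (by omega) h2)
      (fun i j h1 h2 h3 => hw i j (by omega) h2 h3) (w (a + 1))
      (hw _ _ (by omega) (by omega) le_rfl) (fun i h1 h2 => hw _ _ (by omega) h1.le h2)
    have h2 := hK a le_rfl (by omega)
    have h3 := hc (a + 1) (by omega) (by omega)
    rw [hsplit]
    refine (norm_add_le _ _).trans ?_
    rw [norm_mul, Complex.norm_real, Real.norm_eq_abs, abs_of_nonneg (by linarith)]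
    have := mul_le_mul_of_nonneg_left h2 (by linarith : 0 ≤ w (a + 1) - c)
    linarith

lemma HasDerivAt.comp_const_mul_left {f : ℝ → ℝ} {d c y : ℝ} (h : HasDerivAt f d (c * y)) :
    HasDerivAt (fun y => f (c * y)) (d * c) y := by
  have h1 : HasDerivAt (fun y : ℝ => c * y) c y := by
    simpa using (hasDerivAt_id y).const_mul c
  exact HasDerivAt.comp y h h1

section

variable {f f₁ G₁ G₂ : ℝ → ℝ} (hf : IsPhase f f₁ G₁ G₂) {P R : ℕ} {A X : ℝ}

-- The second derivative of l ↦ f(ml) is G₁(ml)/l², and l lies between X/m and AX/m. The endpoints a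
-- and b are free because partial summation needs the tails.
include hf in
lemma type_one_inner (hA : 1 ≤ A) (hX : 1 ≤ X) (hP : X ≤ P + 1) (hR : R ≤ A * X)
    {s κ : ℝ} (hG : HasLevel G₁ P R s κ) {m a b : ℕ} (hm : 0 < m) (ha : P / m ≤ a)
    (hb : b ≤ R / m) :
    ‖∑ l ∈ Ioc a b, expChar (f (m * l : ℕ))‖ ≤ 12 * A ^ 2 * √κ + 13 * A * X / √κ * (1 / m) := by
  have hm' : (0 : ℝ) < m := by exact_mod_cast hm
  have hκ := hG.pos
  have hsκ : 0 < √κ := Real.sqrt_pos.2 hκ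
  have hbR : (b : ℝ) * m ≤ R := by
    have := (Nat.le_div_iff_mul_le hm).1 hb
    exact_mod_cast this
  have hmem : ∀ y ∈ Set.Icc (a + 1 : ℝ) b, m * y ∈ Set.Icc (P + 1 : ℝ) R := by
    intro y hy
    constructor
    · have h1 : P + 1 ≤ m * (a + 1) := by
        have h2 := Nat.lt_div_mul_add (a := P) hm
        have h3 : P / m * m ≤ a * m := Nat.mul_le_mul_right _ ha
        have : m * (a + 1) = a * m + m := by ring
        omega
      have h1' : (P + 1 : ℝ) ≤ m * (a + 1) := by exact_mod_cast h1
      exact h1'.trans (mul_le_mul_of_nonneg_left hy.1 hm'.le)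
    · calc m * y ≤ m * b := mul_le_mul_of_nonneg_left hy.2 hm'.le
        _ ≤ R := by linarith
  have hypos : ∀ y ∈ Set.Icc (a + 1 : ℝ) b, 0 < y := fun y hy => by
    have : (0 : ℝ) ≤ a := by positivity
    linarith [hy.1]
  -- From 1/l ≥ m/(AX), g is a lower bound for the signed second derivative; 1/l ≤ m/X gives the
  -- ratio h = 2A².
  set g := κ * (m / (A * X)) ^ 2 with hg
  have hgpos : 0 < g := by positivity
  have hsg : √g = √κ * (m / (A * X)) := by
    rw [hg, Real.sqrt_mul hκ.le, Real.sqrt_sq (by positivity)]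
  have hsec : ∀ y ∈ Set.Icc (a + 1 : ℝ) b, s * (G₁ (m * y) / (m * y) ^ 2 * m * m)
      = s * G₁ (m * y) * (1 / y) ^ 2 := by
    intro y hy
    have := hypos y hy
    field_simp
  have key := second_derivative_test (fun y => f (m * y)) (fun y => f₁ (m * y) * m)
    (fun y => G₁ (m * y) / (m * y) ^ 2 * m * m) a b (g := g) (h := 2 * A ^ 2) (s := s) hgpos
    (by nlinarith) hG.sign
    (fun y hy => by
      have := hypos y hy
      exact (hf.deriv₁ (m * y) (by positivity)).comp_const_mul_left)
    (fun y hy => by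
      have := hypos y hy
      exact (hf.deriv₂ (m * y) (by positivity)).comp_const_mul_left.mul_const (m : ℝ))
    (fun y hy => by
      rw [hsec y hy, hg]
      have h0 := hypos y hy
      apply mul_le_mul (hG.low _ (hmem y hy)) _ (by positivity)
        (hκ.le.trans (hG.low _ (hmem y hy)))
      apply pow_le_pow_left₀ (by positivity)
      rw [div_le_div_iff₀ (by positivity) h0]
      linarith [(hmem y hy).2])
    (fun y hy => by
      rw [hsec y hy, hg]
      have h0 := hypos y hy
      have h1 : 2 * A ^ 2 * (κ * (m / (A * X)) ^ 2) = 2 * κ * (m / X) ^ 2 := by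
        field_simp
      rw [h1]
      apply mul_le_mul (hG.high _ (hmem y hy)) _ (by positivity) (by positivity)
      apply pow_le_pow_left₀ (by positivity)
      rw [div_le_div_iff₀ h0 (by positivity)]
      linarith [(hmem y hy).1])
  have hcast : ∀ l : ℕ, ((m * l : ℕ) : ℝ) = m * l := fun l => by push_cast; rfl
  simp only [hcast]
  refine key.trans ?_
  rw [hsg]
  have hlen : ((b - a : ℕ) : ℝ) ≤ A * X / m := by
    rw [le_div_iff₀ hm']
    have : ((b - a : ℕ) : ℝ) ≤ b := by exact_mod_cast Nat.sub_le b a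
    have := mul_le_mul_of_nonneg_right this hm'.le
    linarith
  have t1 : 6 * (2 * A ^ 2 * ((b - a : ℕ) : ℝ) * (√κ * (m / (A * X)))) ≤ 12 * A ^ 2 * √κ := by
    calc _ ≤ 6 * (2 * A ^ 2 * (A * X / m) * (√κ * (m / (A * X)))) := by gcongr
      _ = _ := by field_simp; norm_num
  have t2 : 13 / (√κ * (m / (A * X))) = 13 * A * X / √κ * (1 / m) := by
    field_simp
  linarith

include hf in
/-- Type I sums. -/
lemma norm_type_one_le (hA : 1 ≤ A) (hX : 1 ≤ X) (hP : X ≤ P + 1) (hR : R ≤ A * X)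
    {s κ : ℝ} (hG : HasLevel G₁ P R s κ) (a b : ArithmeticFunction ℝ) {U : ℕ} {D W : ℝ}
    (hD : 0 ≤ D) (haD : ∀ n, n ≤ R → |a n| ≤ D) (haU : ∀ n, U < n → a n = 0)
    (hb0 : ∀ n, 0 < n → 0 ≤ b n)
    (hbm : ∀ i j, 0 < i → i ≤ j → b i ≤ b j) (hbW : ∀ n, 0 < n → n ≤ R → b n ≤ W) (hW : 0 ≤ W) :
    ‖twistedSum P R (fun n => expChar (f n)) (a * b)‖ ≤
      D * W * (12 * A ^ 2 * √κ * U + 13 * A * X / √κ * (1 + Real.log U)) := by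
  rw [twistedSum_mul]
  have hsκ : 0 < √κ := Real.sqrt_pos.2 hG.pos
  have hinner : ∀ m ∈ Ioc 0 R, ‖∑ l ∈ Ioc (P / m) (R / m),
      (a m : ℂ) * (b l : ℂ) * expChar (f (m * l : ℕ))‖ ≤
      if m ∈ Ioc 0 U then D * W * (12 * A ^ 2 * √κ + 13 * A * X / √κ * (1 / m)) else 0 := by
    intro m hm
    obtain ⟨hm0, hmR⟩ := mem_Ioc.1 hm
    have hp0 : 0 ≤ P / m := Nat.zero_le _
    split_ifs with hmU
    · simp only [mul_assoc]
      rw [← mul_sum, norm_mul, Complex.norm_real, Real.norm_eq_abs, ← mul_assoc, mul_assoc]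
      apply mul_le_mul (haD m hmR) _ (norm_nonneg _) hD
      rcases lt_or_ge (P / m) (R / m) with hlt | hge
      · have hKpos : 0 ≤ 12 * A ^ 2 * √κ + 13 * A * X / √κ * (1 / m) := by positivity
        have h1 := norm_sum_monotone_mul_le (fun l => expChar (f (m * l : ℕ))) b (R / m)
          (R / m - P / m) (P / m) (by omega)
          (fun a' h1 h2 => type_one_inner hf hA hX hP hR hG hm0 h1 le_rfl)
          (fun i j h1 h2 h3 => hbm i j (by omega) h2) 0 (hb0 _ (by omega))
          (fun i h1 h2 => hb0 _ (by omega))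
        simp only [sub_zero] at h1
        refine h1.trans ?_
        rw [mul_assoc] at *
        have := hbW (R / m) (by omega) (Nat.div_le_self _ _)
        simpa only [mul_assoc] using mul_le_mul_of_nonneg_right this hKpos
      · rw [Ioc_eq_empty (by omega)]
        simp only [sum_empty, norm_zero]
        positivity
    · rw [haU m (by simp only [mem_Ioc] at hmU; omega)]
      simp
  refine (norm_sum_le _ _).trans ((sum_le_sum hinner).trans ?_)
  rw [← sum_filter]
  have hsub : {m ∈ Ioc 0 R | m ∈ Ioc 0 U} ⊆ Ioc 0 U := fun m hm => (mem_filter.1 hm).2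
  refine (sum_le_sum_of_subset_of_nonneg hsub fun m _ _ => by positivity).trans ?_
  rw [← mul_sum, sum_add_distrib, sum_const, Nat.card_Ioc, nsmul_eq_mul]
  have hharm : ∑ m ∈ Ioc 0 U, 1 / (m : ℝ) ≤ 1 + Real.log U := by
    have h := harmonic_le_one_add_log U
    rw [harmonic_eq_sum_Icc] at h
    push_cast at h
    have e : Ioc 0 U = Icc 1 U := by ext; simp; omega
    rw [e]
    simpa [one_div] using h
  apply mul_le_mul_of_nonneg_left _ (by positivity)
  apply add_le_add
  · rw [tsub_zero, mul_comm]
  · rw [← mul_sum]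
    exact mul_le_mul_of_nonneg_left hharm (by positivity)

end

/-! ### Type II sums -/

/-- Cauchy–Schwarz for a bilinear sum, the second variable being cut into blocks of length `Q`. -/
lemma norm_bilinear_sq_le (M S : Finset ℕ) (a : ℕ → ℂ) (z : ℕ → ℕ → ℂ) (Q : ℕ) {B : ℝ}
    (hB : ∀ m ∈ M, ‖a m‖ ^ 2 ≤ B) :
    ‖∑ l ∈ S, ∑ m ∈ M, a m * z m l‖ ^ 2 ≤ (#M * B) * (#(S.image (· / Q)) *
      ∑ l ∈ S, ∑ l' ∈ S with l' / Q = l / Q, ‖∑ m ∈ M, z m l * (starRingEnd ℂ) (z m l')‖) := by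
  set J := S.image (· / Q) with hJ
  have hmaps : ∀ l ∈ S, l / Q ∈ J := fun l hl => mem_image_of_mem _ hl
  have h1 : ‖∑ l ∈ S, ∑ m ∈ M, a m * z m l‖ ^ 2 ≤
      (∑ m ∈ M, ‖a m‖ ^ 2) * ∑ m ∈ M, ‖∑ l ∈ S, z m l‖ ^ 2 := by
    rw [sum_comm]
    simp only [← mul_sum]
    have h2 : ‖∑ m ∈ M, a m * ∑ l ∈ S, z m l‖ ≤ ∑ m ∈ M, ‖a m‖ * ‖∑ l ∈ S, z m l‖ :=
      (norm_sum_le _ _).trans (by simp)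
    exact (pow_le_pow_left₀ (norm_nonneg _) h2 2).trans (sum_mul_sq_le_sq_mul_sq _ _ _)
  have h2 : ∀ m, ‖∑ l ∈ S, z m l‖ ^ 2 ≤ #J * ∑ j ∈ J, ‖∑ l ∈ S with l / Q = j, z m l‖ ^ 2 := by
    intro m
    rw [← sum_fiberwise_of_maps_to hmaps]
    refine (pow_le_pow_left₀ (norm_nonneg _) (norm_sum_le _ _) 2).trans ?_
    exact sq_sum_le_card_mul_sum_sq
  have h3 : ∑ m ∈ M, ∑ j ∈ J, ‖∑ l ∈ S with l / Q = j, z m l‖ ^ 2 ≤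
      ∑ l ∈ S, ∑ l' ∈ S with l' / Q = l / Q, ‖∑ m ∈ M, z m l * (starRingEnd ℂ) (z m l')‖ := by
    have e : ∀ j, (((∑ m ∈ M, ‖∑ l ∈ S with l / Q = j, z m l‖ ^ 2 : ℝ)) : ℂ) =
        ∑ l ∈ S with l / Q = j, ∑ l' ∈ S with l' / Q = j,
          ∑ m ∈ M, z m l * (starRingEnd ℂ) (z m l') := by
      intro j
      push_cast
      simp only [← Complex.mul_conj', map_sum, sum_mul_sum]
      rw [sum_comm]
      refine sum_congr rfl fun l _ => ?_
      rw [sum_comm]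
    have h4 : ∀ j, ∑ m ∈ M, ‖∑ l ∈ S with l / Q = j, z m l‖ ^ 2 ≤
        ∑ l ∈ S with l / Q = j, ∑ l' ∈ S with l' / Q = l / Q,
          ‖∑ m ∈ M, z m l * (starRingEnd ℂ) (z m l')‖ := by
      intro j
      have h5 : ∑ m ∈ M, ‖∑ l ∈ S with l / Q = j, z m l‖ ^ 2 =
          ‖((∑ m ∈ M, ‖∑ l ∈ S with l / Q = j, z m l‖ ^ 2 : ℝ) : ℂ)‖ := by
        rw [Complex.norm_real, Real.norm_eq_abs, abs_of_nonneg]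
        exact sum_nonneg fun _ _ => sq_nonneg _
      rw [h5, e]
      refine (norm_sum_le _ _).trans (sum_le_sum fun l hl => ?_)
      rw [(mem_filter.1 hl).2]
      exact norm_sum_le _ _
    rw [sum_comm, ← sum_fiberwise_of_maps_to hmaps]
    exact sum_le_sum fun j _ => h4 j
  calc _ ≤ _ := h1
    _ ≤ (#M * B) * (#J * ∑ m ∈ M, ∑ j ∈ J, ‖∑ l ∈ S with l / Q = j, z m l‖ ^ 2) := by
      have hB' : ∑ m ∈ M, ‖a m‖ ^ 2 ≤ #M * B := by
        have := sum_le_sum hB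
        simpa using this
      apply mul_le_mul hB' _ (by positivity) ((sum_nonneg fun _ _ => sq_nonneg _).trans hB')
      rw [mul_sum]
      exact sum_le_sum fun m _ => h2 m
    _ ≤ _ := by
      have hB' : 0 ≤ #M * B := by
        have := sum_le_sum hB
        refine (sum_nonneg fun _ _ => sq_nonneg _).trans (this.trans (by simp))
      exact mul_le_mul_of_nonneg_left (mul_le_mul_of_nonneg_left h3 (by positivity)) hB'

/-- Members of the block containing l are at distance less than Q from l, and each distance occurs
at most once on either side. -/
lemma sum_block_le (S : Finset ℕ) (l Q : ℕ) (hQ : 0 < Q) (K : ℕ → ℝ) (hK : ∀ q, 0 ≤ K q)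
    (k : ℕ → ℝ) {K₀ : ℝ} (hK₀ : 0 ≤ K₀) (hk₀ : k l ≤ K₀)
    (hk : ∀ l' ∈ S, l < l' → k l' ≤ K (l' - l)) (hk' : ∀ l' ∈ S, l' < l → k l' ≤ K (l - l')) :
    ∑ l' ∈ S with l' / Q = l / Q, k l' ≤ K₀ + 2 * ∑ q ∈ Ico 1 Q, K q := by
  set B := {l' ∈ S | l' / Q = l / Q} with hB
  have hdist : ∀ l' ∈ B, l' < l + Q ∧ l < l' + Q := by
    intro l' hl'
    have h1 := (mem_filter.1 hl').2
    have h2 := Nat.div_add_mod l' Q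
    have h3 := Nat.div_add_mod l Q
    have h4 := Nat.mod_lt l' hQ
    have h5 := Nat.mod_lt l hQ
    rw [h1] at h2
    omega
  have hgt : ∑ l' ∈ B with l < l', k l' ≤ ∑ q ∈ Ico 1 Q, K q := by
    calc ∑ l' ∈ B with l < l', k l' ≤ ∑ l' ∈ B with l < l', K (l' - l) :=
          sum_le_sum fun l' h => hk l' (mem_filter.1 (mem_filter.1 h).1).1 (mem_filter.1 h).2
      _ = ∑ q ∈ ({l' ∈ B | l < l'}).image (· - l), K q := by
          rw [sum_image]
          intro x hx y hy hxy
          have h1 := (mem_filter.1 (mem_coe.1 hx)).2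
          have h2 := (mem_filter.1 (mem_coe.1 hy)).2
          simp only at hxy
          omega
      _ ≤ _ := by
          apply sum_le_sum_of_subset_of_nonneg _ fun _ _ _ => hK _
          intro q hq
          obtain ⟨l', h1, rfl⟩ := mem_image.1 hq
          obtain ⟨h2, h3⟩ := mem_filter.1 h1
          have := hdist l' h2
          exact mem_Ico.2 (by omega)
  have hlt : ∑ l' ∈ B with l' < l, k l' ≤ ∑ q ∈ Ico 1 Q, K q := by
    calc ∑ l' ∈ B with l' < l, k l' ≤ ∑ l' ∈ B with l' < l, K (l - l') :=
          sum_le_sum fun l' h => hk' l' (mem_filter.1 (mem_filter.1 h).1).1 (mem_filter.1 h).2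
      _ = ∑ q ∈ ({l' ∈ B | l' < l}).image (l - ·), K q := by
          rw [sum_image]
          intro x hx y hy hxy
          have h1 := (mem_filter.1 (mem_coe.1 hx)).2
          have h2 := (mem_filter.1 (mem_coe.1 hy)).2
          simp only at hxy
          omega
      _ ≤ _ := by
          apply sum_le_sum_of_subset_of_nonneg _ fun _ _ _ => hK _
          intro q hq
          obtain ⟨l', h1, rfl⟩ := mem_image.1 hq
          obtain ⟨h2, h3⟩ := mem_filter.1 h1
          have := hdist l' h2
          exact mem_Ico.2 (by omega)
  have heq : ∑ l' ∈ B with l' = l, k l' ≤ K₀ := by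
    rw [sum_filter, sum_ite_eq' B l k]
    split_ifs
    · exact hk₀
    · exact hK₀
  have hsplit : ∑ l' ∈ B, k l' = ∑ l' ∈ B with l < l', k l' + (∑ l' ∈ B with l' < l, k l' +
      ∑ l' ∈ B with l' = l, k l') := by
    clear_value B
    rw [sum_filter, sum_filter, sum_filter, ← sum_add_distrib, ← sum_add_distrib]
    refine sum_congr rfl fun l' _ => ?_
    rcases lt_trichotomy l l' with h | h | h
    · simp [h, h.not_gt, h.ne']
    · simp [h]
    · simp [h, h.not_gt, h.ne]
  rw [hsplit]
  linarith

lemma sum_sqrt_le (Q : ℕ) : ∑ q ∈ Ico 1 Q, √(q : ℝ) ≤ Q * √(Q : ℝ) := by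
  calc ∑ q ∈ Ico 1 Q, √(q : ℝ) ≤ ∑ q ∈ Ico 1 Q, √(Q : ℝ) :=
        sum_le_sum fun q hq => Real.sqrt_le_sqrt (by exact_mod_cast (mem_Ico.1 hq).2.le)
    _ = ((Q - 1 : ℕ) : ℝ) * √(Q : ℝ) := by simp
    _ ≤ _ := by
        apply mul_le_mul_of_nonneg_right _ (Real.sqrt_nonneg _)
        exact_mod_cast Nat.sub_le Q 1

lemma sum_inv_sqrt_le (Q : ℕ) : ∑ q ∈ Ico 1 (Q + 1), 1 / √(q : ℝ) ≤ 2 * √(Q : ℝ) := by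
  induction Q with
  | zero => simp
  | succ Q ih =>
    rw [sum_Ico_succ_top (by omega)]
    refine (add_le_add ih le_rfl).trans ?_
    push_cast
    have hp : 0 < √((Q : ℝ) + 1) := Real.sqrt_pos.2 (by positivity)
    have h1 : √(Q : ℝ) ^ 2 = Q := Real.sq_sqrt (by positivity)
    have h2 : √((Q : ℝ) + 1) ^ 2 = Q + 1 := Real.sq_sqrt (by positivity)
    have h3 : 1 / √((Q : ℝ) + 1) ≤ 2 * (√((Q : ℝ) + 1) - √(Q : ℝ)) := by
      rw [div_le_iff₀ hp]
      nlinarith [sq_nonneg (√((Q : ℝ) + 1) - √(Q : ℝ))]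
    linarith

lemma card_image_div_le {L Q : ℕ} (hQ : 0 < Q) (hQL : Q ≤ L) :
    (#((Ico L (2 * L)).image (· / Q)) : ℝ) ≤ 3 * L / Q := by
  have hsub : (Ico L (2 * L)).image (· / Q) ⊆ Ico (L / Q) (2 * L / Q + 1) := by
    intro j hj
    obtain ⟨l, hl, rfl⟩ := mem_image.1 hj
    obtain ⟨h1, h2⟩ := mem_Ico.1 hl
    have := Nat.div_le_div_right (c := Q) h1
    have := Nat.div_le_div_right (c := Q) h2.le
    exact mem_Ico.2 ⟨by omega, by omega⟩
  have h1 := card_le_card hsub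
  rw [Nat.card_Ico] at h1
  have hQ' : (0 : ℝ) < Q := by exact_mod_cast hQ
  have h2 : (1 : ℝ) ≤ L / Q := by
    rw [le_div_iff₀ hQ', one_mul]; exact_mod_cast hQL
  have h3 : ((2 * L / Q : ℕ) : ℝ) ≤ 2 * L / Q := by
    have := Nat.cast_div_le (α := ℝ) (m := 2 * L) (n := Q)
    push_cast at this
    exact this
  have h4 : (L : ℝ) / Q < (L / Q : ℕ) + 1 := by
    rw [div_lt_iff₀ hQ']
    have := Nat.lt_div_mul_add (a := L) hQ
    have h5 : L < (L / Q + 1) * Q := by linarith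
    exact_mod_cast h5
  have h5 : L / Q ≤ 2 * L / Q + 1 := by
    have := Nat.div_le_div_right (c := Q) (show L ≤ 2 * L by omega)
    omega
  have h6 : (#((Ico L (2 * L)).image (· / Q)) : ℝ) + (L / Q : ℕ) ≤ (2 * L / Q : ℕ) + 1 := by
    exact_mod_cast (by omega : #((Ico L (2 * L)).image (· / Q)) + L / Q ≤ 2 * L / Q + 1)
  have e1 : 3 * (L : ℝ) / Q = 3 * (L / Q) := by ring
  have e2 : 2 * (L : ℝ) / Q = 2 * (L / Q) := by ring
  rw [e1]
  rw [e2] at h3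
  linarith

section

variable {f f₁ G₁ G₂ : ℝ → ℝ} (hf : IsPhase f f₁ G₁ G₂) {P R : ℕ} {A X : ℝ}

include hf in
/-- The sum over `m` of `e(f(m l') - f(m l))`. -/
lemma type_two_inner (hA : 1 ≤ A) (hX : 1 ≤ X) (hP : X ≤ P + 1) (hR : R ≤ A * X)
    {s κ : ℝ} (hG : HasLevel G₂ P R s κ) {L l l' a b : ℕ} (hL : 0 < L) (hl : L ≤ l) (hll : l < l')
    (hl' : l' ≤ 2 * L) (ha : P / l ≤ a) (hb : b ≤ R / l') :
    ‖∑ m ∈ Ioc a b, expChar (f (m * l' : ℕ) - f (m * l : ℕ))‖ ≤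
      24 * A ^ 2 * √(κ / L) * √((l' - l : ℕ) : ℝ) +
        13 * A * X / √(L * κ) * (1 / √((l' - l : ℕ) : ℝ)) := by
  have hκ := hG.pos
  have hL' : (0 : ℝ) < L := by exact_mod_cast hL
  have hLl : (L : ℝ) ≤ l := by exact_mod_cast hl
  have hl0 : (0 : ℝ) < l := by linarith
  have hll' : (l : ℝ) < l' := by exact_mod_cast hll
  have hl'0 : (0 : ℝ) < l' := by linarith
  have hl'L : (l' : ℝ) ≤ 2 * L := by exact_mod_cast hl'
  have hAX : 0 < A * X := by positivity
  set q : ℝ := ((l' - l : ℕ) : ℝ) with hq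
  have hqe : q = l' - l := by rw [hq, Nat.cast_sub hll.le]
  have hq0 : 0 < q := by rw [hqe]; linarith
  have hbR : (b : ℝ) * l' ≤ R := by
    have := (Nat.le_div_iff_mul_le (by omega : 0 < l')).1 hb
    exact_mod_cast this
  have hlo : ∀ y ∈ Set.Icc (a + 1 : ℝ) b, (P + 1 : ℝ) ≤ l * y := by
    intro y hy
    have h1 : P + 1 ≤ l * (a + 1) := by
      have h2 := Nat.lt_div_mul_add (a := P) (by omega : 0 < l)
      have h3 : P / l * l ≤ a * l := Nat.mul_le_mul_right _ ha
      have : l * (a + 1) = a * l + l := by ring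
      omega
    have h1' : (P + 1 : ℝ) ≤ l * (a + 1) := by exact_mod_cast h1
    exact h1'.trans (mul_le_mul_of_nonneg_left hy.1 hl0.le)
  have hhi : ∀ y ∈ Set.Icc (a + 1 : ℝ) b, l' * y ≤ (R : ℝ) := by
    intro y hy
    calc l' * y ≤ l' * b := mul_le_mul_of_nonneg_left hy.2 hl'0.le
      _ ≤ R := by linarith
  have hypos : ∀ y ∈ Set.Icc (a + 1 : ℝ) b, 0 < y := fun y hy => by
    have : (0 : ℝ) ≤ a := by positivity
    linarith [hy.1]
  set F₂ : ℝ → ℝ := fun y => G₁ (l' * y) / (l' * y) ^ 2 * l' * l' - G₁ (l * y) / (l * y) ^ 2 * l * l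
    with hF₂
  -- The differenced phase has second derivative (G₁(l'y) - G₁(ly))/y². Since G₁' = G₂/x, a level
  -- for G₂ fixes its sign and size.
  have hmvt : ∀ y ∈ Set.Icc (a + 1 : ℝ) b, ∃ ξ ∈ Set.Icc (P + 1 : ℝ) R,
      F₂ y = q * (1 / y) * (G₂ ξ * (1 / ξ)) := by
    intro y hy
    have hy0 := hypos y hy
    have hlt : l * y < l' * y := mul_lt_mul_of_pos_right hll' hy0
    have hly0 : 0 < l * y := by positivity
    obtain ⟨ξ, hξ, he⟩ := exists_hasDerivAt_eq_slope G₁ (fun x => G₂ x / x) hlt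
      (fun x hx => (hf.deriv₃ x (hly0.trans_le hx.1)).continuousAt.continuousWithinAt)
      (fun x hx => hf.deriv₃ x (hly0.trans hx.1))
    refine ⟨ξ, ⟨(hlo y hy).trans hξ.1.le, hξ.2.le.trans (hhi y hy)⟩, ?_⟩
    have hξ0 : 0 < ξ := hly0.trans hξ.1
    rw [eq_div_iff (by linarith)] at he
    have e1 : F₂ y = (G₁ (l' * y) - G₁ (l * y)) / y ^ 2 := by
      simp only [hF₂]
      field_simp
    rw [e1, ← he, hqe]
    field_simp
  set g := q * (L / (A * X)) * (κ / (A * X)) with hg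
  have hgpos : 0 < g := by positivity
  have hsg : √g = √q * √(L * κ) / (A * X) := by
    have : g = q * (L * κ) / (A * X) ^ 2 := by rw [hg]; field_simp
    rw [this, Real.sqrt_div (by positivity), Real.sqrt_sq (by positivity),
      Real.sqrt_mul hq0.le]
  have key := second_derivative_test (fun y => f (l' * y) - f (l * y))
    (fun y => f₁ (l' * y) * l' - f₁ (l * y) * l) F₂ a b (g := g) (h := 4 * A ^ 2) (s := s) hgpos
    (by nlinarith) hG.sign
    (fun y hy => by
      have := hypos y hy
      exact ((hf.deriv₁ (l' * y) (by positivity)).comp_const_mul_left).sub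
        ((hf.deriv₁ (l * y) (by positivity)).comp_const_mul_left))
    (fun y hy => by
      have := hypos y hy
      exact ((hf.deriv₂ (l' * y) (by positivity)).comp_const_mul_left.mul_const (l' : ℝ)).sub
        ((hf.deriv₂ (l * y) (by positivity)).comp_const_mul_left.mul_const (l : ℝ)))
    (fun y hy => by
      obtain ⟨ξ, hξ, he⟩ := hmvt y hy
      have hy0 := hypos y hy
      have hξ0 : 0 < ξ := by linarith [hξ.1]
      have e : s * F₂ y = q * (1 / y) * (s * G₂ ξ * (1 / ξ)) := by rw [he]; ring
      rw [e, hg]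
      have h1 := hG.low ξ hξ
      have h2 : (L : ℝ) / (A * X) ≤ 1 / y := by
        rw [div_le_div_iff₀ hAX hy0]
        have := hhi y hy
        have : L * y ≤ l' * y := mul_le_mul_of_nonneg_right (by linarith) hy0.le
        linarith
      have h3 : κ / (A * X) ≤ s * G₂ ξ * (1 / ξ) := by
        rw [div_eq_mul_one_div]
        apply mul_le_mul h1 _ (by positivity) (by linarith)
        exact one_div_le_one_div_of_le hξ0 (hξ.2.trans hR)
      apply mul_le_mul (mul_le_mul_of_nonneg_left h2 hq0.le) h3 (by positivity) (by positivity))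
    (fun y hy => by
      obtain ⟨ξ, hξ, he⟩ := hmvt y hy
      have hy0 := hypos y hy
      have hξ0 : 0 < ξ := by linarith [hξ.1]
      have e : s * F₂ y = q * (1 / y) * (s * G₂ ξ * (1 / ξ)) := by rw [he]; ring
      have e2 : 4 * A ^ 2 * g = q * (2 * L / X) * (2 * κ * (1 / X)) := by
        rw [hg]; field_simp; norm_num
      rw [e, e2]
      have h1 := hG.high ξ hξ
      have h1' := hG.low ξ hξ
      have h2 : 1 / y ≤ 2 * L / X := by
        rw [div_le_div_iff₀ hy0 (by positivity)]
        have h4 := hlo y hy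
        have : l * y ≤ 2 * L * y := mul_le_mul_of_nonneg_right (by linarith) hy0.le
        linarith
      have h3 : s * G₂ ξ * (1 / ξ) ≤ 2 * κ * (1 / X) := by
        apply mul_le_mul h1 _ (by positivity) (by linarith)
        exact one_div_le_one_div_of_le (by positivity) (hP.trans hξ.1)
      apply mul_le_mul (mul_le_mul_of_nonneg_left h2 hq0.le) h3 _ (by positivity)
      have : 0 ≤ s * G₂ ξ := by linarith
      positivity)
  have hcast : ∀ m : ℕ, f (m * l' : ℕ) - f (m * l : ℕ) = f (l' * m) - f (l * m) := fun m => by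
    push_cast; rw [mul_comm (m : ℝ), mul_comm (m : ℝ)]
  simp only [hcast]
  refine key.trans ?_
  have hsq : 0 < √q := Real.sqrt_pos.2 hq0
  have hsL : 0 < √(L : ℝ) := Real.sqrt_pos.2 hL'
  have hsκ : 0 < √κ := Real.sqrt_pos.2 hκ
  have hLL : √(L : ℝ) * √(L : ℝ) = L := Real.mul_self_sqrt hL'.le
  have hlen : ((b - a : ℕ) : ℝ) ≤ A * X / L := by
    rw [le_div_iff₀ hL']
    have h1 : ((b - a : ℕ) : ℝ) ≤ b := by exact_mod_cast Nat.sub_le b a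
    have h2 : ((b - a : ℕ) : ℝ) * L ≤ b * l' := mul_le_mul h1 (by linarith) hL'.le (by positivity)
    linarith
  rw [hsg, Real.sqrt_mul hL'.le, Real.sqrt_div hκ.le]
  have t1 : 6 * (4 * A ^ 2 * ((b - a : ℕ) : ℝ) * (√q * (√(L : ℝ) * √κ) / (A * X))) ≤
      24 * A ^ 2 * (√κ / √(L : ℝ)) * √q := by
    calc _ ≤ 6 * (4 * A ^ 2 * (A * X / L) * (√q * (√(L : ℝ) * √κ) / (A * X))) := by gcongr
      _ = _ := by
        nth_rewrite 1 [← hLL]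
        field_simp
        norm_num
  have t2 : 13 / (√q * (√(L : ℝ) * √κ) / (A * X)) = 13 * A * X / (√(L : ℝ) * √κ) * (1 / √q) := by
    field_simp
  linarith

include hf in
/-- A dyadic type II sum. -/
lemma type_two_dyadic (hA : 1 ≤ A) (hX : 1 ≤ X) (hP : X ≤ P + 1) (hR : R ≤ A * X)
    {s κ : ℝ} (hG : HasLevel G₂ P R s κ) (a b : ℕ → ℝ) {L Q : ℕ} (hQ : 0 < Q) (hQL : Q ≤ L) {D : ℝ}
    (ha : ∀ n, n ≤ R → |a n| ≤ D) (hb : ∀ n, n ≤ R → |b n| ≤ D) :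
    ‖∑ l ∈ Ico L (2 * L), ∑ m ∈ Ioc (P / l) (R / l),
      (a m : ℂ) * (b l : ℂ) * expChar (f (m * l : ℕ))‖ ^ 2 ≤
    3 * A * D ^ 4 * X * (A * X / Q + 48 * A ^ 2 * √(Q * L * κ) + 52 * A * X * √(L / (Q * κ))) := by
  have hκ := hG.pos
  have hL : 0 < L := by omega
  have hL' : (0 : ℝ) < L := by exact_mod_cast hL
  have hQ' : (0 : ℝ) < Q := by exact_mod_cast hQ
  have hD : 0 ≤ D := (abs_nonneg _).trans (ha 0 (Nat.zero_le _))
  set M := Ioc 0 (R / L) with hM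
  -- The range of m depends on l; encoding it in z lets m run over the fixed set M, as
  -- Cauchy–Schwarz requires. The condition l ≤ R keeps the bound on b available.
  set z : ℕ → ℕ → ℂ := fun m l => if m ∈ Ioc (P / l) (R / l) ∧ l ≤ R then
    (b l : ℂ) * expChar (f (m * l : ℕ)) else 0 with hz
  have hMR : (#M : ℝ) ≤ A * X / L := by
    rw [hM, Nat.card_Ioc, Nat.sub_zero, le_div_iff₀ hL']
    have := Nat.div_mul_le_self R L
    have : ((R / L : ℕ) : ℝ) * L ≤ R := by exact_mod_cast this
    linarith
  have hrew : ∑ l ∈ Ico L (2 * L), ∑ m ∈ Ioc (P / l) (R / l),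
      (a m : ℂ) * (b l : ℂ) * expChar (f (m * l : ℕ)) =
      ∑ l ∈ Ico L (2 * L), ∑ m ∈ M, (a m : ℂ) * z m l := by
    refine sum_congr rfl fun l hl => ?_
    have hlL := (mem_Ico.1 hl).1
    have hsub : Ioc (P / l) (R / l) ⊆ M := fun m hm => by
      have h1 := mem_Ioc.1 hm
      have h2 : R / l ≤ R / L := Nat.div_le_div_left hlL hL
      have h3 : 0 ≤ P / l := Nat.zero_le _
      exact mem_Ioc.2 ⟨by omega, by omega⟩
    rw [← sum_subset hsub]
    · refine sum_congr rfl fun m hm => ?_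
      have hlR : l ≤ R := by
        have h1 := mem_Ioc.1 hm
        have h3 : 0 < R / l := (Nat.zero_le _).trans_lt (h1.1.trans_le h1.2)
        exact (Nat.div_pos_iff.1 h3).2
      simp only [hz, if_pos (And.intro hm hlR)]
      ring
    · intro m _ hm
      simp only [hz]
      rw [if_neg (fun h => hm h.1), mul_zero]
  have hcauchy := norm_bilinear_sq_le M (Ico L (2 * L)) (fun m => (a m : ℂ)) z Q (B := D ^ 2)
    (fun m hm => by
      rw [Complex.norm_real, Real.norm_eq_abs]
      have h1 := mem_Ioc.1 hm
      exact pow_le_pow_left₀ (abs_nonneg _) (ha m (h1.2.trans (Nat.div_le_self _ _))) 2)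
  set c₁ := 24 * A ^ 2 * √(κ / L) with hc₁
  set c₂ := 13 * A * X / √(L * κ) with hc₂
  have hc₁0 : 0 ≤ c₁ := by positivity
  have hc₂0 : 0 ≤ c₂ := by positivity
  have hpair : ∀ l ∈ Ico L (2 * L), ∀ l' ∈ Ico L (2 * L), l < l' →
      ‖∑ m ∈ M, z m l' * (starRingEnd ℂ) (z m l)‖ ≤
        D ^ 2 * (c₁ * √((l' - l : ℕ) : ℝ) + c₂ * (1 / √((l' - l : ℕ) : ℝ))) := by
    intro l hl l' hl' hll
    have hrhs : 0 ≤ c₁ * √((l' - l : ℕ) : ℝ) + c₂ * (1 / √((l' - l : ℕ) : ℝ)) := by positivity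
    have hl1 := mem_Ico.1 hl
    have hl1' := mem_Ico.1 hl'
    rcases le_or_gt l' R with hl'R | hl'R
    swap
    · have : ∀ m ∈ M, z m l' * (starRingEnd ℂ) (z m l) = 0 := by
        intro m _
        simp only [hz]
        rw [if_neg (by omega), zero_mul]
      rw [sum_congr rfl this]
      simp only [sum_const_zero, norm_zero]
      positivity
    have e : ∑ m ∈ M, z m l' * (starRingEnd ℂ) (z m l) = ((b l' * b l : ℝ) : ℂ) *
        ∑ m ∈ Ioc (P / l) (R / l'), expChar (f (m * l' : ℕ) - f (m * l : ℕ)) := by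
      have hsub : Ioc (P / l) (R / l') ⊆ M := fun m hm => by
        have h1 := mem_Ioc.1 hm
        have h2 : R / l' ≤ R / L := Nat.div_le_div_left hl1'.1 hL
        have h3 : 0 ≤ P / l := Nat.zero_le _
        exact mem_Ioc.2 ⟨by omega, by omega⟩
      have h3 : P / l' ≤ P / l := Nat.div_le_div_left hll.le (by omega)
      have h4 : R / l' ≤ R / l := Nat.div_le_div_left hll.le (by omega)
      rw [mul_sum, ← sum_subset hsub]
      · refine sum_congr rfl fun m hm => ?_
        have h1 := mem_Ioc.1 hm
        simp only [hz]
        rw [if_pos ⟨mem_Ioc.2 ⟨by omega, by omega⟩, hl'R⟩,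
          if_pos ⟨mem_Ioc.2 ⟨by omega, by omega⟩, by omega⟩, ← expChar_mul_conj, map_mul,
          Complex.conj_ofReal]
        push_cast
        ring
      · intro m _ hm
        simp only [hz]
        by_cases h5 : m ∈ Ioc (P / l') (R / l')
        · by_cases h6 : m ∈ Ioc (P / l) (R / l)
          · exact absurd (mem_Ioc.2 ⟨(mem_Ioc.1 h6).1, (mem_Ioc.1 h5).2⟩) hm
          · simp [h6]
        · simp [h5]
    rw [e, norm_mul, Complex.norm_real, Real.norm_eq_abs, abs_mul, sq]
    apply mul_le_mul (mul_le_mul (hb l' hl'R) (hb l (by omega)) (abs_nonneg _) hD) _ (norm_nonneg _)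
      (by positivity)
    exact type_two_inner hf hA hX hP hR hG hL hl1.1 hll hl1'.2.le le_rfl le_rfl
  have hrow : ∀ l ∈ Ico L (2 * L), ∑ l' ∈ Ico L (2 * L) with l' / Q = l / Q,
      ‖∑ m ∈ M, z m l * (starRingEnd ℂ) (z m l')‖ ≤
        D ^ 2 * (A * X / L + 2 * (c₁ * (Q * √(Q : ℝ)) + c₂ * (2 * √(Q : ℝ)))) := by
    intro l hl
    have h1 := sum_block_le (Ico L (2 * L)) l Q hQ
      (fun q => D ^ 2 * (c₁ * √(q : ℝ) + c₂ * (1 / √(q : ℝ)))) (fun q => by positivity)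
      (fun l' => ‖∑ m ∈ M, z m l * (starRingEnd ℂ) (z m l')‖) (K₀ := D ^ 2 * (A * X / L))
      (by positivity)
      (by
        refine (norm_sum_le _ _).trans ?_
        have hzb : ∀ m ∈ M, ‖z m l * (starRingEnd ℂ) (z m l)‖ ≤ D ^ 2 := by
          intro m _
          rw [norm_mul, RCLike.norm_conj, ← sq]
          apply pow_le_pow_left₀ (norm_nonneg _)
          simp only [hz]
          split_ifs with h
          · rw [norm_mul, norm_expChar, mul_one, Complex.norm_real, Real.norm_eq_abs]
            exact hb l h.2
          · simpa using hD
        refine (sum_le_sum hzb).trans ?_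
        rw [sum_const, nsmul_eq_mul, mul_comm]
        exact mul_le_mul_of_nonneg_left hMR (by positivity))
      (fun l' hl' hll => by
        have h2 : ‖∑ m ∈ M, z m l * (starRingEnd ℂ) (z m l')‖ =
            ‖∑ m ∈ M, z m l' * (starRingEnd ℂ) (z m l)‖ := by
          rw [← RCLike.norm_conj, map_sum]
          congr 1
          exact sum_congr rfl fun m _ => by rw [map_mul, Complex.conj_conj, mul_comm]
        rw [h2]
        exact hpair l hl l' hl' hll)
      (fun l' hl' hll => hpair l' hl' l hl hll)
    refine h1.trans ?_
    have h2 : ∑ q ∈ Ico 1 Q, D ^ 2 * (c₁ * √(q : ℝ) + c₂ * (1 / √(q : ℝ))) ≤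
        D ^ 2 * (c₁ * (Q * √(Q : ℝ)) + c₂ * (2 * √(Q : ℝ))) := by
      rw [← mul_sum, sum_add_distrib, ← mul_sum, ← mul_sum]
      have h3 : ∑ q ∈ Ico 1 Q, 1 / √(q : ℝ) ≤ 2 * √(Q : ℝ) :=
        (sum_le_sum_of_subset_of_nonneg (Ico_subset_Ico_right (Nat.le_succ Q))
          fun q _ _ => by positivity).trans (sum_inv_sqrt_le Q)
      have h4 := sum_sqrt_le Q
      gcongr
    linarith
  rw [hrew]
  refine hcauchy.trans ?_
  have hJ := card_image_div_le hQ hQL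
  have hsum : ∑ l ∈ Ico L (2 * L), ∑ l' ∈ Ico L (2 * L) with l' / Q = l / Q,
      ‖∑ m ∈ M, z m l * (starRingEnd ℂ) (z m l')‖ ≤
      L * (D ^ 2 * (A * X / L + 2 * (c₁ * (Q * √(Q : ℝ)) + c₂ * (2 * √(Q : ℝ))))) := by
    have h2 := sum_le_sum hrow
    rw [sum_const, Nat.card_Ico, nsmul_eq_mul] at h2
    have e : ((2 * L - L : ℕ) : ℝ) = L := by congr 1; omega
    rwa [e] at h2
  calc _ ≤ (A * X / L * D ^ 2) * (3 * L / Q * (L * (D ^ 2 * (A * X / L +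
          2 * (c₁ * (Q * √(Q : ℝ)) + c₂ * (2 * √(Q : ℝ))))))) := by
        apply mul_le_mul (mul_le_mul_of_nonneg_right hMR (by positivity)) _ _ (by positivity)
        · apply mul_le_mul hJ hsum _ (by positivity)
          exact sum_nonneg fun _ _ => sum_nonneg fun _ _ => norm_nonneg _
        · apply mul_nonneg (by positivity)
          exact sum_nonneg fun _ _ => sum_nonneg fun _ _ => norm_nonneg _
    _ = _ := by
        have hsL : 0 < √(L : ℝ) := Real.sqrt_pos.2 hL'
        have hsQ : 0 < √(Q : ℝ) := Real.sqrt_pos.2 hQ'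
        have hsκ : 0 < √κ := Real.sqrt_pos.2 hκ
        have eL : (L : ℝ) = √(L : ℝ) ^ 2 := (Real.sq_sqrt hL'.le).symm
        have eQ : (Q : ℝ) = √(Q : ℝ) ^ 2 := (Real.sq_sqrt hQ'.le).symm
        rw [hc₁, hc₂, Real.sqrt_mul hL'.le κ, Real.sqrt_mul (by positivity : 0 ≤ (Q : ℝ) * L) κ,
          Real.sqrt_mul hQ'.le (L : ℝ), Real.sqrt_div hκ.le, Real.sqrt_div hL'.le,
          Real.sqrt_mul hQ'.le κ]
        generalize √(L : ℝ) = x at *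
        generalize √(Q : ℝ) = y at *
        generalize √κ = w at *
        rw [eL, eQ]
        field_simp
        ring

end

section

variable {f f₁ G₁ G₂ : ℝ → ℝ} (hf : IsPhase f f₁ G₁ G₂) {P R : ℕ} {A X : ℝ}

-- The bound for a dyadic block increases with L, so the blocks are taken in the variable carrying
-- b, which is supported on (U, Y]. Counting the blocks gives the logarithmic factor.
include hf in
lemma type_two_half (hA : 1 ≤ A) (hX : 1 ≤ X) (hP : X ≤ P + 1) (hR : R ≤ A * X)
    {s κ : ℝ} (hG : HasLevel G₂ P R s κ) (a b : ArithmeticFunction ℝ) {U Y Q : ℕ} (hQ : 0 < Q)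
    (hQU : 2 * Q ≤ U + 1) {D : ℝ} (ha : ∀ n, n ≤ R → |a n| ≤ D) (hb : ∀ n, n ≤ R → |b n| ≤ D)
    (hbU : ∀ n, n ≤ U → b n = 0) (hbY : ∀ n, Y < n → b n = 0) :
    ‖twistedSum P R (fun n => expChar (f n)) (b * a)‖ ≤ (Nat.log 2 R + 1) *
      √(3 * A * D ^ 4 * X * (A * X / Q + 48 * A ^ 2 * √(Q * Y * κ) + 52 * A * X * √(Y / (Q * κ)))) := by
  have hκ := hG.pos
  rw [twistedSum_mul]
  set F : ℕ → ℂ := fun l => ∑ m ∈ Ioc (P / l) (R / l),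
    (b l : ℂ) * (a m : ℂ) * expChar (f (l * m : ℕ)) with hF
  have hmaps : ∀ l ∈ Ioc 0 R, Nat.log 2 l ∈ range (Nat.log 2 R + 1) := fun l hl =>
    mem_range.2 (Nat.lt_succ_of_le (Nat.log_mono_right (mem_Ioc.1 hl).2))
  change ‖∑ l ∈ Ioc 0 R, F l‖ ≤ _
  rw [← sum_fiberwise_of_maps_to hmaps]
  refine (norm_sum_le _ _).trans ?_
  have hbound : ∀ i ∈ range (Nat.log 2 R + 1), ‖∑ l ∈ Ioc 0 R with Nat.log 2 l = i, F l‖ ≤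
      √(3 * A * D ^ 4 * X *
        (A * X / Q + 48 * A ^ 2 * √(Q * Y * κ) + 52 * A * X * √(Y / (Q * κ)))) := by
    intro i _
    set L := 2 ^ i with hL
    have hLpos : 0 < L := by positivity
    have hfib : ∀ l, 0 < l → (Nat.log 2 l = i ↔ l ∈ Ico L (2 * L)) := by
      intro l hl
      rw [Nat.log_eq_iff (Or.inr ⟨by norm_num, hl.ne'⟩), mem_Ico, pow_succ, mul_comm (2 ^ i) 2]
    have hsub : ∑ l ∈ Ioc 0 R with Nat.log 2 l = i, F l = ∑ l ∈ Ico L (2 * L), F l := by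
      apply sum_subset
      · intro l hl
        have h1 := mem_filter.1 hl
        exact (hfib l (mem_Ioc.1 h1.1).1).1 h1.2
      · intro l hl hl'
        have hl0 : 0 < l := hLpos.trans_le (mem_Ico.1 hl).1
        have hlR : R < l := by
          by_contra h
          exact hl' (mem_filter.2 ⟨mem_Ioc.2 ⟨hl0, not_lt.1 h⟩, (hfib l hl0).2 hl⟩)
        simp only [hF]
        rw [Nat.div_eq_of_lt hlR, Ioc_eq_empty (by simp), sum_empty]
    rw [hsub]
    -- In this case 2Q ≤ U + 1 ≤ 2L, so blocks of length Q fit. Every other dyadic range misses the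
    -- support of b.
    by_cases hcase : U < 2 * L ∧ L ≤ Y
    · have hQL : Q ≤ L := by omega
      have h1 := type_two_dyadic hf hA hX hP hR hG a b hQ hQL ha hb
      have h2 : ∑ l ∈ Ico L (2 * L), F l = ∑ l ∈ Ico L (2 * L), ∑ m ∈ Ioc (P / l) (R / l),
          (a m : ℂ) * (b l : ℂ) * expChar (f (m * l : ℕ)) := by
        refine sum_congr rfl fun l _ => sum_congr rfl fun m _ => ?_
        rw [mul_comm (b l : ℂ), mul_comm l m]
      rw [h2]
      apply Real.le_sqrt_of_sq_le
      refine h1.trans ?_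
      have hLY : (L : ℝ) ≤ Y := by exact_mod_cast hcase.2
      have hQ' : (0 : ℝ) < Q := by exact_mod_cast hQ
      gcongr
    · rw [sum_eq_zero]
      · rw [norm_zero]; positivity
      · intro l hl
        have h1 := mem_Ico.1 hl
        have : b l = 0 := by
          by_cases h : U < l
          · exact hbY l (by omega)
          · exact hbU l (by omega)
        simp [hF, this]
  refine (sum_le_sum hbound).trans ?_
  simp

lemma twistedSum_highPart_mul_highPart {Y : ℕ} (hY : R < (Y + 1) * (Y + 1)) (E : ℕ → ℂ)
    (a b : ArithmeticFunction ℝ) : twistedSum P R E (highPart Y a * highPart Y b) = 0 := by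
  refine sum_eq_zero fun n hn => ?_
  have : (highPart Y a * highPart Y b) n = 0 := by
    rw [ArithmeticFunction.mul_apply]
    refine sum_eq_zero fun p hp => ?_
    rw [Nat.mem_divisorsAntidiagonal] at hp
    rw [highPart_apply, highPart_apply]
    split_ifs with h1 h2
    · simp
    · simp
    · simp
    · have h3 := Nat.mul_le_mul (show Y + 1 ≤ p.1 by omega) (show Y + 1 ≤ p.2 by omega)
      have := (mem_Ioc.1 hn).2
      omega
  rw [this]
  simp

include hf in
/-- Type II sums. -/
lemma norm_type_two_le (hA : 1 ≤ A) (hX : 1 ≤ X) (hP : X ≤ P + 1) (hR : R ≤ A * X)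
    {s κ : ℝ} (hG : HasLevel G₂ P R s κ) (a b : ArithmeticFunction ℝ) {U Q : ℕ} (hQ : 0 < Q)
    (hQU : 2 * Q ≤ U + 1) {D : ℝ} (ha : ∀ n, n ≤ R → |a n| ≤ D) (hb : ∀ n, n ≤ R → |b n| ≤ D)
    (haU : ∀ n, n ≤ U → a n = 0) (hbU : ∀ n, n ≤ U → b n = 0) :
    ‖twistedSum P R (fun n => expChar (f n)) (a * b)‖ ≤ 2 * ((Nat.log 2 R + 1) *
      √(3 * A * D ^ 4 * X * (A * X / Q + 48 * A ^ 2 * √(Q * R.sqrt * κ) +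
        52 * A * X * √(R.sqrt / (Q * κ))))) := by
  set Y := R.sqrt with hY
  -- With Y = ⌊√R⌋ the product of the two high parts vanishes up to R. In each of the other products
  -- one factor is supported up to Y and serves as the short variable.
  have e : a * b = lowPart Y b * a + (lowPart Y a * highPart Y b + highPart Y a * highPart Y b) := by
    have h1 := lowPart_add_highPart Y a
    have h2 := lowPart_add_highPart Y b
    linear_combination (-a) * h2 - highPart Y b * h1
  rw [e, twistedSum_add, twistedSum_add,
    twistedSum_highPart_mul_highPart (Nat.lt_succ_sqrt R), add_zero, two_mul]
  refine (norm_add_le _ _).trans (add_le_add ?_ ?_)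
  · refine type_two_half hf hA hX hP hR hG a (lowPart Y b) hQ hQU ha
      (fun n hn => (abs_lowPart_le _ _ _).trans (hb n hn)) (fun n hn => ?_) (fun n hn => ?_)
    · rw [lowPart_apply, hbU n hn, ite_self]
    · rw [lowPart_apply, if_neg (by omega)]
  · refine type_two_half hf hA hX hP hR hG (highPart Y b) (lowPart Y a) hQ hQU
      (fun n hn => (abs_highPart_le _ _ _).trans (hb n hn))
      (fun n hn => (abs_lowPart_le _ _ _).trans (ha n hn)) (fun n hn => ?_) (fun n hn => ?_)
    · rw [lowPart_apply, haU n hn, ite_self]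
    · rw [lowPart_apply, if_neg (by omega)]

/-! ### Vaughan's identity on a piece with levels -/

include hf in
/-- The estimate for the von Mangoldt sum over an interval on which `G₁` and `G₂` have levels. -/
lemma norm_vonMangoldt_sum_le (hA : 1 ≤ A) (hX : 1 ≤ X) (hP : X ≤ P + 1) (hR : R ≤ A * X)
    {s₁ κ₁ s₂ κ₂ : ℝ} (hG₁ : HasLevel G₁ P R s₁ κ₁) (hG₂ : HasLevel G₂ P R s₂ κ₂)
    {U Q : ℕ} (hQ : 0 < Q) (hQU : 2 * Q ≤ U + 1) (hU : U ^ 3 ≤ P) {D : ℝ} (hD : 1 ≤ D)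
    (hlog : ∀ n : ℕ, 0 < n → n ≤ R → Real.log n ≤ D)
    (hdiv : ∀ n : ℕ, n ≤ R → (#n.divisors : ℝ) ≤ D) :
    ‖twistedSum P R (fun n => expChar (f n)) vonMangoldt‖ ≤
      2 * (D * (12 * A ^ 2 * √κ₁ * U + 13 * A * X / √κ₁ * (1 + Real.log U))) +
      4 * ((Nat.log 2 R + 1) *
      √(3 * A * D ^ 4 * X * (A * X / Q + 48 * A ^ 2 * √(Q * R.sqrt * κ₂) +
        52 * A * X * √(R.sqrt / (Q * κ₂))))) := by
  have hlog' : ∀ n : ℕ, n ≤ R → Real.log n ≤ D := by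
    intro n hn
    rcases Nat.eq_zero_or_pos n with rfl | h
    · simp; linarith
    · exact hlog n h hn
  set E : ℕ → ℂ := fun n => expChar (f n) with hE
  set c := lowPart U (moebius : ArithmeticFunction ℝ) * lowPart U vonMangoldt with hc
  set Z : ArithmeticFunction ℝ := (zeta : ArithmeticFunction ℝ) with hZ
  have hcD : ∀ n, n ≤ R → |c n| ≤ D := fun n hn =>
    (abs_lowPart_mul_lowPart_le U n).trans (hlog' n hn)
  have hZ0 : ∀ n, 0 < n → Z n = 1 := by
    intro n hn
    rw [hZ, natCoe_apply, zeta_apply, if_neg hn.ne', Nat.cast_one]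
  have hUU : U ≤ U ^ 3 := Nat.le_self_pow (by norm_num) U
  have hΛ1 : twistedSum P R E (lowPart U vonMangoldt) = 0 := by
    refine sum_eq_zero fun n hn => ?_
    have := (mem_Ioc.1 hn).1
    rw [lowPart_apply, if_neg (by omega)]
    simp
  -- Since c is supported up to U², this product lives on n ≤ U³ ≤ P, outside the summation range.
  have hcross : twistedSum P R E (highPart U c * lowPart U Z) = 0 := by
    refine sum_eq_zero fun n hn => ?_
    have : (highPart U c * lowPart U Z) n = 0 := by
      rw [ArithmeticFunction.mul_apply]
      refine sum_eq_zero fun p hp => ?_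
      rw [Nat.mem_divisorsAntidiagonal] at hp
      rw [highPart_apply, lowPart_apply]
      by_cases h1 : p.1 ≤ U
      · rw [if_pos h1, zero_mul]
      by_cases h2 : p.2 ≤ U
      · rw [if_neg h1, hc, lowPart_mul_lowPart_eq_zero, zero_mul]
        by_contra h3
        have h4 := Nat.mul_le_mul (not_lt.1 h3) h2
        have h5 := (mem_Ioc.1 hn).1
        rw [hp.1] at h4
        have : U * U * U = U ^ 3 := by ring
        omega
      · rw [if_neg h2, mul_zero]
    rw [this]
    simp
  -- The factor c reaches U², too far for a type I estimate when U ≈ X^{1/3}. Its part beyond U is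
  -- therefore paired with the part of the constant function 1 beyond U and treated as type II.
  have hid : (vonMangoldt : ArithmeticFunction ℝ) = lowPart U vonMangoldt +
      lowPart U (moebius : ArithmeticFunction ℝ) * log
      - (lowPart U c * Z + (highPart U c * lowPart U Z + highPart U c * highPart U Z))
      + highPart U vonMangoldt * (Z * highPart U (moebius : ArithmeticFunction ℝ)) := by
    have h1 := lowPart_add_highPart U c
    have h2 := lowPart_add_highPart U Z
    nth_rewrite 1 [vaughan_identity U]
    rw [← hc, ← hZ]
    linear_combination (-highPart U c) * h2 * (-1) + Z * h1
  have t1 : ‖twistedSum P R E (lowPart U (moebius : ArithmeticFunction ℝ) * log)‖ ≤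
      1 * D * (12 * A ^ 2 * √κ₁ * U + 13 * A * X / √κ₁ * (1 + Real.log U)) := by
    refine norm_type_one_le hf hA hX hP hR hG₁ _ _ zero_le_one
      (fun n _ => abs_lowPart_moebius_le U n)
      (fun n hn => by rw [lowPart_apply, if_neg (by omega)]) (fun n hn => ?_) (fun i j hi hij => ?_)
      (fun n hn hnR => by rw [log_apply]; exact hlog n hn hnR) (by linarith)
    · rw [log_apply]; exact Real.log_natCast_nonneg n
    · rw [log_apply, log_apply]
      exact Real.log_le_log (by exact_mod_cast hi) (by exact_mod_cast hij)
  have t2 : ‖twistedSum P R E (lowPart U c * Z)‖ ≤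
      D * 1 * (12 * A ^ 2 * √κ₁ * U + 13 * A * X / √κ₁ * (1 + Real.log U)) := by
    refine norm_type_one_le hf hA hX hP hR hG₁ _ _ (by linarith)
      (fun n hn => (abs_lowPart_le U c n).trans (hcD n hn))
      (fun n hn => by rw [lowPart_apply, if_neg (by omega)]) (fun n hn => ?_) (fun i j hi hij => ?_)
      (fun n hn _ => (hZ0 n hn).le) zero_le_one
    · rw [hZ0 n hn]; exact zero_le_one
    · rw [hZ0 i hi, hZ0 j (by omega)]
  have t3 := norm_type_two_le hf hA hX hP hR hG₂ (highPart U c) (highPart U Z) hQ hQU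
    (fun n hn => (abs_highPart_le U c n).trans (hcD n hn))
    (fun n hn => by
      refine (abs_highPart_le U Z n).trans ?_
      rcases Nat.eq_zero_or_pos n with rfl | h
      · simp; linarith
      · rw [hZ0 n h]; simpa using hD)
    (fun n hn => by rw [highPart_apply, if_pos hn]) (fun n hn => by rw [highPart_apply, if_pos hn])
  have t4 := norm_type_two_le hf hA hX hP hR hG₂ (highPart U vonMangoldt)
    (Z * highPart U (moebius : ArithmeticFunction ℝ)) hQ hQU
    (fun n hn => by
      refine (abs_highPart_le U vonMangoldt n).trans ?_
      rw [abs_of_nonneg vonMangoldt_nonneg]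
      exact vonMangoldt_le_log.trans (hlog' n hn))
    (fun n hn => (abs_zeta_mul_highPart_moebius_le U n).trans (hdiv n hn))
    (fun n hn => by rw [highPart_apply, if_pos hn])
    (fun n hn => zeta_mul_highPart_eq_zero hn _)
  rw [hid, twistedSum_add, twistedSum_sub, twistedSum_add, twistedSum_add, twistedSum_add, hΛ1,
    hcross, zero_add, zero_add]
  refine (norm_add_le _ _).trans ?_
  refine (add_le_add (norm_sub_le _ _) le_rfl).trans ?_
  refine (add_le_add (add_le_add le_rfl (norm_add_le _ _)) le_rfl).trans ?_
  linarith

end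

/-! ### Break points and dyadic levels -/

/-- By the intermediate value theorem, a change of side between x₀ and x forces the value y₀
strictly between u and v, because x₀ is interior and g x ≠ y₀. Hence the comparison at x₀ decides
the whole closed interval. -/
lemma abs_level_dichotomy {g : ℝ → ℝ} {u v x₀ y₀ : ℝ} (hg : ContinuousOn g (Set.Icc u v))
    (hx₀ : x₀ ∈ Set.Icc u v) (hx : u = v ∨ x₀ ∈ Set.Ioo u v)
    (hno : ∀ y ∈ Set.Ioo u v, g y ≠ y₀) :
    (g x₀ ≤ y₀ → ∀ x ∈ Set.Icc u v, g x ≤ y₀) ∧ (y₀ ≤ g x₀ → ∀ x ∈ Set.Icc u v, y₀ ≤ g x) := by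
  rcases hx with rfl | hx
  · have h1 : x₀ = u := le_antisymm hx₀.2 hx₀.1
    subst h1
    constructor <;>
    · intro h x hx
      rwa [le_antisymm hx.2 hx.1]
  have key : ∀ x ∈ Set.Icc u v, g x ≠ y₀ → ∀ y ∈ Set.uIcc x₀ x, g y ≠ y₀ := by
    intro x hxI hne y hy hyy
    have hyx : y ≠ x := by rintro rfl; exact hne hyy
    refine hno y ?_ hyy
    rcases le_total x₀ x with h | h
    · rw [Set.uIcc_of_le h] at hy
      exact ⟨hx.1.trans_le hy.1, (lt_of_le_of_ne hy.2 hyx).trans_le hxI.2⟩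
    · rw [Set.uIcc_of_ge h] at hy
      exact ⟨hxI.1.trans_lt (lt_of_le_of_ne hy.1 hyx.symm), hy.2.trans_lt hx.2⟩
  have hsub : ∀ x ∈ Set.Icc u v, Set.uIcc x₀ x ⊆ Set.Icc u v := fun x hxI =>
    Set.uIcc_subset_Icc hx₀ hxI
  constructor
  · intro h x hxI
    by_contra hlt
    have hlt := not_le.1 hlt
    obtain ⟨y, hy, hyy⟩ := intermediate_value_uIcc (hg.mono (hsub x hxI))
      (Set.mem_uIcc_of_le h hlt.le)
    exact key x hxI hlt.ne' y hy hyy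
  · intro h x hxI
    by_contra hlt
    have hlt := not_le.1 hlt
    obtain ⟨y, hy, hyy⟩ := intermediate_value_uIcc (hg.mono (hsub x hxI))
      (Set.mem_uIcc_of_ge hlt.le h)
    exact key x hxI hlt.ne y hy hyy

lemma exists_dyadic_level {v V : ℝ} (hvV : v ≤ V) (I : ℕ) :
    v ≤ V * (1 / 2) ^ I ∨ ∃ i < I, V * (1 / 2) ^ (i + 1) ≤ v ∧ v ≤ V * (1 / 2) ^ i := by
  induction I with
  | zero => left; simpa using hvV
  | succ I ih =>
    rcases ih with h | ⟨i, hi, h⟩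
    · rcases le_total v (V * (1 / 2) ^ (I + 1)) with h' | h'
      · exact Or.inl h'
      · exact Or.inr ⟨I, by omega, h', h⟩
    · exact Or.inr ⟨i, by omega, h⟩

/-- The points at which an exponential sum takes a prescribed nonzero value. -/
lemma exists_finset_value_expPoly (S : Finset ℝ) (hS : (0 : ℝ) ∉ S) (b : ℝ → ℝ) {y : ℝ}
    (hy : y ≠ 0) : ∃ Z : Finset ℝ, #Z ≤ #S + 1 ∧ ∀ t, expPoly S b t = y → t ∈ Z := by
  -- The value y is attained exactly at the zeros of the sum with the additional exponent 0 and
  -- coefficient -y; y ≠ 0 makes that sum nontrivial whatever b is.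
  have hex : ∃ γ ∈ insert 0 S, Function.update b 0 (-y) γ ≠ 0 :=
    ⟨0, mem_insert_self _ _, by simpa using hy⟩
  obtain ⟨Z, hZ, h⟩ := exists_finset_zeros_expPoly (insert 0 S) (Function.update b 0 (-y)) hex
  rw [card_insert_of_notMem hS] at hZ
  refine ⟨Z, hZ, fun t ht => h t ?_⟩
  rw [expPoly, sum_insert hS]
  have : ∑ γ ∈ S, Function.update b 0 (-y) γ * Real.exp (γ * t) = expPoly S b t := by
    refine sum_congr rfl fun γ hγ => ?_
    rw [Function.update_of_ne (by rintro rfl; exact hS hγ)]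
  rw [this, ht]
  simp

/-- Away from few break points, a combination of powers has a level, unless the piece is short. -/
lemma exists_breakpoints (S : Finset ℝ) (hS : (0 : ℝ) ∉ S) {A : ℝ} (hA : 1 ≤ A) :
    ∃ c > 0, ∃ M ≥ 1, ∀ X : ℝ, 1 ≤ X → ∀ b : ℝ → ℝ, 0 < ∑ γ ∈ S, |b γ| → ∀ I : ℕ,
      ∃ Z : Finset ℝ, #Z ≤ (I + 1) * (2 * (#S + 1)) ∧ ∀ P R : ℕ, X ≤ P + 1 → R ≤ A * X →
        (∀ z ∈ Z, ¬ ((P + 1 : ℝ) < z ∧ z < R)) →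
        (∃ s κ, HasLevel (fun x => expPoly S b (Real.log (x / X))) P R s κ ∧
          (∑ γ ∈ S, |b γ|) * (1 / 2) ^ I ≤ κ ∧ κ ≤ M * ∑ γ ∈ S, |b γ|) ∨
        ((P + 1 : ℝ) ≤ R ∧ c * (R - (P + 1) : ℝ) ^ #S ≤ X ^ #S * (1 / 2) ^ I) := by
  set T := Real.log A with hT
  have hT0 : 0 ≤ T := Real.log_nonneg hA
  obtain ⟨c₀, hc₀, _, hlarge⟩ := exists_subinterval_expPoly_large T hT0 S
  set M := 1 + ∑ γ ∈ S, Real.exp (|γ| * T) with hM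
  have hM1 : 1 ≤ M := by
    have : 0 ≤ ∑ γ ∈ S, Real.exp (|γ| * T) := sum_nonneg fun _ _ => (Real.exp_pos _).le
    linarith
  refine ⟨c₀ / (A ^ #S * M), by positivity, M, hM1, fun X hX b hB I => ?_⟩
  have hX0 : 0 < X := by linarith
  set B := ∑ γ ∈ S, |b γ| with hBdef
  -- The case y = 0 only makes the choice total; the levels used are nonzero.
  have hval : ∀ y : ℝ, ∃ Z : Finset ℝ, #Z ≤ #S + 1 ∧ (y ≠ 0 → ∀ t, expPoly S b t = y → t ∈ Z) := by
    intro y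
    by_cases hy : y = 0
    · exact ⟨∅, by simp, fun h => absurd hy h⟩
    · obtain ⟨Z, h1, h2⟩ := exists_finset_value_expPoly S hS b hy
      exact ⟨Z, h1, fun _ => h2⟩
  choose Zv hZcard hZmem using hval
  -- MB bounds the exponential sum on the whole range, so the levels start there and halve. Points
  -- where the sum equals plus or minus a level are carried back by x = X e^t.
  set lev : ℕ → ℝ := fun i => M * B * (1 / 2) ^ i with hlev
  have hlevpos : ∀ i, 0 < lev i := fun i => by simp only [hlev]; positivity
  set Z₀ : Finset ℝ := (range (I + 1)).biUnion fun i => Zv (lev i) ∪ Zv (-lev i) with hZ₀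
  refine ⟨Z₀.image (fun t => X * Real.exp t), ?_, ?_⟩
  · refine card_image_le.trans ?_
    refine (card_biUnion_le_card_mul _ _ (2 * (#S + 1)) fun i _ => ?_).trans (by simp)
    refine (card_union_le _ _).trans ?_
    have := hZcard (lev i)
    have := hZcard (-lev i)
    omega
  intro P R hP hR hZ
  set G : ℝ → ℝ := fun x => expPoly S b (Real.log (x / X)) with hG
  -- On an empty interval every level holds vacuously, and κ = MB lies in the required range.
  rcases lt_or_ge (R : ℝ) (P + 1) with hlt | hle
  · left
    refine ⟨1, M * B, ⟨Or.inl rfl, by positivity, fun x hx => ?_, fun x hx => ?_⟩, ?_, le_rfl⟩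
    · exact absurd (hx.1.trans hx.2) (not_le.2 hlt)
    · exact absurd (hx.1.trans hx.2) (not_le.2 hlt)
    · have h1 : B * (1 / 2 : ℝ) ^ I ≤ B * 1 :=
        mul_le_mul_of_nonneg_left (pow_le_one₀ (by norm_num) (by norm_num)) hB.le
      nlinarith
  have hIpos : ∀ x ∈ Set.Icc (P + 1 : ℝ) R, 0 < x := fun x hx => hX0.trans_le (hP.trans hx.1)
  have hlogI : ∀ x ∈ Set.Icc (P + 1 : ℝ) R, 0 ≤ Real.log (x / X) ∧ Real.log (x / X) ≤ T := by
    intro x hx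
    have hx0 := hIpos x hx
    constructor
    · apply Real.log_nonneg
      rw [le_div_iff₀ hX0]
      linarith [hx.1]
    · apply Real.log_le_log (by positivity)
      rw [div_le_iff₀ hX0]
      exact hx.2.trans hR
  have hcont : ContinuousOn G (Set.Icc (P + 1 : ℝ) R) := by
    apply (continuous_expPoly S b).comp_continuousOn
    apply ContinuousOn.log
    · fun_prop
    · intro x hx
      have := hIpos x hx
      positivity
  have hGle : ∀ x ∈ Set.Icc (P + 1 : ℝ) R, |G x| ≤ lev 0 := by
    intro x hx
    obtain ⟨h1, h2⟩ := hlogI x hx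
    simpa [hlev] using abs_expPoly_le S b h1 h2
  have hnolev : ∀ i ≤ I, ∀ y ∈ Set.Ioo (P + 1 : ℝ) R, |G y| ≠ lev i := by
    intro i hi y hy heq
    refine hZ y (mem_image.2 ⟨Real.log (y / X), mem_biUnion.2 ⟨i, mem_range.2 (by omega), ?_⟩, ?_⟩) hy
    · rcases (abs_eq (hlevpos i).le).1 heq with h | h
      · exact mem_union_left _ (hZmem _ (hlevpos i).ne' _ h)
      · exact mem_union_right _ (hZmem _ (neg_ne_zero.2 (hlevpos i).ne') _ h)
    · have := hIpos y (Set.Ioo_subset_Icc_self hy)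
      rw [Real.exp_log (by positivity)]
      field_simp
  set x₀ : ℝ := ((P + 1) + R) / 2 with hx₀
  have hx₀I : x₀ ∈ Set.Icc (P + 1 : ℝ) R := ⟨by linarith, by linarith⟩
  have hx₀' : (P + 1 : ℝ) = R ∨ x₀ ∈ Set.Ioo (P + 1 : ℝ) R := by
    rcases hle.eq_or_lt with h | h
    · exact Or.inl h
    · exact Or.inr ⟨by linarith, by linarith⟩
  have hdich : ∀ i ≤ I, _ := fun i hi =>
    abs_level_dichotomy (g := fun x => |G x|) hcont.abs hx₀I hx₀' (hnolev i hi)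
  rcases exists_dyadic_level (hGle x₀ hx₀I) I with h | ⟨i, hi, h1, h2⟩
  -- Here |G| is at most the lowest level on the whole piece, yet somewhere it reaches
  -- c₀(v-u)^{#S}B. This bounds the logarithmic length v - u, and R - (P+1) ≤ AX(v-u).
  · right
    refine ⟨hle, ?_⟩
    have e0 : lev 0 * (1 / 2) ^ I = lev I := by simp [hlev]
    rw [e0] at h
    have hsmall := (hdich I le_rfl).1 h
    have hP1 : (P + 1 : ℝ) ∈ Set.Icc (P + 1 : ℝ) R := ⟨le_rfl, hle⟩
    have hR1 : (R : ℝ) ∈ Set.Icc (P + 1 : ℝ) R := ⟨hle, le_rfl⟩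
    have hP0 := hIpos _ hP1
    have hR0 := hIpos _ hR1
    set u := Real.log ((P + 1 : ℝ) / X) with hu
    set v := Real.log ((R : ℝ) / X) with hv
    have huv : u ≤ v := Real.log_le_log (by positivity) (by gcongr)
    obtain ⟨u', v', a1, a2, a3, -, a5⟩ := hlarge b u v (hlogI _ hP1).1 huv (hlogI _ hR1).2
    have h5 := a5 u' ⟨le_rfl, a2⟩
    have hxu : X * Real.exp u' ∈ Set.Icc (P + 1 : ℝ) R := by
      constructor
      · have : Real.exp u ≤ Real.exp u' := Real.exp_le_exp.2 a1
        rw [hu, Real.exp_log (by positivity), div_le_iff₀ hX0] at this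
        linarith
      · have : Real.exp u' ≤ Real.exp v := Real.exp_le_exp.2 (a2.trans a3)
        rw [hv, Real.exp_log (by positivity), le_div_iff₀ hX0] at this
        linarith
    have h6 := hsmall _ hxu
    have e1 : G (X * Real.exp u') = expPoly S b u' := by
      simp only [hG]
      rw [mul_div_cancel_left₀ _ hX0.ne', Real.log_exp]
    rw [e1] at h6
    have h7 : c₀ * (v - u) ^ #S ≤ M * (1 / 2) ^ I := by
      have h8 := h5.trans h6
      simp only [hlev] at h8
      have h9 : c₀ * (v - u) ^ #S * B ≤ M * (1 / 2) ^ I * B := by linarith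
      exact le_of_mul_le_mul_right h9 hB
    have h8 : (R - (P + 1) : ℝ) ≤ A * X * (v - u) := by
      have h10 : v - u = -Real.log ((P + 1) / R) := by
        rw [hu, hv, Real.log_div hR0.ne' hX0.ne', Real.log_div hP0.ne' hX0.ne',
          Real.log_div hP0.ne' hR0.ne']
        ring
      have h11 : 1 - (P + 1 : ℝ) / R ≤ v - u := by
        have := Real.log_le_sub_one_of_pos (div_pos hP0 hR0)
        rw [h10]
        linarith
      have h12 : (R - (P + 1) : ℝ) = R * (1 - (P + 1 : ℝ) / R) := by field_simp
      rw [h12]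
      have h13 : 0 ≤ 1 - (P + 1 : ℝ) / R := by
        have : (P + 1 : ℝ) / R ≤ 1 := (div_le_one hR0).2 hle
        linarith
      exact mul_le_mul hR h11 h13 (by positivity)
    calc c₀ / (A ^ #S * M) * (R - (P + 1) : ℝ) ^ #S
        ≤ c₀ / (A ^ #S * M) * (A * X * (v - u)) ^ #S := by
          have : (0 : ℝ) ≤ R - (P + 1) := by linarith
          gcongr
      _ = X ^ #S / M * (c₀ * (v - u) ^ #S) := by
          rw [mul_pow, mul_pow]
          field_simp
      _ ≤ X ^ #S / M * (M * (1 / 2) ^ I) := by gcongr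
      _ = _ := by field_simp
  · left
    have e0 : ∀ j, lev 0 * (1 / 2) ^ j = lev j := fun j => by simp [hlev]
    rw [e0] at h1 h2
    have hup := (hdich i hi.le).1 h2
    have hlow := (hdich (i + 1) hi).2 h1
    have e2 : lev i = 2 * lev (i + 1) := by simp only [hlev, pow_succ]; ring
    have hκ1 : B * (1 / 2) ^ I ≤ lev (i + 1) := by
      have h3 : ((1 : ℝ) / 2) ^ I ≤ (1 / 2) ^ (i + 1) :=
        pow_le_pow_of_le_one (by norm_num) (by norm_num) hi
      simp only [hlev]
      calc B * (1 / 2) ^ I = 1 * B * (1 / 2) ^ I := by ring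
        _ ≤ M * B * (1 / 2) ^ (i + 1) := by gcongr
    have hκ2 : lev (i + 1) ≤ M * B := by
      simp only [hlev]
      exact mul_le_of_le_one_right (by positivity) (pow_le_one₀ (by norm_num) (by norm_num))
    rcases sign_const_of_le_abs isPreconnected_Icc hcont (hlevpos (i + 1)) hlow with h | h
    · exact ⟨1, lev (i + 1), ⟨Or.inl rfl, hlevpos _, fun x hx => by simpa using h x hx,
        fun x hx => by
          have : |G x| ≤ lev i := hup x hx
          have := le_abs_self (G x)
          linarith⟩, hκ1, hκ2⟩
    · exact ⟨-1, lev (i + 1), ⟨Or.inr rfl, hlevpos _, fun x hx => by simpa using h x hx,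
        fun x hx => by
          have : |G x| ≤ lev i := hup x hx
          have := neg_le_abs (G x)
          linarith⟩, hκ1, hκ2⟩

/-- Splitting a sum at finitely many break points. -/
lemma norm_sum_Ioc_le_of_breakpoints (w : ℕ → ℂ) (Z : Finset ℝ) {P₀ R₀ : ℕ} {K : ℝ} (hK : 0 ≤ K)
    (h : ∀ P R, P₀ ≤ P → R ≤ R₀ → (∀ z ∈ Z, ¬ ((P + 1 : ℝ) < z ∧ z < R)) →
      ‖∑ n ∈ Ioc P R, w n‖ ≤ K) :
    ∀ N P, P₀ ≤ P → #{z ∈ Z | (P + 1 : ℝ) < z ∧ z < R₀} ≤ N →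
      ‖∑ n ∈ Ioc P R₀, w n‖ ≤ (N + 1) * K := by
  intro N
  induction N with
  | zero =>
    intro P hP hcard
    rw [Nat.le_zero, card_eq_zero, filter_eq_empty_iff] at hcard
    simpa using h P R₀ hP le_rfl fun z hz => hcard hz
  | succ N ih =>
    intro P hP hcard
    rcases ({z ∈ Z | (P + 1 : ℝ) < z ∧ z < R₀}).eq_empty_or_nonempty with hemp | hne
    · rw [filter_eq_empty_iff] at hemp
      refine (h P R₀ hP le_rfl fun z hz => hemp hz).trans ?_
      push_cast
      nlinarith
    · have hmem := min'_mem _ hne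
      set z := ({z ∈ Z | (P + 1 : ℝ) < z ∧ z < R₀}).min' hne with hz
      obtain ⟨hzZ, hz1, hz2⟩ := mem_filter.1 hmem
      have hz0 : 0 ≤ z := by
        have : (0 : ℝ) ≤ P := by positivity
        linarith
      have hPz : P + 1 ≤ ⌊z⌋₊ := Nat.le_floor (by push_cast; exact hz1.le)
      have hfl := Nat.floor_le hz0
      have hzR : ⌊z⌋₊ ≤ R₀ := by
        have : (⌊z⌋₊ : ℝ) < R₀ := hfl.trans_lt hz2
        exact_mod_cast this.le
      -- The cut is at the integer part of the least break point z: none lies strictly between P + 1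
      -- and ⌊z⌋, and z < ⌊z⌋ + 1 is no longer counted in the second piece.
      rw [← sum_Ioc_consecutive w (by omega : P ≤ ⌊z⌋₊) hzR]
      refine (norm_add_le _ _).trans ?_
      have h1 : ‖∑ n ∈ Ioc P ⌊z⌋₊, w n‖ ≤ K := by
        refine h P _ hP hzR fun y hy hcon => ?_
        have hy' : y ∈ {z ∈ Z | (P + 1 : ℝ) < z ∧ z < R₀} :=
          mem_filter.2 ⟨hy, hcon.1, (hcon.2.trans_le hfl).trans hz2⟩
        have := min'_le _ _ hy'
        rw [← hz] at this
        linarith [hcon.2]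
      have h2 : ‖∑ n ∈ Ioc ⌊z⌋₊ R₀, w n‖ ≤ (N + 1) * K := by
        refine ih _ (by omega) ?_
        have hss : {y ∈ Z | ((⌊z⌋₊ : ℝ) + 1) < y ∧ y < R₀} ⊂ {y ∈ Z | (P + 1 : ℝ) < y ∧ y < R₀} := by
          refine ⟨fun y hy => ?_, fun hcon => ?_⟩
          · obtain ⟨g1, g2, g3⟩ := mem_filter.1 hy
            refine mem_filter.2 ⟨g1, lt_trans ?_ g2, g3⟩
            have : (P : ℝ) < ⌊z⌋₊ := by exact_mod_cast hPz
            linarith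
          · have := (mem_filter.1 (hcon hmem)).2.1
            have := Nat.lt_floor_add_one z
            linarith
        have := card_lt_card hss
        omega
      push_cast
      linarith

/-! ### The phase of the theorem and the choice of exponents -/

/-- The linear term dies at the second derivative, so neither G₁ nor G₂ involves α. -/
lemma isPhase_powers {k : ℕ} (γ h : Fin k → ℝ) (α : ℝ) :
    IsPhase (fun x => α * x + ∑ j, h j * x ^ γ j) (fun x => α + ∑ j, h j * (γ j * x ^ (γ j - 1)))
      (fun x => ∑ j, h j * (γ j * (γ j - 1)) * x ^ γ j)
      (fun x => ∑ j, h j * (γ j ^ 2 * (γ j - 1)) * x ^ γ j) := by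
  refine ⟨fun x hx => ?_, fun x hx => ?_, fun x hx => ?_⟩
  · refine HasDerivAt.add ?_ (HasDerivAt.fun_sum fun j _ => ?_)
    · simpa using (hasDerivAt_id x).const_mul α
    · exact (Real.hasDerivAt_rpow_const (Or.inl hx.ne')).const_mul _
  · have h1 : HasDerivAt (fun x => α + ∑ j, h j * (γ j * x ^ (γ j - 1)))
        (∑ j, h j * (γ j * ((γ j - 1) * x ^ (γ j - 1 - 1)))) x := by
      refine HasDerivAt.const_add α (HasDerivAt.fun_sum fun j _ => ?_)
      exact ((Real.hasDerivAt_rpow_const (Or.inl hx.ne')).const_mul _).const_mul _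
    refine h1.congr_deriv ?_
    rw [sum_div]
    refine sum_congr rfl fun j _ => ?_
    rw [sub_sub, show (1 : ℝ) + 1 = 2 by norm_num, Real.rpow_sub hx, Real.rpow_two]
    ring
  · have h1 : HasDerivAt (fun x => ∑ j, h j * (γ j * (γ j - 1)) * x ^ γ j)
        (∑ j, h j * (γ j * (γ j - 1)) * (γ j * x ^ (γ j - 1))) x := by
      refine HasDerivAt.fun_sum fun j _ => ?_
      exact (Real.hasDerivAt_rpow_const (Or.inl hx.ne')).const_mul _
    refine h1.congr_deriv ?_
    rw [sum_div]
    refine sum_congr rfl fun j _ => ?_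
    rw [Real.rpow_sub hx, Real.rpow_one]
    ring

/-- A combination of powers as an exponential sum in `log (x / X)`. -/
lemma exists_expPoly_eq {k : ℕ} (γ : Fin k → ℝ) (hγ : Function.Injective γ) (c : Fin k → ℝ) {X : ℝ}
    (hX : 0 < X) : ∃ b : ℝ → ℝ,
      (∀ x, 0 < x → ∑ j, c j * x ^ γ j = expPoly (univ.image γ) b (Real.log (x / X))) ∧
      ∑ r ∈ univ.image γ, |b r| = ∑ j, |c j| * X ^ γ j := by
  refine ⟨Function.extend γ (fun j => c j * X ^ γ j) 0, fun x hx => ?_, ?_⟩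
  · rw [expPoly, sum_image hγ.injOn]
    refine sum_congr rfl fun j _ => ?_
    rw [hγ.extend_apply, mul_assoc]
    congr 1
    rw [mul_comm (γ j), ← Real.rpow_def_of_pos (by positivity), Real.div_rpow hx.le hX.le]
    field_simp
  · rw [sum_image hγ.injOn]
    refine sum_congr rfl fun j _ => ?_
    rw [hγ.extend_apply, abs_mul, abs_of_pos (Real.rpow_pos_of_pos hX _)]

lemma HasLevel.congr {G G' : ℝ → ℝ} {P R : ℕ} {s κ : ℝ} (h : HasLevel G P R s κ)
    (hG : ∀ x, 0 < x → G' x = G x) : HasLevel G' P R s κ := by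
  have hpos : ∀ x ∈ Set.Icc (P + 1 : ℝ) R, 0 < x := fun x hx => by
    have : (0 : ℝ) ≤ P := by positivity
    linarith [hx.1]
  exact ⟨h.sign, h.pos, fun x hx => by rw [hG x (hpos x hx)]; exact h.low x hx,
    fun x hx => by rw [hG x (hpos x hx)]; exact h.high x hx⟩

/-- The four terms of the estimate on a level piece, with `V = X ^ (1 - q / 2)`. -/
lemma piece_terms_le {X A c C q w d γ₀ κ₁ κ₂ U Q Y : ℝ} (hX : 1 ≤ X) (hA : 1 ≤ A) (hc : 0 < c)
    (hC : 0 < C) (hκ₁ : c * X ^ (γ₀ - w) ≤ κ₁) (hκ₁' : κ₁ ≤ C * X ^ d)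
    (hκ₂ : c * X ^ (γ₀ - w) ≤ κ₂) (hκ₂' : κ₂ ≤ C * X ^ d) (hU0 : 0 ≤ U)
    (hU : U ≤ X ^ (1 / 3 : ℝ)) (hQ : X ^ q / 4 ≤ Q) (hQ' : Q ≤ X ^ q) (hY0 : 0 ≤ Y)
    (hY : Y ≤ A * X ^ (1 / 2 : ℝ)) (h1 : 3 * q + d ≤ 3 / 2) (h2 : q + w + 1 / 2 ≤ γ₀)
    (h3 : q / 2 + d / 2 + 1 / 3 ≤ 1) :
    √κ₁ * U ≤ √C * X ^ (1 - q / 2) ∧ X / √κ₁ ≤ 1 / √c * X ^ (1 - q / 2) ∧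
    X * (A * X / Q + 48 * A ^ 2 * √(Q * Y * κ₂) + 52 * A * X * √(Y / (Q * κ₂))) ≤
      (4 * A + 48 * A ^ 2 * √(A * C) + 52 * A * √(4 * A / c)) * (X ^ (1 - q / 2)) ^ 2 := by
  have hX0 : 0 < X := by linarith
  have hp : ∀ r : ℝ, 0 < X ^ r := fun r => Real.rpow_pos_of_pos hX0 r
  have hmono : ∀ {r t : ℝ}, r ≤ t → X ^ r ≤ X ^ t := fun h => Real.rpow_le_rpow_of_exponent_le hX h
  have hsqrt : ∀ r : ℝ, √(X ^ r) = X ^ (r / 2) := fun r => by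
    rw [Real.sqrt_eq_rpow, ← Real.rpow_mul hX0.le]; congr 1; ring
  have hκ₁0 : 0 < κ₁ := (mul_pos hc (hp _)).trans_le hκ₁
  have hκ₂0 : 0 < κ₂ := (mul_pos hc (hp _)).trans_le hκ₂
  have hQ0 : 0 < Q := (div_pos (hp q) (by norm_num)).trans_le hQ
  have hA0 : 0 < A := by linarith
  have hV2 : (X ^ (1 - q / 2)) ^ 2 = X * X ^ (1 - q) := by
    rw [← Real.rpow_natCast, ← Real.rpow_mul hX0.le]
    nth_rewrite 2 [← Real.rpow_one X]
    rw [← Real.rpow_add hX0]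
    congr 1
    push_cast
    ring
  refine ⟨?_, ?_, ?_⟩
  · have e1 : √κ₁ ≤ √C * X ^ (d / 2) := by
      rw [← hsqrt, ← Real.sqrt_mul hC.le]
      exact Real.sqrt_le_sqrt hκ₁'
    calc √κ₁ * U ≤ (√C * X ^ (d / 2)) * X ^ (1 / 3 : ℝ) := by gcongr
      _ = √C * X ^ (d / 2 + 1 / 3) := by rw [mul_assoc, ← Real.rpow_add hX0]
      _ ≤ _ := by
        apply mul_le_mul_of_nonneg_left (hmono (by linarith)) (Real.sqrt_nonneg _)
  · have e1 : √c * X ^ (q / 2) ≤ √κ₁ := by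
      rw [← hsqrt, ← Real.sqrt_mul hc.le]
      apply Real.sqrt_le_sqrt
      refine le_trans ?_ hκ₁
      exact mul_le_mul_of_nonneg_left (hmono (by linarith)) hc.le
    have hsc : 0 < √c := Real.sqrt_pos.2 hc
    calc X / √κ₁ ≤ X / (√c * X ^ (q / 2)) := by
          apply div_le_div_of_nonneg_left hX0.le (mul_pos hsc (hp _)) e1
      _ = _ := by
        rw [Real.rpow_sub hX0, Real.rpow_one]
        field_simp
  -- As V² = X · X^{1-q}, each summand in the bracket must be O(X^{1-q}). The first follows from Q ≥
  -- X^q/4, the second needs `h1`, and the third needs `h2`.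
  · rw [hV2]
    have t1 : A * X / Q ≤ 4 * A * X ^ (1 - q) := by
      calc A * X / Q ≤ A * X / (X ^ q / 4) := by
            apply div_le_div_of_nonneg_left (by positivity) (div_pos (hp q) (by norm_num)) hQ
        _ = _ := by
          rw [Real.rpow_sub hX0, Real.rpow_one]
          field_simp
    have t2 : √(Q * Y * κ₂) ≤ √(A * C) * X ^ (1 - q) := by
      have e : 1 - q = (2 - 2 * q) / 2 := by ring
      rw [e, ← hsqrt, ← Real.sqrt_mul (by positivity)]
      apply Real.sqrt_le_sqrt
      calc Q * Y * κ₂ ≤ X ^ q * (A * X ^ (1 / 2 : ℝ)) * (C * X ^ d) := by gcongr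
        _ = A * C * X ^ (q + 1 / 2 + d) := by
          rw [Real.rpow_add hX0, Real.rpow_add hX0]; ring
        _ ≤ _ := by
          apply mul_le_mul_of_nonneg_left (hmono (by linarith)) (by positivity)
    have t3 : X * √(Y / (Q * κ₂)) ≤ √(4 * A / c) * X ^ (1 - q) := by
      have e : √(Y / (Q * κ₂)) ≤ √(4 * A / c) * X ^ (-q) := by
        have e : -q = (-(2 * q)) / 2 := by ring
        rw [e, ← hsqrt, ← Real.sqrt_mul (by positivity)]
        apply Real.sqrt_le_sqrt
        calc Y / (Q * κ₂) ≤ (A * X ^ (1 / 2 : ℝ)) / (X ^ q / 4 * (c * X ^ (γ₀ - w))) := by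
              have := hp q
              have := hp (γ₀ - w)
              gcongr
          _ = 4 * A / c * X ^ (1 / 2 - q - (γ₀ - w)) := by
            rw [Real.rpow_sub hX0 (1 / 2 - q) (γ₀ - w), Real.rpow_sub hX0 (1 / 2) q]
            have := (hp q).ne'
            have := (hp (γ₀ - w)).ne'
            field_simp
          _ ≤ _ := by
            apply mul_le_mul_of_nonneg_left (hmono (by linarith)) (by positivity)
      calc X * √(Y / (Q * κ₂)) ≤ X * (√(4 * A / c) * X ^ (-q)) := by gcongr
        _ = _ := by
          rw [Real.rpow_sub hX0, Real.rpow_neg hX0.le, Real.rpow_one]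
          ring
    have t1' := mul_le_mul_of_nonneg_left t1 hX0.le
    have t2' : 48 * A ^ 2 * √(Q * Y * κ₂) ≤ 48 * A ^ 2 * (√(A * C) * X ^ (1 - q)) := by gcongr
    have t3' : 52 * A * (X * √(Y / (Q * κ₂))) ≤ 52 * A * (√(4 * A / c) * X ^ (1 - q)) := by gcongr
    calc X * (A * X / Q + 48 * A ^ 2 * √(Q * Y * κ₂) + 52 * A * X * √(Y / (Q * κ₂)))
        = X * (A * X / Q + 48 * A ^ 2 * √(Q * Y * κ₂) + 52 * A * (X * √(Y / (Q * κ₂)))) := by ring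
      _ ≤ X * (4 * A * X ^ (1 - q) + 48 * A ^ 2 * (√(A * C) * X ^ (1 - q)) +
          52 * A * (√(4 * A / c) * X ^ (1 - q))) := by gcongr
      _ = _ := by ring

/-- Choice of the number of dyadic levels. -/
lemma exists_half_pow_between {X w : ℝ} (hX : 1 ≤ X) (hw : 0 ≤ w) :
    ∃ I : ℕ, X ^ (-w) / 2 ≤ (1 / 2 : ℝ) ^ I ∧ (1 / 2 : ℝ) ^ I ≤ X ^ (-w) ∧
      (I + 1 : ℝ) ≤ (2 * w + 2) * (1 + Real.log X) := by
  have hX0 : 0 < X := by linarith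
  have hl : 0 ≤ Real.log X := Real.log_nonneg hX
  have hpw := Real.rpow_pos_of_pos hX0 (-w)
  have hl2 : 0 < Real.log 2 := Real.log_pos (by norm_num)
  have hl2' : (1 / 2 : ℝ) ≤ Real.log 2 := by linarith [Real.log_two_gt_d9]
  set y := w * Real.log X / Real.log 2 with hy
  have hy0 : 0 ≤ y := by positivity
  have hXy : X ^ (-w) = (2 : ℝ) ^ (-y) := by
    rw [Real.rpow_def_of_pos hX0, Real.rpow_def_of_pos (by norm_num), hy]
    congr 1
    field_simp
  refine ⟨⌈y⌉₊, ?_, ?_, ?_⟩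
  · have h1 : (⌈y⌉₊ : ℝ) ≤ y + 1 := (Nat.ceil_lt_add_one hy0).le
    rw [hXy, one_div, inv_pow, ← Real.rpow_natCast, ← Real.rpow_neg (by norm_num)]
    have : (2 : ℝ) ^ (-y) / 2 = 2 ^ (-y - 1) := by
      rw [Real.rpow_sub (by norm_num), Real.rpow_one]
    rw [this]
    exact Real.rpow_le_rpow_of_exponent_le (by norm_num) (by linarith)
  · have h1 := Nat.le_ceil y
    rw [hXy, one_div, inv_pow, ← Real.rpow_natCast, ← Real.rpow_neg (by norm_num)]
    exact Real.rpow_le_rpow_of_exponent_le (by norm_num) (by linarith)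
  · have h1 : (⌈y⌉₊ : ℝ) ≤ y + 1 := (Nat.ceil_lt_add_one hy0).le
    have h2 : y ≤ 2 * w * Real.log X := by
      rw [hy, div_le_iff₀ hl2]
      have : 0 ≤ w * Real.log X := by positivity
      nlinarith
    nlinarith

/-- A common bound for divisor functions and logarithms up to `A X`. -/
lemma exists_divisor_log_bound (A ε : ℝ) (hA : 1 ≤ A) (hε : 0 < ε) :
    ∃ C : ℝ, 1 ≤ C ∧ ∀ X : ℝ, 1 ≤ X → 1 + Real.log X ≤ C * X ^ ε ∧
      ∀ n : ℕ, (n : ℝ) ≤ A * X → (#n.divisors : ℝ) ≤ C * X ^ ε ∧ 1 + Real.log n ≤ C * X ^ ε := by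
  obtain ⟨C₁, hC₁, hdiv⟩ := exists_card_divisors_le ε hε
  have hA' : 1 ≤ A ^ ε := Real.one_le_rpow hA hε.le
  have hpε : 0 < 1 / ε := by positivity
  refine ⟨(C₁ + 1 / ε) * A ^ ε, by nlinarith, fun X hX => ?_⟩
  have hX' : 1 ≤ X ^ ε := Real.one_le_rpow hX hε.le
  have hAX : (A * X) ^ ε = A ^ ε * X ^ ε := Real.mul_rpow (by linarith) (by linarith)
  have hAX1 : 1 ≤ (A * X) ^ ε := by rw [hAX]; nlinarith
  have hlog : ∀ x : ℝ, 0 < x → x ≤ A * X → 1 + Real.log x ≤ (C₁ + 1 / ε) * A ^ ε * X ^ ε := by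
    intro x hx hxA
    have h1 := Real.log_le_rpow_div hx.le hε
    have h2 : x ^ ε ≤ (A * X) ^ ε := Real.rpow_le_rpow hx.le hxA hε.le
    have h3 : x ^ ε / ε ≤ 1 / ε * (A * X) ^ ε := by
      rw [div_eq_mul_one_div, mul_comm]; gcongr
    rw [mul_assoc, ← hAX]
    nlinarith
  refine ⟨hlog X (by linarith) (by nlinarith), fun n hn => ⟨?_, ?_⟩⟩
  · have h2 : (n : ℝ) ^ ε ≤ (A * X) ^ ε := Real.rpow_le_rpow (by positivity) hn hε.le
    rw [mul_assoc, ← hAX]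
    calc (#n.divisors : ℝ) ≤ C₁ * (n : ℝ) ^ ε := hdiv n
      _ ≤ (C₁ + 1 / ε) * (A * X) ^ ε := by gcongr; linarith
  · rcases Nat.eq_zero_or_pos n with rfl | h
    · have := hlog 1 one_pos (by nlinarith)
      simpa using this
    · exact hlog n (by exact_mod_cast h) hn

/-- The conclusions serve, in order, the terms √(QYκ) and √(Y/(Qκ)) of type II, the term √κ U of
type I, and the requirement Q ≲ U. At ε = 0 they become strict inequalities in σ and δ, whose least
slack τ determines ε₀. -/
lemma exponent_conditions {k : ℕ} (hk : 3 ≤ k) {σ δ : ℝ} (hσ : 0 ≤ σ) (hδ : 0 ≤ δ)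
    (hcond : Omega k * σ + OmegaStar k * δ < 1 - varpi k) :
    ∃ ε₀ : ℝ, 0 < ε₀ ∧ ∀ ε η q : ℝ, 0 < ε → ε < ε₀ → η = σ + ((k : ℝ) + 1) * δ + ((k : ℝ) + 2) * ε →
      q = 2 * η + 20 * ε → 3 * q + (1 + δ + ε) ≤ 3 / 2 ∧ q + k * (q / 2) + 1 / 2 ≤ 1 - σ ∧
      q / 2 + (1 + δ + ε) / 2 + 1 / 3 ≤ 1 ∧ q ≤ 1 / 3 := by
  set η' := σ + ((k : ℝ) + 1) * δ with hη'
  have hk3 : (3 : ℝ) ≤ k := by exact_mod_cast hk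
  have key : 6 * η' + δ < 1 / 2 ∧ ((k : ℝ) + 2) * η' + σ < 1 / 2 ∧ η' + δ / 2 < 1 / 6 ∧
      2 * η' < 1 / 3 := by
    rcases eq_or_lt_of_le hk with rfl | hk4
    · norm_num [Omega, OmegaStar, varpi] at hcond
      norm_num at hη'
      rw [hη']
      push_cast
      refine ⟨by linarith, by linarith, by linarith, by linarith⟩
    · have hk4' : (4 : ℝ) ≤ k := by exact_mod_cast hk4
      have hv : 0 ≤ varpi k := by
        unfold varpi
        split_ifs <;> positivity
      -- For k ≥ 4 the hypothesis is 4kη' < 1 - ϖ_k. With σ ≤ η' this gives (k+2)η' + σ ≤ (k+3)η' <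
      -- (k+3)/(4k) ≤ 7/16.
      have h1 : 4 * (k : ℝ) * η' < 1 := by
        rw [OmegaStar, if_neg (by omega), Omega] at hcond
        have : 4 * (k : ℝ) * η' = 4 * (k : ℝ) * σ + 4 * (k : ℝ) * ((k : ℝ) + 1) * δ := by
          rw [hη']; ring
        linarith
      have hη0 : 0 ≤ η' := by positivity
      have h2 : 16 * η' ≤ 4 * (k : ℝ) * η' := by nlinarith
      have h3 : 5 * δ ≤ η' := by
        have : 5 * δ ≤ ((k : ℝ) + 1) * δ := mul_le_mul_of_nonneg_right (by linarith) hδ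
        linarith
      have h4 : σ ≤ η' := by
        have : 0 ≤ ((k : ℝ) + 1) * δ := by positivity
        linarith
      refine ⟨by linarith, by nlinarith, by linarith, by linarith⟩
  obtain ⟨k1, k2, k3, k4⟩ := key
  set τ := min (min (1 / 2 - (6 * η' + δ)) (1 / 2 - (((k : ℝ) + 2) * η' + σ)))
    (min (1 / 6 - (η' + δ / 2)) (1 / 3 - 2 * η')) with hτ
  have hτ0 : 0 < τ := lt_min (lt_min (by linarith) (by linarith)) (lt_min (by linarith) (by linarith))
  have τ1 : τ ≤ 1 / 2 - (6 * η' + δ) := (min_le_left _ _).trans (min_le_left _ _)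
  have τ2 : τ ≤ 1 / 2 - (((k : ℝ) + 2) * η' + σ) := (min_le_left _ _).trans (min_le_right _ _)
  have τ3 : τ ≤ 1 / 6 - (η' + δ / 2) := (min_le_right _ _).trans (min_le_left _ _)
  have τ4 : τ ≤ 1 / 3 - 2 * η' := (min_le_right _ _).trans (min_le_right _ _)
  refine ⟨τ / (100 * ((k : ℝ) + 2) ^ 2), by positivity, fun ε η q hε hεt hη hq => ?_⟩
  rw [lt_div_iff₀ (by positivity)] at hεt
  have hη2 : η = η' + ((k : ℝ) + 2) * ε := by rw [hη]
  have h5 : 5 * (((k : ℝ) + 2) * ε) ≤ ((k : ℝ) + 2) ^ 2 * ε := by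
    have : 0 ≤ ((k : ℝ) + 2) * ε := by positivity
    nlinarith
  have h6 : 5 * ε ≤ ((k : ℝ) + 2) * ε := mul_le_mul_of_nonneg_right (by linarith) hε.le
  have hE : ε * (100 * ((k : ℝ) + 2) ^ 2) = 100 * (((k : ℝ) + 2) ^ 2 * ε) := by ring
  rw [hE] at hεt
  have e2 : q + k * (q / 2) = ((k : ℝ) + 2) * η' + ((k : ℝ) + 2) ^ 2 * ε +
      10 * (((k : ℝ) + 2) * ε) := by
    rw [hq, hη2]; ring
  refine ⟨?_, ?_, ?_, ?_⟩
  · rw [hq, hη2]; linarith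
  · rw [e2]; linarith
  · rw [hq, hη2]; linarith
  · rw [hq, hη2]; linarith

/-- σ is the sum of the positive numbers 1 - γ_i. The consequence γ_j ≥ 1 - σ bounds the coefficient
sums from below. -/
lemma one_sub_le_sigmaDef {k : ℕ} (γ : Fin k → ℝ) (hγ : ∀ j, γ j < 1) (j : Fin k) :
    1 - γ j ≤ sigmaDef k γ := by
  have h : sigmaDef k γ = ∑ j, (1 - γ j) := by
    rw [sum_sub_distrib]
    simp [sigmaDef]
  rw [h]
  exact single_le_sum (f := fun j => 1 - γ j) (fun i _ => by linarith [hγ i]) (mem_univ j)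

/-- Bounds for the total size of the coefficients of the phase. -/
lemma coeff_sum_bounds {k : ℕ} (γ h u : Fin k → ℝ) {X d : ℝ} (hX : 1 ≤ X) (j₀ : Fin k)
    (hu : ∀ j, |u j| ≤ 1) (hh : ∀ j, 1 ≤ |h j| ∧ |h j| ≤ X ^ (d - γ j)) {σ : ℝ}
    (hγ : 1 - σ ≤ γ j₀) :
    |u j₀| * X ^ (1 - σ) ≤ ∑ j, |h j * u j| * X ^ γ j ∧
      ∑ j, |h j * u j| * X ^ γ j ≤ k * X ^ d := by
  have hX0 : 0 < X := by linarith
  constructor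
  · have h1 := single_le_sum (f := fun j => |h j * u j| * X ^ γ j)
      (fun j _ => mul_nonneg (abs_nonneg _) (Real.rpow_nonneg hX0.le _)) (mem_univ j₀)
    refine le_trans ?_ h1
    rw [abs_mul]
    have h2 : X ^ (1 - σ) ≤ X ^ γ j₀ := Real.rpow_le_rpow_of_exponent_le hX hγ
    have h3 := (hh j₀).1
    have h4 : 1 * |u j₀| ≤ |h j₀| * |u j₀| := mul_le_mul_of_nonneg_right h3 (abs_nonneg _)
    rw [one_mul] at h4
    exact mul_le_mul h4 h2 (Real.rpow_nonneg hX0.le _) (by positivity)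
  · calc ∑ j, |h j * u j| * X ^ γ j ≤ ∑ j : Fin k, X ^ d := by
          refine sum_le_sum fun j _ => ?_
          rw [abs_mul]
          calc |h j| * |u j| * X ^ γ j ≤ X ^ (d - γ j) * 1 * X ^ γ j := by
                have := (hh j).2
                have := hu j
                gcongr
            _ = X ^ d := by rw [mul_one, ← Real.rpow_add hX0, sub_add_cancel]
      _ = _ := by simp

/-! ### Estimates on single pieces and assembly -/

set_option maxHeartbeats 800000 in
/-- The estimate on a level piece with all parameters chosen. -/
lemma norm_level_piece_le {f f₁ G₁ G₂ : ℝ → ℝ} (hf : IsPhase f f₁ G₁ G₂) {P R : ℕ} {A X : ℝ}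
    (hA : 1 ≤ A) (hX : 1 ≤ X) (hP₀ : ⌊X⌋₊ ≤ P) (hR : R ≤ A * X)
    {s₁ κ₁ s₂ κ₂ : ℝ} (hG₁ : HasLevel G₁ P R s₁ κ₁) (hG₂ : HasLevel G₂ P R s₂ κ₂)
    {D : ℝ} (hD : 1 ≤ D)
    (hdl : ∀ n : ℕ, (n : ℝ) ≤ A * X → (#n.divisors : ℝ) ≤ D ∧ 1 + Real.log n ≤ D)
    {c C q w d γ₀ : ℝ} (hc : 0 < c) (hC : 0 < C) (hκ₁ : c * X ^ (γ₀ - w) ≤ κ₁)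
    (hκ₁' : κ₁ ≤ C * X ^ d) (hκ₂ : c * X ^ (γ₀ - w) ≤ κ₂) (hκ₂' : κ₂ ≤ C * X ^ d) (hq : 0 ≤ q)
    (h1 : 3 * q + d ≤ 3 / 2) (h2 : q + w + 1 / 2 ≤ γ₀) (h3 : q / 2 + d / 2 + 1 / 3 ≤ 1)
    (h4 : q ≤ 1 / 3) :
    ‖twistedSum P R (fun n => expChar (f n)) ArithmeticFunction.vonMangoldt‖ ≤
      (24 * A ^ 2 * √C + 26 * A * (1 / √c) + 8 * √(3 * A *
        (4 * A + 48 * A ^ 2 * √(A * C) + 52 * A * √(4 * A / c)))) * (D ^ 3 * X ^ (1 - q / 2)) := by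
  have hX0 : 0 < X := by linarith
  set U := ⌊X ^ (1 / 3 : ℝ)⌋₊ with hU
  -- The halving gives 2⌊X^q/2⌋ ≤ X^q ≤ X^{1/3} < U + 1. The maximum keeps Q positive when X^q < 2,
  -- and in all cases X^q/4 ≤ Q ≤ X^q.
  set Q := max 1 ⌊X ^ q / 2⌋₊ with hQ
  have hXq : 1 ≤ X ^ q := Real.one_le_rpow hX hq
  have hX3 : 1 ≤ X ^ (1 / 3 : ℝ) := Real.one_le_rpow hX (by norm_num)
  have hU1 : 1 ≤ U := Nat.le_floor (by simpa using hX3)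
  have hUle : (U : ℝ) ≤ X ^ (1 / 3 : ℝ) := Nat.floor_le (by linarith)
  have hUX : U ^ 3 ≤ ⌊X⌋₊ := by
    apply Nat.le_floor
    push_cast
    calc (U : ℝ) ^ 3 ≤ (X ^ (1 / 3 : ℝ)) ^ 3 := pow_le_pow_left₀ (by positivity) hUle 3
      _ = X := by rw [← Real.rpow_natCast, ← Real.rpow_mul hX0.le]; norm_num
  have hQ0 : 0 < Q := by simp [hQ]
  have hfl : (⌊X ^ q / 2⌋₊ : ℝ) ≤ X ^ q / 2 := Nat.floor_le (by linarith)
  have hfl' := Nat.lt_floor_add_one (X ^ q / 2)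
  have hQcast : (Q : ℝ) = max 1 (⌊X ^ q / 2⌋₊ : ℝ) := by rw [hQ]; push_cast; rfl
  have hQle : (Q : ℝ) ≤ X ^ q := by
    rw [hQcast]; exact max_le hXq (by linarith)
  have hQge : X ^ q / 4 ≤ (Q : ℝ) := by
    have g1 : (1 : ℝ) ≤ Q := by exact_mod_cast hQ0
    have g2 : (⌊X ^ q / 2⌋₊ : ℝ) ≤ Q := by rw [hQcast]; exact le_max_right _ _
    linarith
  have hQU : 2 * Q ≤ U + 1 := by
    rcases le_total ⌊X ^ q / 2⌋₊ 1 with g | g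
    · rw [hQ, max_eq_left g]; omega
    · rw [hQ, max_eq_right g]
      have g1 : X ^ q ≤ X ^ (1 / 3 : ℝ) := Real.rpow_le_rpow_of_exponent_le hX h4
      have g2 := Nat.lt_floor_add_one (X ^ (1 / 3 : ℝ))
      have g3 : (2 * ⌊X ^ q / 2⌋₊ : ℝ) < U + 1 := by linarith
      exact_mod_cast g3.le
  have hP : X ≤ P + 1 := by
    have g1 := (Nat.lt_floor_add_one X).le
    have : (⌊X⌋₊ : ℝ) ≤ P := by exact_mod_cast hP₀
    linarith
  have hUA : (U : ℝ) ≤ A * X := by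
    calc (U : ℝ) ≤ X ^ (1 / 3 : ℝ) := hUle
      _ ≤ X ^ (1 : ℝ) := Real.rpow_le_rpow_of_exponent_le hX (by norm_num)
      _ ≤ A * X := by rw [Real.rpow_one]; exact le_mul_of_one_le_left hX0.le hA
  have hY : (R.sqrt : ℝ) ≤ A * X ^ (1 / 2 : ℝ) := by
    have g1 : ((R.sqrt : ℕ) : ℝ) ^ 2 ≤ R := by exact_mod_cast Nat.sqrt_le' R
    have g2 : ((R.sqrt : ℕ) : ℝ) ^ 2 ≤ (A * X ^ (1 / 2 : ℝ)) ^ 2 := by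
      rw [mul_pow, ← Real.rpow_natCast (X ^ (1 / 2 : ℝ)), ← Real.rpow_mul hX0.le]
      norm_num
      have g3 : A * X ≤ A ^ 2 * X := by
        rw [sq, mul_assoc]
        exact le_mul_of_one_le_left (by positivity) hA
      linarith only [g1, g3, hR]
    exact le_of_sq_le_sq g2 (by positivity)
  have main := norm_vonMangoldt_sum_le hf hA hX hP hR hG₁ hG₂ hQ0 hQU (hUX.trans hP₀) hD
    (fun n _ hnR => by
      have := (hdl n ((Nat.cast_le.2 hnR).trans hR)).2
      linarith)
    (fun n hnR => (hdl n ((Nat.cast_le.2 hnR).trans hR)).1)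
  obtain ⟨b1, b2, b3⟩ := piece_terms_le hX hA hc hC hκ₁ hκ₁' hκ₂ hκ₂' (Nat.cast_nonneg U) hUle hQge
    hQle (Nat.cast_nonneg R.sqrt) hY h1 h2 h3
  set K₁ := 4 * A + 48 * A ^ 2 * √(A * C) + 52 * A * √(4 * A / c) with hK₁
  set V := X ^ (1 - q / 2) with hV
  have hV0 : 0 < V := Real.rpow_pos_of_pos hX0 _
  have hA0 : 0 < A := by linarith
  have hD0 : 0 < D := by linarith
  have hK₁0 : 0 < K₁ := by positivity
  have hsc : 0 < √c := Real.sqrt_pos.2 hc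
  have hlogU : 1 + Real.log U ≤ D := (hdl U hUA).2
  have hlogU0 : 0 ≤ Real.log U := Real.log_natCast_nonneg U
  have hlog2 : (Nat.log 2 R + 1 : ℝ) ≤ 2 * D := by
    have g1 : ((Nat.log 2 R : ℕ) : ℝ) ≤ Real.logb 2 R := by
      exact_mod_cast Real.natLog_le_logb R 2
    have g2 : Real.logb 2 R ≤ 2 * Real.log R := by
      have hl2 : 0 < Real.log 2 := Real.log_pos (by norm_num)
      rw [Real.logb, div_le_iff₀ hl2]
      have g3 := Real.log_natCast_nonneg R
      have g4 : (1 / 2 : ℝ) ≤ Real.log 2 := by linarith only [Real.log_two_gt_d9]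
      calc Real.log R = 2 * Real.log R * (1 / 2) := by ring
        _ ≤ 2 * Real.log R * Real.log 2 := mul_le_mul_of_nonneg_left g4 (by positivity)
    have := (hdl R hR).2
    linarith only [this, g1, g2, hD]
  have s1 : 2 * (D * (12 * A ^ 2 * √κ₁ * U + 13 * A * X / √κ₁ * (1 + Real.log U))) ≤
      (24 * A ^ 2 * √C + 26 * A * (1 / √c)) * (D ^ 3 * V) := by
    have e1 : 12 * A ^ 2 * √κ₁ * U ≤ 12 * A ^ 2 * (√C * V) * D ^ 2 := by
      rw [mul_assoc (12 * A ^ 2)]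
      have : (1 : ℝ) ≤ D ^ 2 := one_le_pow₀ hD
      calc 12 * A ^ 2 * (√κ₁ * U) ≤ 12 * A ^ 2 * (√C * V) := by gcongr
        _ ≤ _ := le_mul_of_one_le_right (by positivity) this
    have e2 : 13 * A * X / √κ₁ * (1 + Real.log U) ≤ 13 * A * (1 / √c * V) * D ^ 2 := by
      rw [mul_div_assoc]
      have : D ≤ D ^ 2 := by nlinarith
      have g : 1 + Real.log U ≤ D ^ 2 := hlogU.trans this
      gcongr
    calc _ ≤ 2 * (D * (12 * A ^ 2 * (√C * V) * D ^ 2 + 13 * A * (1 / √c * V) * D ^ 2)) := by gcongr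
      _ = _ := by ring
  have s2 : √(3 * A * D ^ 4 * X * (A * X / Q + 48 * A ^ 2 * √(Q * R.sqrt * κ₂) +
      52 * A * X * √(R.sqrt / (Q * κ₂)))) ≤ √(3 * A * K₁) * (D ^ 2 * V) := by
    have e : √(3 * A * K₁) * (D ^ 2 * V) = √(3 * A * K₁ * (D ^ 2 * V) ^ 2) := by
      rw [Real.sqrt_mul (by positivity : 0 ≤ 3 * A * K₁) ((D ^ 2 * V) ^ 2),
        Real.sqrt_sq (by positivity)]
    rw [e]
    apply Real.sqrt_le_sqrt
    calc _ = 3 * A * D ^ 4 * (X * (A * X / Q + 48 * A ^ 2 * √(Q * R.sqrt * κ₂) +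
            52 * A * X * √(R.sqrt / (Q * κ₂)))) := by ring
      _ ≤ 3 * A * D ^ 4 * (K₁ * V ^ 2) := by gcongr
      _ = _ := by ring
  -- Of the factor D³, two powers come from the square root of D⁴ and one from the number of dyadic
  -- blocks.
  have s3 : 4 * ((Nat.log 2 R + 1) * √(3 * A * D ^ 4 * X * (A * X / Q + 48 * A ^ 2 *
      √(Q * R.sqrt * κ₂) + 52 * A * X * √(R.sqrt / (Q * κ₂))))) ≤
      8 * √(3 * A * K₁) * (D ^ 3 * V) := by
    calc _ ≤ 4 * ((2 * D) * (√(3 * A * K₁) * (D ^ 2 * V))) := by gcongr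
      _ = _ := by ring
  calc _ ≤ _ := main
    _ ≤ (24 * A ^ 2 * √C + 26 * A * (1 / √c)) * (D ^ 3 * V) + 8 * √(3 * A * K₁) * (D ^ 3 * V) :=
        add_le_add s1 s3
    _ = _ := by ring

/-- The trivial estimate on a short piece. -/
lemma norm_short_piece_le {f : ℝ → ℝ} {P R n : ℕ} {A X : ℝ} (hX : 1 ≤ X)
    (hR : R ≤ A * X) {D : ℝ} (hD : 1 ≤ D) (hlog : ∀ n : ℕ, (n : ℝ) ≤ A * X → 1 + Real.log n ≤ D)
    {c q : ℝ} (hc : 0 < c) (hc1 : c ≤ 1) (hn : n ≠ 0) (hq : q ≤ 2) (hPR : (P + 1 : ℝ) ≤ R)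
    (h : c * (R - (P + 1) : ℝ) ^ n ≤ (X ^ (1 - q / 2)) ^ n) :
    ‖twistedSum P R (fun n => expChar (f n)) ArithmeticFunction.vonMangoldt‖ ≤
      (1 / c + 1) * (D ^ 3 * X ^ (1 - q / 2)) := by
  have hX0 : 0 < X := by linarith
  set V := X ^ (1 - q / 2) with hV
  have hV1 : 1 ≤ V := Real.one_le_rpow hX (by linarith)
  have ht : 0 ≤ (R - (P + 1) : ℝ) := by linarith
  -- As c ≤ 1, c^n ≤ c, so an n-th root can be taken with c left outside the power.
  have h1 : c * (R - (P + 1) : ℝ) ≤ V := by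
    apply le_of_pow_le_pow_left₀ hn (by linarith)
    rw [mul_pow]
    refine le_trans ?_ h
    have : c ^ n ≤ c := pow_le_of_le_one hc.le hc1 hn
    gcongr
  have h2 : (R - (P + 1) : ℝ) ≤ 1 / c * V := by
    rw [one_div_mul_eq_div, le_div_iff₀ hc]
    linarith
  have hcard : ((R - P : ℕ) : ℝ) ≤ (1 / c + 1) * V := by
    have hPR' : P ≤ R := by
      have : (P : ℝ) ≤ R := by linarith
      exact_mod_cast this
    rw [Nat.cast_sub hPR']
    linarith
  unfold twistedSum
  refine (norm_sum_le _ _).trans ?_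
  have hterm : ∀ n ∈ Ioc P R,
      ‖((ArithmeticFunction.vonMangoldt n : ℝ) : ℂ) * expChar (f n)‖ ≤ D := by
    intro n hn
    rw [norm_mul, norm_expChar, mul_one, Complex.norm_real, Real.norm_eq_abs,
      abs_of_nonneg ArithmeticFunction.vonMangoldt_nonneg]
    have := hlog n ((Nat.cast_le.2 (mem_Ioc.1 hn).2).trans hR)
    exact ArithmeticFunction.vonMangoldt_le_log.trans (by linarith)
  refine (sum_le_sum hterm).trans ?_
  rw [sum_const, Nat.card_Ioc, nsmul_eq_mul]
  have hD3 : D ≤ D ^ 3 := le_self_pow₀ hD (by norm_num)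
  calc _ ≤ ((1 / c + 1) * V) * D ^ 3 := by gcongr
    _ = _ := by ring

set_option maxHeartbeats 800000 in
theorem lemma3p4 (k : ℕ) (hk : 3 ≤ k) (γ : Fin k → ℝ)
    (hγ_anti : StrictAnti γ) (hγ_low : ∀ j, 1 / 2 < γ j) (hγ_up : ∀ j, γ j < 1)
    (δ : ℝ) (hδ_nonneg : 0 ≤ δ) (hδ_lt : δ < 1 / 2)
    (hcond : Omega k * sigmaDef k γ + OmegaStar k * δ < 1 - varpi k) :
    ∃ ε₀ : ℝ, 0 < ε₀ ∧ ∀ ε : ℝ, 0 < ε → ε < ε₀ → ∀ A : ℝ, 1 ≤ A →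
      ∃ C : ℝ, 0 < C ∧ ∀ (X X₁ α : ℝ) (h : Fin k → ℤ),
        1 ≤ X → X < X₁ → X₁ ≤ A * X →
        (∀ j, 1 ≤ |(h j : ℝ)| ∧ |(h j : ℝ)| ≤ X ^ (1 - γ j + δ + ε)) →
        ‖mangoldtExpSum k γ h α X X₁‖ ≤
          C * X ^ (1 - sigmaDef k γ - ((k : ℝ) + 1) * δ - ((k : ℝ) + 2) * ε) := by
  set σ := sigmaDef k γ with hσ
  set j₀ : Fin k := ⟨0, by omega⟩ with hj₀
  have hσ1 := one_sub_le_sigmaDef γ hγ_up j₀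
  have hσ0 : 0 ≤ σ := by linarith [hγ_up j₀]
  obtain ⟨ε₀, hε₀, hexp⟩ := exponent_conditions hk hσ0 hδ_nonneg hcond
  refine ⟨ε₀, hε₀, fun ε hε hεε A hA => ?_⟩
  set η := σ + ((k : ℝ) + 1) * δ + ((k : ℝ) + 2) * ε with hη
  -- Each piece contributes X^{1-q/2} = X^{1-η-10ε} before ε-losses. The slack absorbs four factors
  -- X^ε: three from D³ and one from the number of pieces.
  set q := 2 * η + 20 * ε with hq
  obtain ⟨E1, E2, E3, E4⟩ := hexp ε η q hε hεε rfl rfl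
  have hη0 : 0 ≤ η := by positivity
  have hq0 : 0 ≤ q := by positivity
  -- With 2^{-I} ≈ X^{-w}, short pieces have length O(X^{1-w/k}) = O(X^{1-q/2}), matching the bound
  -- on level pieces.
  set w := (k : ℝ) * (q / 2) with hw
  have hw0 : 0 ≤ w := by positivity
  set d := 1 + δ + ε with hd
  set S : Finset ℝ := univ.image γ with hS
  have hSk : #S = k := by
    rw [hS, card_image_of_injective _ hγ_anti.injective]; simp
  have hS0 : (0 : ℝ) ∉ S := by
    rw [hS]
    intro hmem
    obtain ⟨j, -, hj⟩ := mem_image.1 hmem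
    linarith [hγ_low j]
  obtain ⟨c₁, hc₁, M, hM, hbreak⟩ := exists_breakpoints S hS0 hA
  obtain ⟨CD, hCD, hDbound⟩ := exists_divisor_log_bound A ε hA hε
  set u₁ : Fin k → ℝ := fun j => γ j * (γ j - 1) with hu₁
  set u₂ : Fin k → ℝ := fun j => γ j ^ 2 * (γ j - 1) with hu₂
  have hu₁1 : ∀ j, |u₁ j| ≤ 1 := fun j => by
    have := hγ_low j; have := hγ_up j
    rw [abs_le]; constructor <;> simp only [hu₁] <;> nlinarith
  have hu₂1 : ∀ j, |u₂ j| ≤ 1 := fun j => by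
    have g1 := hγ_low j
    have g2 := hγ_up j
    have : u₂ j = γ j * u₁ j := by simp only [hu₁, hu₂]; ring
    rw [this, abs_mul, abs_of_pos (by linarith)]
    exact mul_le_one₀ g2.le (abs_nonneg _) (hu₁1 j)
  set m₀ := min |u₁ j₀| |u₂ j₀| with hm₀
  have hm₀0 : 0 < m₀ := by
    have g1 := hγ_low j₀
    have g2 := hγ_up j₀
    have g3 : γ j₀ ≠ 0 := by linarith
    have g4 : γ j₀ - 1 ≠ 0 := by linarith
    exact lt_min (abs_pos.2 (mul_ne_zero g3 g4)) (abs_pos.2 (mul_ne_zero (pow_ne_zero 2 g3) g4))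
  set c := m₀ / 2 with hc
  have hc0 : 0 < c := by positivity
  set C := M * k with hC
  have hk0 : (0 : ℝ) < k := by exact_mod_cast (by omega : 0 < k)
  have hC0 : 0 < C := by positivity
  set c' := min c₁ 1 with hc'
  have hc'0 : 0 < c' := lt_min hc₁ one_pos
  set K₂ := 24 * A ^ 2 * √C + 26 * A * (1 / √c) + 8 * √(3 * A *
        (4 * A + 48 * A ^ 2 * √(A * C) + 52 * A * √(4 * A / c))) with hK₂
  have hK₂0 : 0 ≤ K₂ := by positivity
  set K₃ := K₂ + (1 / c' + 1) with hK₃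
  have hK₃0 : 0 < K₃ := by positivity
  refine ⟨((2 * (2 * (k + 1)) * (2 * w + 2)) + 1) * CD ^ 4 * K₃, by positivity,
    fun X X₁ α h hX hXX₁ hX₁ hh => ?_⟩
  have hX0 : 0 < X := by linarith
  obtain ⟨hlogX, hdl⟩ := hDbound X hX
  set D := CD * X ^ ε with hD
  have hXε : 1 ≤ X ^ ε := Real.one_le_rpow hX hε.le
  have hD1 : 1 ≤ D := one_le_mul_of_one_le_of_one_le hCD hXε
  obtain ⟨I, hI1, hI2, hI3⟩ := exists_half_pow_between hX hw0
  set V := X ^ (1 - q / 2) with hV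
  have hV0 : 0 < V := Real.rpow_pos_of_pos hX0 _
  set R₀ := ⌊X₁⌋₊ with hR₀
  have hR₀A : (R₀ : ℝ) ≤ A * X := (Nat.floor_le (by linarith)).trans hX₁
  set hr : Fin k → ℝ := fun j => (h j : ℝ) with hhr
  have hhd : ∀ j, 1 ≤ |hr j| ∧ |hr j| ≤ X ^ (d - γ j) := fun j => by
    have := hh j
    refine ⟨this.1, this.2.trans (le_of_eq ?_)⟩
    congr 1
    rw [hd]; ring
  have hγ0 : 1 - σ ≤ γ j₀ := by linarith
  obtain ⟨b₁, hb₁, hb₁s⟩ := exists_expPoly_eq γ hγ_anti.injective (fun j => hr j * u₁ j) hX0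
  obtain ⟨b₂, hb₂, hb₂s⟩ := exists_expPoly_eq γ hγ_anti.injective (fun j => hr j * u₂ j) hX0
  obtain ⟨B₁l, B₁u⟩ := coeff_sum_bounds γ hr u₁ hX j₀ hu₁1 hhd hγ0
  obtain ⟨B₂l, B₂u⟩ := coeff_sum_bounds γ hr u₂ hX j₀ hu₂1 hhd hγ0
  rw [← hb₁s, ← hS] at B₁l B₁u
  rw [← hb₂s, ← hS] at B₂l B₂u
  have hXσ : 0 < X ^ (1 - σ) := Real.rpow_pos_of_pos hX0 _
  have hB₁l : m₀ * X ^ (1 - σ) ≤ ∑ r ∈ S, |b₁ r| :=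
    (mul_le_mul_of_nonneg_right (min_le_left _ _) hXσ.le).trans B₁l
  have hB₂l : m₀ * X ^ (1 - σ) ≤ ∑ r ∈ S, |b₂ r| :=
    (mul_le_mul_of_nonneg_right (min_le_right _ _) hXσ.le).trans B₂l
  have hB0 : 0 < m₀ * X ^ (1 - σ) := by positivity
  obtain ⟨Z₁, hZ₁, hbr₁⟩ := hbreak X hX b₁ (hB0.trans_le hB₁l) I
  obtain ⟨Z₂, hZ₂, hbr₂⟩ := hbreak X hX b₂ (hB0.trans_le hB₂l) I
  set f : ℝ → ℝ := fun x => α * x + ∑ j, hr j * x ^ γ j with hf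
  have hphase := isPhase_powers γ hr α
  have hlow : ∀ {B κ : ℝ}, m₀ * X ^ (1 - σ) ≤ B → B * (1 / 2) ^ I ≤ κ →
      c * X ^ (1 - σ - w) ≤ κ := by
    intro B κ h1 h2
    refine le_trans ?_ h2
    calc c * X ^ (1 - σ - w) = m₀ * X ^ (1 - σ) * (X ^ (-w) / 2) := by
          rw [sub_eq_add_neg (1 - σ) w, Real.rpow_add hX0, hc]; ring
      _ ≤ B * (1 / 2) ^ I := by
          have := Real.rpow_pos_of_pos hX0 (-w)
          exact mul_le_mul h1 hI1 (by positivity) (hB0.le.trans h1)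
  have hhigh : ∀ {B κ : ℝ}, B ≤ k * X ^ d → κ ≤ M * B → κ ≤ C * X ^ d := by
    intro B κ h1 h2
    refine h2.trans ?_
    rw [hC, mul_assoc]
    exact mul_le_mul_of_nonneg_left h1 (by linarith)
  have hshort : ∀ {P R : ℕ}, (P + 1 : ℝ) ≤ R →
      c₁ * (R - (P + 1) : ℝ) ^ #S ≤ X ^ #S * (1 / 2) ^ I →
      c' * (R - (P + 1) : ℝ) ^ k ≤ V ^ k := by
    intro P R hPR h1
    rw [hSk] at h1
    have ht : (0 : ℝ) ≤ R - (P + 1) := by linarith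
    calc c' * (R - (P + 1) : ℝ) ^ k ≤ c₁ * (R - (P + 1) : ℝ) ^ k := by
          have : c' ≤ c₁ := min_le_left _ _
          gcongr
      _ ≤ X ^ k * (1 / 2) ^ I := h1
      _ ≤ X ^ k * X ^ (-w) := by gcongr
      _ = V ^ k := by
          rw [hV, ← Real.rpow_natCast, ← Real.rpow_natCast, ← Real.rpow_mul hX0.le,
            ← Real.rpow_add hX0]
          congr 1
          rw [hw]; ring
  -- If G₁ or G₂ has no level the piece is short and the trivial bound applies; otherwise both
  -- levels feed Vaughan's identity.
  have hpiece : ∀ P R : ℕ, ⌊X⌋₊ ≤ P → R ≤ R₀ →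
      (∀ z ∈ Z₁ ∪ Z₂, ¬ ((P + 1 : ℝ) < z ∧ z < R)) →
      ‖∑ n ∈ Ioc P R, ((ArithmeticFunction.vonMangoldt n : ℝ) : ℂ) * expChar (f n)‖ ≤
        K₃ * (D ^ 3 * V) := by
    intro P R hP hR hfree
    have hRA : (R : ℝ) ≤ A * X := (Nat.cast_le.2 hR).trans hR₀A
    have hXP : X ≤ P + 1 := by
      have g1 := (Nat.lt_floor_add_one X).le
      have : (⌊X⌋₊ : ℝ) ≤ P := by exact_mod_cast hP
      linarith
    have hK2le : K₂ * (D ^ 3 * V) ≤ K₃ * (D ^ 3 * V) := by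
      apply mul_le_mul_of_nonneg_right _ (by positivity)
      have : 0 < 1 / c' + 1 := by positivity
      linarith
    have hK3le : (1 / c' + 1) * (D ^ 3 * V) ≤ K₃ * (D ^ 3 * V) := by
      apply mul_le_mul_of_nonneg_right _ (by positivity)
      linarith
    have hbad : (P + 1 : ℝ) ≤ R ∧ c₁ * (R - (P + 1) : ℝ) ^ #S ≤ X ^ #S * (1 / 2) ^ I →
        ‖∑ n ∈ Ioc P R, ((ArithmeticFunction.vonMangoldt n : ℝ) : ℂ) * expChar (f n)‖ ≤
        K₃ * (D ^ 3 * V) := by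
      rintro ⟨h1, h2⟩
      exact (norm_short_piece_le (f := f) hX hRA hD1 (fun n hn => (hdl n hn).2) hc'0
        (min_le_right _ _) (by omega : k ≠ 0) (by linarith) h1 (hshort h1 h2)).trans hK3le
    rcases hbr₁ P R hXP hRA (fun z hz => hfree z (mem_union_left _ hz)) with
      ⟨s₁, κ₁, hG₁, l₁, t₁⟩ | hb
    swap
    · exact hbad hb
    rcases hbr₂ P R hXP hRA (fun z hz => hfree z (mem_union_right _ hz)) with
      ⟨s₂, κ₂, hG₂, l₂, t₂⟩ | hb
    swap
    · exact hbad hb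
    have hG₁' := hG₁.congr (G' := fun x => ∑ j, hr j * (γ j * (γ j - 1)) * x ^ γ j) hb₁
    have hG₂' := hG₂.congr (G' := fun x => ∑ j, hr j * (γ j ^ 2 * (γ j - 1)) * x ^ γ j) hb₂
    exact (norm_level_piece_le hphase hA hX hP hRA hG₁' hG₂' hD1 hdl hc0 hC0
      (hlow hB₁l l₁) (hhigh B₁u t₁) (hlow hB₂l l₂) (hhigh B₂u t₂) hq0 E1 E2 E3 E4).trans hK2le
  have htotal := norm_sum_Ioc_le_of_breakpoints
    (fun n => ((ArithmeticFunction.vonMangoldt n : ℝ) : ℂ) * expChar (f n)) (Z₁ ∪ Z₂)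
    (by positivity) hpiece #(Z₁ ∪ Z₂) ⌊X⌋₊ le_rfl (card_filter_le _ _)
  have hcardZ : (#(Z₁ ∪ Z₂) : ℝ) + 1 ≤ ((2 * (2 * (k + 1)) * (2 * w + 2)) + 1) * D := by
    have h1 : #(Z₁ ∪ Z₂) ≤ 2 * ((I + 1) * (2 * (k + 1))) := by
      refine (card_union_le _ _).trans ?_
      rw [hSk] at hZ₁ hZ₂
      omega
    have h2 : (#(Z₁ ∪ Z₂) : ℝ) ≤ 2 * ((I + 1) * (2 * (k + 1))) := by exact_mod_cast h1
    have h3 : (I + 1 : ℝ) ≤ (2 * w + 2) * D := hI3.trans (by gcongr)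
    calc (#(Z₁ ∪ Z₂) : ℝ) + 1 ≤ 2 * (((2 * w + 2) * D) * (2 * (k + 1))) + D := by
          have : 2 * ((I + 1 : ℝ) * (2 * (k + 1))) ≤ 2 * (((2 * w + 2) * D) * (2 * (k + 1))) := by
            gcongr
          linarith
      _ = _ := by ring
  have hgoal : mangoldtExpSum k γ h α X X₁ =
      ∑ n ∈ Ioc ⌊X⌋₊ R₀, ((ArithmeticFunction.vonMangoldt n : ℝ) : ℂ) * expChar (f n) := rfl
  rw [hgoal]
  refine htotal.trans ?_
  calc ((#(Z₁ ∪ Z₂) : ℝ) + 1) * (K₃ * (D ^ 3 * V))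
      ≤ (((2 * (2 * (k + 1)) * (2 * w + 2)) + 1) * D) * (K₃ * (D ^ 3 * V)) := by gcongr
    _ = ((2 * (2 * (k + 1)) * (2 * w + 2)) + 1) * CD ^ 4 * K₃ * ((X ^ ε) ^ 4 * V) := by
        rw [hD]; ring
    _ ≤ _ := by
        apply mul_le_mul_of_nonneg_left _ (by positivity)
        rw [hV, ← Real.rpow_natCast, ← Real.rpow_mul hX0.le, ← Real.rpow_add hX0]
        apply Real.rpow_le_rpow_of_exponent_le hX
        push_cast
        rw [hq, hη]
        linarith
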